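/- **Setting.** Let $d\ge 0$ and let $c_x:\mathbb N\to\mathbb R$, $x\in\mathbb Z^d$, be jump rates with $c_x(0)=0$. Suppose that for some constants $c_1,a_1,a_2>0$ and an integer $k_0$, for all $x\in\mathbb Z^d$ and $k\in\mathbb N$, $$c_x(k)\ge c_1k,\qquad \text{(LG)}\ \ |c_x(k+1)-c_x(k)|\le a_1,\qquad \text{(M)}\ \ c_x(k+k_0)-c_x(k)\ge a_2 .$$ Write $c_x(k)!=c_x(k)c_x(k-1)\cdots c_x(1)$ and $c_x(0)!=1$. For a finite nonempty $\Lambda\subset\mathbb Z^d$ and $\varphi>0$, let $\mu_{\Lambda,\varphi}$ be the product measure on $\mathbb N^\Lambda$ with marginals $\mu_{\{x\},\varphi}(\eta_x=k)=\varphi^k/(c_x(k)!\,Z_x(\varphi))$, where $Z_x(\varphi)=\sum_{k\ge0}\varphi^k/c_x(k)!$. Let $\rho_\Lambda(\varphi)=|\Lambda|^{-1}\sum_{x\in\Lambda}\mu_{\Lambda,\varphi}[\eta_x]$, and let $\varphi_\Lambda(\rho)$ be the value $\varphi>0$ with $\rho_\Lambda(\varphi)=\rho$. For $r\in\mathbb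 N$, let $\nu_{\Lambda,r}$ be the probability measure on $\{\eta\in\mathbb N^\Lambda:\sum_{x\in\Lambda}\eta_x=r\}$ proportional to $\prod_{x\in\Lambda}1/c_x(\eta_x)!$. Let $e_1(n)>0$ and $e_2(n)$ be constants, $n\ge2$. Condition (E) for $\Lambda$ says: if $|\Lambda|\ge2$, then for all integers $r\ge1$ $$\text{(E)}\qquad e_1(|\Lambda|)\le\sqrt r\;\mu_{\Lambda,\varphi_\Lambda(r/|\Lambda|)}\Big(\sum_{x\in\Lambda}\eta_x=r\Big)\le e_2(|\Lambda|).$$ Let $\Lambda=\Lambda_1\cup\Lambda_2\subset\mathbb Z^d$ be finite with $\Lambda_1,\Lambda_2$ disjoint and $|\Lambda_1|=|\Lambda_2|\ge1$, let $R_1=\sum_{x\in\Lambda_1}\eta_x$, and let $\gamma_1(k)=\nu_{\Lambda,r}(R_1=k)$, a probability measure on $\{0,\dots,r\}$. It is reversible for the birth and death chain on $\{0,\dots,r\}$ with generator $$L^{bd}\psi(k)=\Big[\tfrac{\gamma_1(k+1)}{\gamma_1(k)}\wedge1\Big]\{\psi(k+1)-\psi(k)\}+\Big[\tfrac{\gamma_1(k-1)}{\gamma_1(k)}\wedge1\Big]\{\psi(k-1)-\psi(k)\}$$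 (with $\gamma_1(-1)=\gamma_1(r+1)=0$) and Dirichlet form $$D^{bd}(\psi)=\gamma_1[\psi(-L^{bd})\psi]=\sum_{k=1}^r[\gamma_1(k)\wedge\gamma_1(k-1)]\{\psi(k)-\psi(k-1)\}^2 .$$ Let $H(\psi|\gamma_1)=\gamma_1[\psi\log\psi]-\gamma_1[\psi]\log\gamma_1[\psi]$, with $0\log0=0$. **Proposition.** There is a constant $C>0$, depending only on $c_1,a_1,a_2,k_0$ and on $e_1(\cdot),e_2(\cdot)$, such that for all $d$, all rates as above, all $\Lambda=\Lambda_1\cup\Lambda_2$ as above for which (E) holds for $\Lambda_1$, $\Lambda_2$ and $\Lambda$, all $r\in\mathbb N$ and all $\psi:\{0,\dots,r\}\to[0,\infty)$, $$H(\psi|\gamma_1)\le C\,r\,D^{bd}(\sqrt\psi).$$ In particular $C$ does not depend on the sites, on $|\Lambda|$ or on $r$. -/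

import Mathlib

open Finset

/-! ## Inhomogeneous zero range process: rates, canonical and grand canonical measures -/

section ZeroRange

variable {V : Type*}

/-- The factorial `c_x(k)! = c_x(k) ⋯ c_x(1)` of a rate function `u = c_x`, with `u(0)! = 1`. -/
def rateFactorial (u : ℕ → ℝ) (k : ℕ) : ℝ := ∏ j ∈ range k, u (j + 1)

/-- Admissible jump rates: `c_x(0) = 0`, and `c_x(k) ≥ c₁ k` uniformly in the site `x`, with
`c₁ > 0`; in particular `c_x(k) > 0` for `k ≥ 1`. -/
def AdmissibleRates (c₁ : ℝ) (c : V → ℕ → ℝ) : Prop :=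
  0 < c₁ ∧ (∀ x, c x 0 = 0) ∧ ∀ (x : V) (k : ℕ), c₁ * (k : ℝ) ≤ c x k

/-- Condition (LG), Lipschitz growth, uniform in the site. -/
def LipschitzGrowth (a₁ : ℝ) (c : V → ℕ → ℝ) : Prop :=
  ∀ x k, |c x (k + 1) - c x k| ≤ a₁

/-- Condition (M), weak monotonicity, uniform in the site. -/
def WeakMonotone (a₂ : ℝ) (k₀ : ℕ) (c : V → ℕ → ℝ) : Prop :=
  0 < a₂ ∧ ∀ x k, a₂ ≤ c x (k + k₀) - c x k

/-- The single-site partition function `Z_x(φ) = ∑_k φ^k / c_x(k)!`. -/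
noncomputable def sitePartition (u : ℕ → ℝ) (φ : ℝ) : ℝ :=
  ∑' k : ℕ, φ ^ k / rateFactorial u k

/-- The single-site grand canonical mass `μ_{x,φ}(η_x = k)`. -/
noncomputable def siteMass (u : ℕ → ℝ) (φ : ℝ) (k : ℕ) : ℝ :=
  φ ^ k / (rateFactorial u k * sitePartition u φ)

/-- The density `ρ_x(φ) = μ_{x,φ}[η_x]` at one site. -/
noncomputable def siteDensity (u : ℕ → ℝ) (φ : ℝ) : ℝ :=
  ∑' k : ℕ, (k : ℝ) * siteMass u φ k

/-- The overall density `ρ_Λ(φ) = |Λ|⁻¹ ∑_{x ∈ Λ} ρ_x(φ)`. -/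
noncomputable def volumeDensity (c : V → ℕ → ℝ) (Λ : Finset V) (φ : ℝ) : ℝ :=
  (∑ x ∈ Λ, siteDensity (c x) φ) / (#Λ : ℝ)

variable [DecidableEq V]

/-- The probability `μ_{Λ,φ}(∑_{x ∈ Λ} η_x = r)` under the grand canonical product measure.
`Finset.piAntidiag Λ r` is the finite set of configurations on `Λ` (extended by `0`) with
`r` particles. -/
noncomputable def grandCanonicalTotal (c : V → ℕ → ℝ) (Λ : Finset V) (φ : ℝ) (r : ℕ) : ℝ :=
  ∑ η ∈ piAntidiag Λ r, ∏ x ∈ Λ, siteMass (c x) φ (η x)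

/-- Condition (E) for the volume `Λ`: if `|Λ| ≥ 2`, then for all `r ≥ 1` the quantity
`√r μ_{Λ,φ}(R = r)` lies between two constants `0 < e₁(|Λ|)` and `e₂(|Λ|)`, which may
depend on the size of the volume; here `φ = φ_Λ(r / |Λ|)` is the parameter in `(0, ∞)`
with `ρ_Λ(φ) = r / |Λ|`. -/
def ConditionE (e₁ e₂ : ℕ → ℝ) (c : V → ℕ → ℝ) (Λ : Finset V) : Prop :=
  2 ≤ #Λ → 0 < e₁ #Λ ∧ ∀ r : ℕ, 1 ≤ r → ∀ φ : ℝ, 0 < φ →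
    volumeDensity c Λ φ = (r : ℝ) / (#Λ : ℝ) →
      e₁ #Λ ≤ √(r : ℝ) * grandCanonicalTotal c Λ φ r ∧
      √(r : ℝ) * grandCanonicalTotal c Λ φ r ≤ e₂ #Λ

/-- The weight `∏_{x ∈ Λ} 1 / c_x(η_x)!` of a configuration. -/
noncomputable def configWeight (c : V → ℕ → ℝ) (Λ : Finset V) (η : V → ℕ) : ℝ :=
  ∏ x ∈ Λ, (rateFactorial (c x) (η x))⁻¹

/-- The canonical measure `ν_{Λ,r}(η)` of a configuration `η` on `Λ` with `r` particles. -/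
noncomputable def canonicalMass (c : V → ℕ → ℝ) (Λ : Finset V) (r : ℕ) (η : V → ℕ) : ℝ :=
  configWeight c Λ η / ∑ ξ ∈ piAntidiag Λ r, configWeight c Λ ξ

/-- `γ₁(k) = ν_{Λ,r}(R₁ = k)`, with `Λ = Λ₁ ∪ Λ₂` and `R₁` the number of particles in `Λ₁`. -/
noncomputable def halfLaw (c : V → ℕ → ℝ) (Λ₁ Λ₂ : Finset V) (r k : ℕ) : ℝ :=
  ∑ η ∈ (piAntidiag (Λ₁ ∪ Λ₂) r).filter (fun η => ∑ x ∈ Λ₁, η x = k),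
    canonicalMass c (Λ₁ ∪ Λ₂) r η

end ZeroRange

/-! ## Birth and death chain on `{0, …, r}` reversible for `γ` -/

/-- The mean of `ψ` under the weights `γ` on `{0, …, r}`. -/
def chainMean (r : ℕ) (γ ψ : ℕ → ℝ) : ℝ := ∑ k ∈ range (r + 1), γ k * ψ k

/-- The entropy `H(ψ|γ) = γ[ψ log ψ] - γ[ψ] log γ[ψ]` (with `0 log 0 = 0`). -/
noncomputable def chainEntropy (r : ℕ) (γ ψ : ℕ → ℝ) : ℝ :=
  chainMean r γ (fun k => ψ k * Real.log (ψ k)) -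
    chainMean r γ ψ * Real.log (chainMean r γ ψ)

/-- The generator `L^{bd}` of the birth and death chain: jumps `k → k ± 1` at rate
`(γ(k ± 1) / γ(k)) ∧ 1`. At `k = 0` the death term vanishes because `k - 1 = k` in `ℕ`;
at `k = r` the birth term vanishes when `γ(r + 1) = 0`. -/
noncomputable def bdGenerator (γ ψ : ℕ → ℝ) (k : ℕ) : ℝ :=
  min (γ (k + 1) / γ k) 1 * (ψ (k + 1) - ψ k) +
    min (γ (k - 1) / γ k) 1 * (ψ (k - 1) - ψ k)

/-- The Dirichlet form `D^{bd}(ψ) = γ[ψ (-L^{bd}) ψ]`. -/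
noncomputable def bdDirichlet (r : ℕ) (γ ψ : ℕ → ℝ) : ℝ :=
  chainMean r γ (fun k => ψ k * -(bdGenerator γ ψ k))

/-- For weights that are positive on `{0, …, r}` and vanish at `r + 1`,
`D^{bd}(ψ) = ∑_{k=1}^r (γ(k) ∧ γ(k-1)) (ψ(k) - ψ(k-1))²` (indexed by `k - 1` below). -/
theorem bdDirichlet_eq (r : ℕ) (γ ψ : ℕ → ℝ) (hpos : ∀ k ≤ r, 0 < γ k)
    (hend : γ (r + 1) = 0) :
    bdDirichlet r γ ψ =
      ∑ k ∈ range r, min (γ (k + 1)) (γ k) * (ψ (k + 1) - ψ k) ^ 2 := by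
  have h1 : ∀ k ∈ range (r + 1), γ k * (ψ k * -(bdGenerator γ ψ k)) =
      -(min (γ (k + 1)) (γ k) * (ψ k * (ψ (k + 1) - ψ k))) -
        min (γ (k - 1)) (γ k) * (ψ k * (ψ (k - 1) - ψ k)) := by
    intro k hk
    have hk0 : 0 < γ k := hpos k (Nat.lt_succ_iff.mp (mem_range.mp hk))
    have hm : ∀ a : ℝ, min a (γ k) = γ k * min (a / γ k) 1 := by
      intro a
      rw [mul_min_of_nonneg _ _ hk0.le, mul_one, mul_div_cancel₀ _ hk0.ne']
    rw [hm, hm, bdGenerator]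
    ring
  have hz : min (γ (r + 1)) (γ r) = 0 := by
    rw [hend]; exact min_eq_left (hpos r le_rfl).le
  rw [bdDirichlet, chainMean, sum_congr rfl h1, sum_sub_distrib, sum_range_succ, hz,
    sum_range_succ' _ r]
  simp only [Nat.add_sub_cancel, Nat.zero_sub, sub_self, mul_zero, zero_mul, neg_zero, add_zero]
  rw [← sum_sub_distrib]
  refine sum_congr rfl fun k _ => ?_
  rw [min_comm (γ k)]
  ring

/-! ## The law `γ₁` is a positive probability on `{0, …, r}`, so `bdDirichlet_eq` applies to it -/

theorem rateFactorial_pos {u : ℕ → ℝ} (hu : ∀ k, 0 < u (k + 1)) (k : ℕ) :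
    0 < rateFactorial u k := prod_pos fun j _ => hu j

theorem configWeight_pos {V : Type*} {c : V → ℕ → ℝ} (hc : ∀ x k, 0 < c x (k + 1))
    (Λ : Finset V) (η : V → ℕ) : 0 < configWeight c Λ η :=
  prod_pos fun x _ => inv_pos.mpr (rateFactorial_pos (hc x) _)

theorem halfLaw_pos {V : Type*} [DecidableEq V] {c : V → ℕ → ℝ} (hc : ∀ x k, 0 < c x (k + 1))
    {Λ₁ Λ₂ : Finset V} (hd : Disjoint Λ₁ Λ₂) (h₁ : Λ₁.Nonempty) (h₂ : Λ₂.Nonempty)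
    {r k : ℕ} (hk : k ≤ r) : 0 < halfLaw c Λ₁ Λ₂ r k := by
  obtain ⟨a, ha⟩ := h₁
  obtain ⟨b, hb⟩ := h₂
  have hb1 : b ∉ Λ₁ := fun h => disjoint_left.mp hd h hb
  have ha2 : a ∉ Λ₂ := fun h => disjoint_left.mp hd ha h
  have hs1 : ∑ x ∈ Λ₁, (Pi.single a k + Pi.single b (r - k) : V → ℕ) x = k := by
    simp [sum_add_distrib, Pi.single_apply, ha, hb1]
  have hs2 : ∑ x ∈ Λ₂, (Pi.single a k + Pi.single b (r - k) : V → ℕ) x = r - k := by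
    simp [sum_add_distrib, Pi.single_apply, hb, ha2]
  have hmem : (Pi.single a k + Pi.single b (r - k) : V → ℕ) ∈ piAntidiag (Λ₁ ∪ Λ₂) r := by
    rw [mem_piAntidiag]
    refine ⟨?_, ?_⟩
    · rw [sum_union hd, hs1, hs2]; omega
    · intro i hi
      by_contra hn
      rw [mem_union, not_or] at hn
      have e1 : i ≠ a := fun h => hn.1 (h ▸ ha)
      have e2 : i ≠ b := fun h => hn.2 (h ▸ hb)
      simp [e1, e2] at hi
  have hZ : 0 < ∑ ξ ∈ piAntidiag (Λ₁ ∪ Λ₂) r, configWeight c (Λ₁ ∪ Λ₂) ξ :=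
    sum_pos (fun ξ _ => configWeight_pos hc _ ξ) ⟨_, hmem⟩
  exact sum_pos (fun η _ => div_pos (configWeight_pos hc _ η) hZ)
    ⟨_, mem_filter.mpr ⟨hmem, hs1⟩⟩

theorem halfLaw_eq_zero {V : Type*} [DecidableEq V] (c : V → ℕ → ℝ) {Λ₁ Λ₂ : Finset V}
    (hd : Disjoint Λ₁ Λ₂) {r k : ℕ} (hk : r < k) : halfLaw c Λ₁ Λ₂ r k = 0 := by
  refine sum_eq_zero fun η hη => ?_
  rw [mem_filter, mem_piAntidiag, sum_union hd] at hη
  omega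

theorem sum_halfLaw {V : Type*} [DecidableEq V] {c : V → ℕ → ℝ} (hc : ∀ x k, 0 < c x (k + 1))
    {Λ₁ Λ₂ : Finset V} (hd : Disjoint Λ₁ Λ₂) (h₁ : Λ₁.Nonempty) (r : ℕ) :
    ∑ k ∈ range (r + 1), halfLaw c Λ₁ Λ₂ r k = 1 := by
  have hne : (piAntidiag (Λ₁ ∪ Λ₂) r).Nonempty := by
    obtain ⟨a, ha⟩ := h₁
    refine ⟨Pi.single a r, mem_piAntidiag.mpr ⟨?_, fun i hi => ?_⟩⟩
    · simp [Pi.single_apply, ha]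
    · have : i = a := by
        by_contra h
        simp [h] at hi
      simp [this, ha]
  have hZ : 0 < ∑ ξ ∈ piAntidiag (Λ₁ ∪ Λ₂) r, configWeight c (Λ₁ ∪ Λ₂) ξ :=
    sum_pos (fun ξ _ => configWeight_pos hc _ ξ) hne
  simp only [halfLaw]
  rw [sum_fiberwise_of_maps_to]
  · simp only [canonicalMass]
    rw [← sum_div, div_self hZ.ne']
  · intro η hη
    rw [mem_piAntidiag, sum_union hd] at hη
    rw [mem_range]
    omega

/-! ## A discrete Hardy inequality -/

/-! The proof treats each half of the volume as a single site, shows that `γ₁` is comparable to a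
Boltzmann weight `exp (-E)` with `E` of curvature at least a constant over `r`, and derives the
inequality from a Hardy criterion.

Reduction to two sites. Let `W(k)` be the total weight of the configurations on `Λ` with `k`
particles and put `u(k+1) = |Λ| W(k) / W(k+1)`, so that `u(k)! = |Λ|^k / W(k)`. The halves have
equal size, so the powers of the size cancel and `γ₁(k)` is proportional to `1 / (u(k)! v(r-k)!)`,
with `u`, `v` the effective rates of the halves. By `volumeRate_tame` these rates obey bounds that
do not see the volume: `c₁ k ≤ u(k) ≤ a₁ k`, `u(k+1) ≤ u(k) + a₁`, and `K e^t - log Z(e^t)` is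
convex. For one site the convexity is a variance bound that follows from (LG) and (M); it passes to
volumes because log partition functions add up.

Boltzmann form. For every `φ = e^τ`, `1/u(k)!` is the site mass of `k` times `√φ` times `exp (log
Z(φ) - (k + 1/2) τ)`. With `τ` minimising the exponent, mass times `√φ` lies between positive
constants (`exists_inv_rateFactorial_bounds`). The minimal exponent is a concave conjugate; the
curvature of `log Z` is of order at most `r` at the relevant `τ`, so by duality its second
differences are at most `-η/r` (`legendre_second_diff`).

Log-Sobolev inequality (`chain_logSobolev`). The entropy is at most a constant times a variance
about the minimiser of `E`, with an extra weight `1 + h` where `γ[e^h] ≤ 2`. On each side of the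
minimiser the Hardy inequality reduces the claim to a bound of order `r` on weighted tail times
resistance (`tail_mul_resistance_le`). There the weight `h` costs the logarithm of the tail, and
convexity of `E` pays for it. -/

theorem sum_div_sqrt_partialSum_le (a : ℕ → ℝ) (n : ℕ) (ha : ∀ i < n, 0 ≤ a i) :
    ∑ k ∈ range n, a k / √(∑ j ∈ range (k + 1), a j) ≤ 2 * √(∑ j ∈ range n, a j) := by
  induction n with
  | zero => simp
  | succ n ih =>
    have h0 : 0 ≤ ∑ j ∈ range n, a j :=
      sum_nonneg fun i hi => ha i ((mem_range.1 hi).trans n.lt_succ_self)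
    have hn := ha n n.lt_succ_self
    rw [sum_range_succ]
    refine (add_le_add_left (ih fun i hi => ha i (hi.trans n.lt_succ_self)) _).trans ?_
    set s := ∑ j ∈ range n, a j
    have hs : ∑ j ∈ range (n + 1), a j = s + a n := sum_range_succ _ _
    rw [hs]
    rcases hn.eq_or_lt with h | h
    · rw [← h]; simp
    · have hp : 0 < √(s + a n) := Real.sqrt_pos.2 (by linarith)
      have e1 := Real.sq_sqrt (show 0 ≤ s + a n by linarith)
      have e2 := Real.sq_sqrt h0
      -- Discrete form of the integral of `1/√x`: each term is bounded by an increment of `2√x`.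
      have : a n / √(s + a n) ≤ 2 * √(s + a n) - 2 * √s := by
        rw [div_le_iff₀ hp]
        nlinarith [sq_nonneg (√(s + a n) - √s)]
      linarith

/-- Muckenhoupt's argument: Cauchy–Schwarz with the auxiliary weight `√S`, where `S` is the
resistance from the origin, followed by an exchange of the sums. The constant 4 is a factor 2 from
each of the two square-root summations. -/
theorem discrete_hardy (R : ℕ) (u v d : ℕ → ℝ) (B : ℝ) (hu : ∀ i < R, 0 ≤ u i)
    (hv : ∀ i < R, 0 < v i)
    (hB : ∀ k < R, (∑ j ∈ Ico k R, u j) * (∑ j ∈ range (k + 1), (v j)⁻¹) ≤ B) :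
    ∑ k ∈ range R, u k * (∑ j ∈ range (k + 1), d j) ^ 2 ≤
      4 * B * ∑ j ∈ range R, v j * d j ^ 2 := by
  set S : ℕ → ℝ := fun k => ∑ j ∈ range (k + 1), (v j)⁻¹ with hS
  set U : ℕ → ℝ := fun k => ∑ j ∈ Ico k R, u j with hU
  have hSpos : ∀ k < R, 0 < S k := fun k hk =>
    sum_pos (fun j hj => inv_pos.2 (hv j (by have := mem_range.1 hj; omega))) ⟨0, by simp⟩
  have hUnn : ∀ k, 0 ≤ U k := fun k => sum_nonneg fun j hj => hu j (mem_Ico.1 hj).2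
  have hcs : ∀ k < R, (∑ j ∈ range (k + 1), d j) ^ 2 ≤
      (∑ j ∈ range (k + 1), v j * d j ^ 2 * √(S j)) * (2 * √(S k)) := by
    intro k hk
    have h1 : (∑ j ∈ range (k + 1), d j) ^ 2 ≤
        (∑ j ∈ range (k + 1), v j * d j ^ 2 * √(S j)) *
          ∑ j ∈ range (k + 1), (v j)⁻¹ / √(S j) := by
      refine sum_sq_le_sum_mul_sum_of_sq_le_mul _ (fun j hj => ?_) (fun j hj => ?_) fun j hj => ?_
      · have := hv j (by have := mem_range.1 hj; omega)
        positivity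
      · have := hv j (by have := mem_range.1 hj; omega)
        positivity
      · have h := hv j (by have := mem_range.1 hj; omega)
        have h' : 0 < √(S j) := Real.sqrt_pos.2 (hSpos j (by have := mem_range.1 hj; omega))
        refine le_of_eq ?_
        field_simp
    refine h1.trans (mul_le_mul_of_nonneg_left ?_ (sum_nonneg fun j hj => ?_))
    · exact sum_div_sqrt_partialSum_le (fun j => (v j)⁻¹) (k + 1)
        fun i hi => (inv_pos.2 (hv i (by omega))).le
    · have := hv j (by have := mem_range.1 hj; omega)
      positivity
  -- The hypothesis gives `√(U S) ≤ √B`, and `u / √U` is at most twice a decrement of `√U`, so the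
  -- sum telescopes from the top.
  have htail : ∀ j ≤ R, ∑ k ∈ Ico j R, u k * √(S k) ≤ 2 * √B * √(U j) := by
    intro j hj
    induction hj using Nat.decreasingInduction with
    | self => simp; positivity
    | of_succ j hj ih =>
      rw [sum_eq_sum_Ico_succ_bot hj]
      have hUj : U j = u j + U (j + 1) := sum_eq_sum_Ico_succ_bot hj _
      have h1 : √(U j) * √(S j) ≤ √B := by
        rw [← Real.sqrt_mul (hUnn j)]
        exact Real.sqrt_le_sqrt (hB j hj)
      have e1 := Real.sq_sqrt (hUnn j)
      have e2 := Real.sq_sqrt (hUnn (j + 1))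
      have hle : √(U (j + 1)) ≤ √(U j) := Real.sqrt_le_sqrt (by linarith [hu j hj])
      have h2 : u j ≤ 2 * √(U j) * (√(U j) - √(U (j + 1))) := by
        nlinarith [sq_nonneg (√(U j) - √(U (j + 1)))]
      have h3 : u j * √(S j) ≤ 2 * √B * (√(U j) - √(U (j + 1))) := by
        calc u j * √(S j) ≤ 2 * √(U j) * (√(U j) - √(U (j + 1))) * √(S j) := by gcongr
          _ = 2 * (√(U j) * √(S j)) * (√(U j) - √(U (j + 1))) := by ring
          _ ≤ _ := by
            refine mul_le_mul_of_nonneg_right (by linarith) (by linarith)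
      linarith
  calc ∑ k ∈ range R, u k * (∑ j ∈ range (k + 1), d j) ^ 2
      ≤ ∑ k ∈ range R, ∑ j ∈ range (k + 1), 2 * (v j * d j ^ 2 * √(S j)) * (u k * √(S k)) := by
        refine sum_le_sum fun k hk => ?_
        have hk' := mem_range.1 hk
        refine (mul_le_mul_of_nonneg_left (hcs k hk') (hu k hk')).trans_eq ?_
        rw [sum_mul, mul_sum]
        exact sum_congr rfl fun j _ => by ring
    _ = ∑ j ∈ range R, ∑ k ∈ Ico j R, 2 * (v j * d j ^ 2 * √(S j)) * (u k * √(S k)) := by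
        refine sum_comm' fun k j => ?_
        simp only [mem_range, mem_Ico]
        omega
    _ ≤ ∑ j ∈ range R, 4 * B * (v j * d j ^ 2) := by
        refine sum_le_sum fun j hj => ?_
        have hj' := mem_range.1 hj
        have hvj := hv j hj'
        rw [← mul_sum]
        have hB0 : 0 ≤ B := le_trans (mul_nonneg (hUnn j) (hSpos j hj').le) (hB j hj')
        have h1 : √(S j) * √(U j) ≤ √B := by
          rw [← Real.sqrt_mul (hSpos j hj').le]
          exact Real.sqrt_le_sqrt (by rw [mul_comm]; exact hB j hj')
        calc 2 * (v j * d j ^ 2 * √(S j)) * ∑ k ∈ Ico j R, u k * √(S k)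
            ≤ 2 * (v j * d j ^ 2 * √(S j)) * (2 * √B * √(U j)) := by
              gcongr; exact htail j hj'.le
          _ = 4 * (v j * d j ^ 2) * √B * (√(S j) * √(U j)) := by ring
          _ ≤ 4 * (v j * d j ^ 2) * √B * √B := by gcongr
          _ = 4 * (v j * d j ^ 2) * (√B * √B) := by ring
          _ = _ := by rw [Real.mul_self_sqrt hB0]; ring
    _ = _ := by rw [mul_sum]

/-! ## Sums against strongly convex energies -/

theorem sum_exp_neg_mul_le {s : ℝ} (hs : 0 < s) (N : ℕ) :
    ∑ i ∈ range N, Real.exp (-(s * i)) ≤ 1 + 1 / s := by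
  have h1 : ∀ i : ℕ, Real.exp (-(s * i)) = Real.exp (-s) ^ i := fun i => by
    rw [← Real.exp_nat_mul]; ring_nf
  have hlt : Real.exp (-s) < 1 := Real.exp_zero ▸ Real.exp_lt_exp.2 (by linarith)
  simp only [h1]
  have h2 : ∑ i ∈ range N, Real.exp (-s) ^ i ≤ (1 - Real.exp (-s))⁻¹ := by
    rw [← tsum_geometric_of_lt_one (Real.exp_pos _).le hlt]
    exact (summable_geometric_of_lt_one (Real.exp_pos _).le hlt).sum_le_tsum _
      fun i _ => by positivity
  refine h2.trans ?_
  have h3 : Real.exp (-s) ≤ 1 / (1 + s) := by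
    rw [Real.exp_neg, ← one_div]
    exact one_div_le_one_div_of_le (by linarith) (by linarith [Real.add_one_le_exp s])
  have h4 : s / (1 + s) ≤ 1 - Real.exp (-s) := by
    have : s / (1 + s) = 1 - 1 / (1 + s) := by field_simp; ring
    linarith
  calc (1 - Real.exp (-s))⁻¹ ≤ (s / (1 + s))⁻¹ := inv_anti₀ (by positivity) h4
    _ = 1 + 1 / s := by field_simp; ring

/-- Up to an additive `c/2`, the quadratic exponent dominates the line of slope `c / (2√r)`, which
leaves a geometric series with sum of order `√r`. -/
theorem sum_exp_neg_quadratic_le {c : ℝ} (hc : 0 < c) {r : ℝ} (hr : 1 ≤ r) (N : ℕ) :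
    ∑ i ∈ range N, Real.exp (-(c / r * (i * (i - 1) / 2))) ≤
      Real.exp (c / 2) * (1 + 2 / c) * √r := by
  have hs1 : 1 ≤ √r := Real.one_le_sqrt.2 hr
  have hs : √r ^ 2 = r := Real.sq_sqrt (by linarith)
  have hterm : ∀ i : ℕ, Real.exp (-(c / r * (i * (i - 1) / 2))) ≤
      Real.exp (c / 2) * Real.exp (-((c / (2 * √r)) * i)) := by
    intro i
    rw [← Real.exp_add]
    refine Real.exp_le_exp.2 ?_
    have : c / 2 + -((c / (2 * √r)) * i) + (c / r * (i * (i - 1) / 2)) =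
        c / (2 * r) * (√r ^ 2 - √r * i + i * (i - 1)) := by
      generalize √r = s at *
      subst hs
      have : s ≠ 0 := by positivity
      field_simp
      ring
    have h2 : 0 ≤ √r ^ 2 - √r * i + (i : ℝ) * (i - 1) := by
      rcases Nat.eq_zero_or_pos i with h | h
      · subst h; simp
      rcases Nat.lt_or_ge i 2 with h' | h'
      · have : i = 1 := by omega
        subst this; simp; nlinarith
      · have : (2 : ℝ) ≤ i := by exact_mod_cast h'
        nlinarith [sq_nonneg (2 * √r - i), sq_nonneg ((i : ℝ) - 2), mul_self_nonneg (√r - i)]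
    have h3 : 0 ≤ c / (2 * r) * (√r ^ 2 - √r * i + i * (i - 1)) :=
      mul_nonneg (by positivity) h2
    linarith
  calc _ ≤ ∑ i ∈ range N, Real.exp (c / 2) * Real.exp (-((c / (2 * √r)) * i)) :=
        sum_le_sum fun i _ => hterm i
    _ = Real.exp (c / 2) * ∑ i ∈ range N, Real.exp (-((c / (2 * √r)) * i)) := by rw [mul_sum]
    _ ≤ Real.exp (c / 2) * (1 + 1 / (c / (2 * √r))) := by
        gcongr; exact sum_exp_neg_mul_le (by positivity) N
    _ ≤ Real.exp (c / 2) * ((1 + 2 / c) * √r) := by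
        gcongr
        have : 1 / (c / (2 * √r)) = 2 / c * √r := by field_simp
        rw [this]; linarith
    _ = _ := by ring

/-! ### Slopes of uniformly convex sequences. -/

section ConvexSequence

variable {E : ℕ → ℝ} {R : ℕ} {κ : ℝ}

theorem slope_growth (hE : ∀ i, i + 2 ≤ R → κ ≤ E (i + 2) - 2 * E (i + 1) + E i) {i j : ℕ}
    (hij : i ≤ j) (hj : j + 1 ≤ R) :
    κ * ((j : ℝ) - i) ≤ (E (j + 1) - E j) - (E (i + 1) - E i) := by
  induction j, hij using Nat.le_induction with
  | base => simp
  | succ j hij ih =>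
    have h1 := ih (by omega)
    have h2 := hE j hj
    push_cast
    linarith

theorem energy_ge_slope
    (hE : ∀ i, i + 2 ≤ R → κ ≤ E (i + 2) - 2 * E (i + 1) + E i) {i : ℕ} (n : ℕ)
    (hn : i + n ≤ R) :
    (n : ℝ) * (E (i + 1) - E i) + κ * ((n : ℝ) * (n - 1) / 2) ≤ E (i + n) - E i := by
  induction n with
  | zero => simp
  | succ n ih =>
    have h1 := ih (by omega)
    have h2 := slope_growth hE (i := i) (j := i + n) (by omega) (by omega)
    rw [← add_assoc]
    push_cast at h2 ⊢
    linarith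

theorem energy_le_slope (hκ : 0 ≤ κ)
    (hE : ∀ i, i + 2 ≤ R → κ ≤ E (i + 2) - 2 * E (i + 1) + E i) {i : ℕ} (n : ℕ)
    (hn : i + n + 1 ≤ R) :
    E (i + n + 1) - E i ≤ ((n : ℝ) + 1) * (E (i + n + 1) - E (i + n)) := by
  induction n with
  | zero => simp
  | succ n ih =>
    have h1 := ih (by omega)
    have h2 := hE (i + n) (by omega)
    have h3 : (0 : ℝ) ≤ n := n.cast_nonneg
    have e1 : i + (n + 1) + 1 = i + n + 2 := by ring
    have e2 : i + (n + 1) = i + n + 1 := by ring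
    rw [e1, e2]
    push_cast
    nlinarith [mul_nonneg (show (0 : ℝ) ≤ n + 1 by positivity) hκ,
      mul_le_mul_of_nonneg_left h2 (show (0 : ℝ) ≤ n + 1 by positivity)]

/-- Monotonicity of average slopes on adjacent intervals, cleared of denominators so that either
interval may be empty. -/
theorem three_slopes (hκ : 0 ≤ κ)
    (hE : ∀ i, i + 2 ≤ R → κ ≤ E (i + 2) - 2 * E (i + 1) + E i) (i m n : ℕ)
    (h : i + m + n ≤ R) :
    (n : ℝ) * (E (i + m) - E i) ≤ m * (E (i + m + n) - E (i + m)) := by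
  rcases m with _ | m
  · simp
  rcases n with _ | n
  · simp
  have h1 := energy_le_slope hκ hE (i := i) m (by omega)
  have h2 := energy_ge_slope hE (i := i + (m + 1)) (n + 1) h
  have h3 := hE (i + m) (by omega)
  have e1 : i + (m + 1) = i + m + 1 := by ring
  rw [e1] at h h2 ⊢
  have hn : (0 : ℝ) ≤ n := n.cast_nonneg
  have hm : (0 : ℝ) ≤ m := m.cast_nonneg
  push_cast at *
  set d := E (i + m + 1) - E (i + m)
  have h4 : ((n : ℝ) + 1) * d ≤ E (i + m + 1 + (n + 1)) - E (i + m + 1) := by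
    have : ((n : ℝ) + 1) * d ≤ (n + 1) * (E (i + m + 1 + 1) - E (i + m + 1)) := by
      refine mul_le_mul_of_nonneg_left ?_ (by positivity)
      have e2 : i + m + 1 + 1 = i + m + 2 := by ring
      rw [e2]
      linarith
    have h5 : 0 ≤ κ * (((n : ℝ) + 1) * (n + 1 - 1) / 2) := by
      have : ((n : ℝ) + 1 - 1) = n := by ring
      rw [this]; positivity
    linarith
  calc ((n : ℝ) + 1) * (E (i + m + 1) - E i) ≤ (n + 1) * ((m + 1) * d) := by gcongr
    _ = (m + 1) * ((n + 1) * d) := by ring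
    _ ≤ _ := by gcongr

end ConvexSequence

/-- Boltzmann sums to the right and to the left of a point above the minimum of a strongly
convex energy. -/
theorem boltzmann_sum_bounds {c : ℝ} (hc : 0 < c) {r R : ℕ} (hr : 1 ≤ r) {E : ℕ → ℝ}
    (hE : ∀ i, i + 2 ≤ R → c / r ≤ E (i + 2) - 2 * E (i + 1) + E i)
    (h01 : 1 ≤ R → E 0 ≤ E 1) {k : ℕ} (hk : k + 1 ≤ R) :
    (∑ j ∈ Ico k R, Real.exp (-(E (j + 1) - E (k + 1))) ≤
        Real.exp (c / 2) * (1 + 2 / c) * √r) ∧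
    (∑ j ∈ range (k + 1), Real.exp (-(E (k + 1) - E (j + 1))) ≤
        Real.exp (c / 2) * (1 + 2 / c) * √r) ∧
    (∑ j ∈ Ico k R, Real.exp (-(E (j + 1) - E (k + 1))) ≤ 1 + r / (c * (k + 1))) ∧
    (∀ s : ℝ, 0 < s → s * (k + 1) = E (k + 1) - E 0 →
      (∑ j ∈ Ico k R, Real.exp (-(E (j + 1) - E (k + 1))) ≤ 1 + 1 / s) ∧
      (∑ j ∈ range (k + 1), Real.exp (-(E (k + 1) - E (j + 1))) ≤ 1 + 1 / s)) := by
  have hr0 : (0 : ℝ) < r := by exact_mod_cast hr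
  have hr1 : (1 : ℝ) ≤ r := by exact_mod_cast hr
  have hκ : 0 ≤ c / r := by positivity
  have hd : ∀ i, i + 1 ≤ R → c / r * i ≤ E (i + 1) - E i := by
    intro i hi
    have := slope_growth hE (i := 0) (j := i) (by omega) hi
    have h0 := h01 (by omega)
    simp only [Nat.cast_zero, sub_zero, zero_add] at this
    linarith
  have hright : ∑ j ∈ Ico k R, Real.exp (-(E (j + 1) - E (k + 1))) =
      ∑ i ∈ range (R - k), Real.exp (-(E (k + 1 + i) - E (k + 1))) := by
    rw [sum_Ico_eq_sum_range]
    exact sum_congr rfl fun i _ => by rw [show k + i + 1 = k + 1 + i by ring]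
  have hleft : ∑ j ∈ range (k + 1), Real.exp (-(E (k + 1) - E (j + 1))) =
      ∑ i ∈ range (k + 1), Real.exp (-(E (k + 1) - E (k - i + 1))) :=
    (sum_flip fun j => Real.exp (-(E (k + 1) - E (j + 1)))).symm
  have hquadR : ∀ i ∈ range (R - k), (i : ℝ) * (E (k + 1 + 1) - E (k + 1)) +
      c / r * (i * (i - 1) / 2) ≤ E (k + 1 + i) - E (k + 1) := fun i hi =>
    energy_ge_slope hE (i := k + 1) i (by have := mem_range.1 hi; omega)
  have hslopeR : ∀ i ∈ range (R - k), (i : ℝ) * (c / r * (k + 1)) ≤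
      i * (E (k + 1 + 1) - E (k + 1)) := by
    intro i hi
    rcases Nat.eq_zero_or_pos i with h | h
    · simp [h]
    · have := hd (k + 1) (by have := mem_range.1 hi; omega)
      push_cast at this
      gcongr
  have hsq : ∀ i : ℕ, 0 ≤ (i : ℝ) * (i - 1) / 2 := by
    intro i
    rcases Nat.eq_zero_or_pos i with h | h
    · simp [h]
    · have : (1 : ℝ) ≤ i := by exact_mod_cast h
      have : (0 : ℝ) ≤ i - 1 := by linarith
      positivity
  -- The first two bounds come from quadratic growth, the third from the local slope `c (k+1) / r`,
  -- and the last two from the average slope `s` between `0` and `k + 1`, via `three_slopes`.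
  refine ⟨?_, ?_, ?_, fun s hs hsE => ⟨?_, ?_⟩⟩
  · rw [hright]
    refine le_trans (sum_le_sum fun i hi => Real.exp_le_exp.2 (neg_le_neg ?_))
      (sum_exp_neg_quadratic_le hc hr1 (R - k))
    have h1 := hquadR i hi
    have h2 := hslopeR i hi
    have h3 : 0 ≤ (i : ℝ) * (c / r * (k + 1)) := by positivity
    linarith
  · rw [hleft]
    refine le_trans (sum_le_sum fun i hi => Real.exp_le_exp.2 (neg_le_neg ?_))
      (sum_exp_neg_quadratic_le hc hr1 (k + 1))
    have hi' := mem_range.1 hi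
    have h1 := energy_ge_slope hE (i := k - i + 1) i (by omega)
    rw [show k - i + 1 + i = k + 1 by omega] at h1
    have h3 : 0 ≤ (i : ℝ) * (E (k - i + 1 + 1) - E (k - i + 1)) := by
      rcases Nat.eq_zero_or_pos i with h | h
      · simp [h]
      · have h5 := hd (k - i + 1) (by omega)
        have h6 : 0 ≤ c / r * ((k - i + 1 : ℕ) : ℝ) := by positivity
        exact mul_nonneg (by positivity) (by linarith)
    linarith
  · rw [hright]
    have hs : 0 < c / r * ((k : ℝ) + 1) := by positivity
    refine le_trans (sum_le_sum fun i hi => Real.exp_le_exp.2 (neg_le_neg ?_))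
      ((sum_exp_neg_mul_le hs (R - k)).trans_eq (by field_simp))
    have h1 := hquadR i hi
    have h2 := hslopeR i hi
    have h3 := mul_nonneg hκ (hsq i)
    linarith
  · rw [hright]
    refine le_trans (sum_le_sum fun i hi => Real.exp_le_exp.2 (neg_le_neg ?_))
      (sum_exp_neg_mul_le hs (R - k))
    have h1 := three_slopes hκ hE 0 (k + 1) i (by have := mem_range.1 hi; omega)
    rw [zero_add, ← hsE] at h1
    push_cast at h1
    have hk1 : (0 : ℝ) < k + 1 := by positivity
    have : ((k : ℝ) + 1) * (s * i) ≤ (k + 1) * (E (k + 1 + i) - E (k + 1)) := by linarith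
    exact le_of_mul_le_mul_left this hk1
  · rw [hleft]
    refine le_trans (sum_le_sum fun i hi => Real.exp_le_exp.2 (neg_le_neg ?_))
      (sum_exp_neg_mul_le hs (k + 1))
    have hi' := mem_range.1 hi
    have h1 := three_slopes hκ hE 0 (k - i + 1) i (by omega)
    rw [zero_add, show k - i + 1 + i = k + 1 by omega] at h1
    have hk1 : (0 : ℝ) < k + 1 := by positivity
    have e : ((k - i + 1 : ℕ) : ℝ) = k + 1 - i := by
      rw [Nat.cast_add, Nat.cast_sub (by omega)]; push_cast; ring
    rw [e] at h1
    have : ((k : ℝ) + 1) * (s * i) ≤ (k + 1) * (E (k + 1) - E (k - i + 1)) := by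
      have h2 : ((k : ℝ) + 1) * (s * i) = i * (E (k + 1) - E 0) := by rw [← hsE]; ring
      rw [h2]; linarith
    exact le_of_mul_le_mul_left this hk1

/-- Product of the weighted tail and of the resistance, controlled at one point. -/
theorem tail_mul_resistance_le {c A c₃ C₄ : ℝ} (hc : 0 < c) (hA : 1 ≤ A) (hc₃ : 0 < c₃)
    {r R : ℕ} (hr : 1 ≤ r) (hR : R ≤ r) {p h E : ℕ → ℝ}
    (hlow : ∀ i ≤ R, A⁻¹ * Real.exp (-E i) ≤ p i) (hupp : ∀ i ≤ R, p i ≤ A * Real.exp (-E i))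
    (hE : ∀ i, i + 2 ≤ R → c / r ≤ E (i + 2) - 2 * E (i + 1) + E i)
    (h01 : 1 ≤ R → E 0 ≤ E 1) (hE0 : c₃ ≤ √r * Real.exp (-E 0))
    (hC₄ : ∀ i ≤ R, E i - E 0 ≤ C₄ * r)
    (hsum : ∑ i ∈ range (R + 1), p i * Real.exp (h i) ≤ 2) {k : ℕ} (hk : k < R) :
    (∑ j ∈ Ico k R, p (j + 1) * (1 + h (j + 1))) *
        (∑ j ∈ range (k + 1), (min (p j) (p (j + 1)))⁻¹) ≤
      (A + 2) * A * ((Real.exp (c / 2) * (1 + 2 / c)) ^ 2 + 2 + 1 / c + C₄ +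
        Real.exp (c / 2) * (1 + 2 / c) / c₃) * r := by
  have hr0 : (0 : ℝ) < r := by exact_mod_cast hr
  have hA0 : 0 < A := by linarith
  obtain ⟨hG, hS, hGk, hs⟩ := boltzmann_sum_bounds hc hr hE h01 (k := k) hk
  set C₀ := Real.exp (c / 2) * (1 + 2 / c) with hC₀
  set G := ∑ j ∈ Ico k R, Real.exp (-(E (j + 1) - E (k + 1))) with hGdef
  set S := ∑ j ∈ range (k + 1), Real.exp (-(E (k + 1) - E (j + 1))) with hSdef
  have hC₀pos : 0 < C₀ := by positivity
  have hsq : √(r : ℝ) * √r = r := Real.mul_self_sqrt hr0.le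
  have hsq0 : 0 < √(r : ℝ) := Real.sqrt_pos.2 hr0
  have hp : ∀ i ≤ R, 0 < p i := fun i hi => lt_of_lt_of_le (by positivity) (hlow i hi)
  have hG1 : 1 ≤ G := by
    have := single_le_sum (f := fun j => Real.exp (-(E (j + 1) - E (k + 1))))
      (fun j _ => (Real.exp_pos _).le) (mem_Ico.2 ⟨le_rfl, hk⟩)
    simpa [hGdef] using this
  have hG0 : 0 < G := by linarith
  have hS0 : 0 ≤ S := sum_nonneg fun j _ => (Real.exp_pos _).le
  have hmono : ∀ j, j + 1 ≤ R → E j ≤ E (j + 1) := by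
    intro i hi
    have h1 := slope_growth hE (i := 0) (j := i) (by omega) hi
    have h0 := h01 (by omega)
    have h2 : 0 ≤ c / r * (i : ℝ) := by positivity
    simp only [Nat.cast_zero, sub_zero, zero_add] at h1
    linarith
  have hD0 : 0 ≤ E (k + 1) - E 0 := by
    have h1 := energy_ge_slope hE (i := 0) (k + 1) (by omega)
    have h2 := mul_nonneg (show (0 : ℝ) ≤ ((k + 1 : ℕ) : ℝ) by positivity)
      (sub_nonneg.2 (h01 (by omega)))
    have h3 : 0 ≤ c / r * (((k + 1 : ℕ) : ℝ) * (((k + 1 : ℕ) : ℝ) - 1) / 2) := by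
      push_cast
      have : ((k : ℝ) + 1 - 1) = k := by ring
      rw [this]; positivity
    simp only [zero_add] at h1 h2
    linarith
  -- the threshold
  set θ := Real.exp (-E (k + 1)) * G with hθ
  have hθ0 : 0 < θ := by positivity
  -- An upper bound for `-log θ`. The second term comes from `log x ≤ x`; its factor `1/G` cancels
  -- the `G` of the final product.
  set Λ := (E (k + 1) - E 0) + √r / (c₃ * G) with hΛ
  have hΛ0 : 0 ≤ Λ := by positivity
  have hlogθ : -Real.log θ ≤ Λ := by
    rw [hθ, Real.log_mul (Real.exp_pos _).ne' hG0.ne', Real.log_exp]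
    have h1 : E 0 ≤ Real.log (√r / c₃) := by
      rw [Real.le_log_iff_exp_le (by positivity), le_div_iff₀ hc₃]
      calc Real.exp (E 0) * c₃ ≤ Real.exp (E 0) * (√r * Real.exp (-E 0)) := by gcongr
        _ = √r * (Real.exp (E 0) * Real.exp (-E 0)) := by ring
        _ = √r := by rw [← Real.exp_add]; simp
    have h2 : Real.log (√r / c₃) - Real.log G ≤ √r / (c₃ * G) := by
      rw [← Real.log_div (by positivity) hG0.ne', div_div]
      exact Real.log_le_self (by positivity)
    linarith
  have hPsum : ∑ j ∈ Ico k R, p (j + 1) ≤ A * θ := by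
    rw [hθ, hGdef, mul_sum, mul_sum]
    refine sum_le_sum fun j hj => (hupp (j + 1) (mem_Ico.1 hj).2).trans_eq ?_
    rw [← Real.exp_add]
    ring_nf
  have hPexp : ∑ j ∈ Ico k R, p (j + 1) * Real.exp (h (j + 1)) ≤ 2 := by
    refine le_trans ?_ hsum
    rw [sum_range_succ']
    refine le_add_of_le_of_nonneg (sum_le_sum_of_subset_of_nonneg ?_ fun j hj _ => ?_) ?_
    · intro j hj; exact mem_range.2 (mem_Ico.1 hj).2
    · have := hp (j + 1) (mem_range.1 hj)
      positivity
    · have := hp 0 (Nat.zero_le _)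
      positivity
  have hU : ∑ j ∈ Ico k R, p (j + 1) * (1 + h (j + 1)) ≤ (A + 2) * (θ * (1 + Λ)) := by
    -- Young's inequality `1 + h + log θ ≤ θ e^h` exchanges `h` for `e^h`, whose total mass is at
    -- most 2. Since `θ` is the size of the tail, both terms have order `θ (1 + Λ)`.
    have hpt : ∀ j ∈ Ico k R, p (j + 1) * (1 + h (j + 1)) ≤
        p (j + 1) * Λ + θ * (p (j + 1) * Real.exp (h (j + 1))) := by
      intro j hj
      have hpj := hp (j + 1) (mem_Ico.1 hj).2
      have h1 : 1 + (h (j + 1) + Real.log θ) ≤ Real.exp (h (j + 1)) * θ := by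
        have := Real.add_one_le_exp (h (j + 1) + Real.log θ)
        rw [Real.exp_add, Real.exp_log hθ0] at this
        linarith
      nlinarith
    calc _ ≤ ∑ j ∈ Ico k R, (p (j + 1) * Λ + θ * (p (j + 1) * Real.exp (h (j + 1)))) :=
          sum_le_sum hpt
      _ = (∑ j ∈ Ico k R, p (j + 1)) * Λ +
          θ * ∑ j ∈ Ico k R, p (j + 1) * Real.exp (h (j + 1)) := by
          rw [sum_add_distrib, sum_mul, mul_sum]
      _ ≤ A * θ * Λ + θ * 2 := by gcongr
      _ ≤ _ := by nlinarith [mul_nonneg hθ0.le hΛ0]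
  -- `E` increases away from its minimum, so the outer endpoint controls the conductance of each
  -- edge.
  have hSle : ∑ j ∈ range (k + 1), (min (p j) (p (j + 1)))⁻¹ ≤
      A * Real.exp (E (k + 1)) * S := by
    rw [hSdef, mul_sum]
    refine sum_le_sum fun j hj => ?_
    have hj' := mem_range.1 hj
    have hmin : A⁻¹ * Real.exp (-E (j + 1)) ≤ min (p j) (p (j + 1)) := by
      refine le_min (le_trans ?_ (hlow j (by omega))) (hlow (j + 1) (by omega))
      have := hmono j (by omega)
      gcongr
    calc (min (p j) (p (j + 1)))⁻¹ ≤ (A⁻¹ * Real.exp (-E (j + 1)))⁻¹ :=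
          inv_anti₀ (by positivity) hmin
      _ = A * Real.exp (E (j + 1)) := by rw [mul_inv, inv_inv, ← Real.exp_neg, neg_neg]
      _ = _ := by
          rw [mul_assoc, ← Real.exp_add]; ring_nf
  have hmain : G * S * (1 + Λ) ≤ (C₀ ^ 2 + 2 + 1 / c + C₄ + C₀ / c₃) * r := by
    have t1 : G * S ≤ C₀ ^ 2 * r := by
      calc G * S ≤ (C₀ * √r) * (C₀ * √r) := by gcongr
        _ = C₀ ^ 2 * (√r * √r) := by ring
        _ = _ := by rw [hsq]
    have t3 : G * S * (√r / (c₃ * G)) ≤ C₀ / c₃ * r := by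
      calc G * S * (√r / (c₃ * G)) = S * √r / c₃ := by field_simp
        _ ≤ (C₀ * √r) * √r / c₃ := by gcongr
        _ = C₀ / c₃ * (√r * √r) := by ring
        _ = _ := by rw [hsq]
    -- With `s` the average slope, `S ≤ 1 + 1/s` splits the product into `G (k+1)` and `G s (k+1)`.
    -- The first uses the curvature bound on `G`, the second the bound `G ≤ 1 + 1/s`.
    have t2 : G * S * (E (k + 1) - E 0) ≤ (2 + 1 / c + C₄) * r := by
      have hC := hC₄ (k + 1) hk
      rcases hD0.eq_or_lt with h0 | h0
      · rw [← h0, mul_zero]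
        have : 0 ≤ C₄ * r := by linarith
        have h2 : 0 ≤ (2 + 1 / c) * (r : ℝ) := by positivity
        linarith
      · have hk1 : (0 : ℝ) < k + 1 := by positivity
        set s := (E (k + 1) - E 0) / (k + 1) with hsdef
        have hs0 : 0 < s := by positivity
        have hsE : s * (k + 1) = E (k + 1) - E 0 := by rw [hsdef]; field_simp
        obtain ⟨g1, g2⟩ := hs s hs0 hsE
        have hkr : (k : ℝ) + 1 ≤ r := by exact_mod_cast (show k + 1 ≤ r by omega)
        rw [← hsE]
        calc G * S * (s * (k + 1)) ≤ G * (1 + 1 / s) * (s * (k + 1)) := by gcongr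
          _ = G * (k + 1) + G * (s * (k + 1)) := by field_simp; ring
          _ ≤ (1 + r / (c * (k + 1))) * (k + 1) + (1 + 1 / s) * (s * (k + 1)) := by gcongr
          _ = 2 * (k + 1) + r / c + s * (k + 1) := by field_simp; ring
          _ ≤ 2 * r + r / c + C₄ * r := by rw [hsE]; gcongr
          _ = _ := by ring
    rw [hΛ]
    calc G * S * (1 + (E (k + 1) - E 0 + √r / (c₃ * G)))
        = G * S + G * S * (E (k + 1) - E 0) + G * S * (√r / (c₃ * G)) := by ring
      _ ≤ _ := by linarith
  calc _ ≤ (A + 2) * (θ * (1 + Λ)) * (A * Real.exp (E (k + 1)) * S) := by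
        refine mul_le_mul hU hSle (sum_nonneg fun j hj => ?_) (by positivity)
        have hj' := mem_range.1 hj
        exact inv_nonneg.2 (le_min (hp j (by omega)).le (hp (j + 1) (by omega)).le)
    _ = (A + 2) * A * (G * S * (1 + Λ)) * (Real.exp (-E (k + 1)) * Real.exp (E (k + 1))) := by
        rw [hθ]; ring
    _ = (A + 2) * A * (G * S * (1 + Λ)) := by rw [← Real.exp_add]; simp
    _ ≤ (A + 2) * A * ((C₀ ^ 2 + 2 + 1 / c + C₄ + C₀ / c₃) * r) := by gcongr
    _ = _ := by ring

/-- Weighted Hardy inequality on one side of the minimum of a strongly convex energy. -/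
theorem one_sided_hardy {c A c₃ C₄ : ℝ} (hc : 0 < c) (hA : 1 ≤ A) (hc₃ : 0 < c₃)
    {r R : ℕ} (hr : 1 ≤ r) (hR : R ≤ r) {p h E : ℕ → ℝ}
    (hlow : ∀ i ≤ R, A⁻¹ * Real.exp (-E i) ≤ p i) (hupp : ∀ i ≤ R, p i ≤ A * Real.exp (-E i))
    (hE : ∀ i, i + 2 ≤ R → c / r ≤ E (i + 2) - 2 * E (i + 1) + E i)
    (h01 : 1 ≤ R → E 0 ≤ E 1) (hE0 : c₃ ≤ √r * Real.exp (-E 0))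
    (hC₄ : ∀ i ≤ R, E i - E 0 ≤ C₄ * r) (hh : ∀ i, 0 ≤ h i)
    (hsum : ∑ i ∈ range (R + 1), p i * Real.exp (h i) ≤ 2) (f : ℕ → ℝ) :
    ∑ i ∈ range R, p (i + 1) * (1 + h (i + 1)) * (f (i + 1) - f 0) ^ 2 ≤
      4 * ((A + 2) * A * ((Real.exp (c / 2) * (1 + 2 / c)) ^ 2 + 2 + 1 / c + C₄ +
        Real.exp (c / 2) * (1 + 2 / c) / c₃) * r) *
      ∑ i ∈ range R, min (p i) (p (i + 1)) * (f (i + 1) - f i) ^ 2 := by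
  have hp : ∀ i ≤ R, 0 < p i := fun i hi =>
    lt_of_lt_of_le (by have : 0 < A := by linarith
                       positivity) (hlow i hi)
  have := discrete_hardy R (fun i => p (i + 1) * (1 + h (i + 1)))
    (fun i => min (p i) (p (i + 1))) (fun i => f (i + 1) - f i) _
    (fun i hi => mul_nonneg (hp (i + 1) hi).le (by linarith [hh (i + 1)]))
    (fun i hi => lt_min (hp i hi.le) (hp (i + 1) hi))
    (fun k hk => tail_mul_resistance_le hc hA hc₃ hr hR hlow hupp hE h01 hE0 hC₄ hsum hk)
  simpa only [sum_range_sub] using this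

/-! ### From entropy to a weighted variance. -/

/-- For `f ≤ 2(c + s)` the left side is quadratic in `f - (c + s)`; beyond that, `f` is at most
twice `f - c` and the logarithm is `log (1 + (f - c)²/s²)` up to a constant. The shift by `s` keeps
the reference level positive when `c = 0`. -/
theorem sq_mul_log_sq_le {f c s : ℝ} (hf : 0 ≤ f) (hc : 0 ≤ c) (hs : 0 < s) :
    f ^ 2 * Real.log (f ^ 2) - f ^ 2 * Real.log ((c + s) ^ 2) - f ^ 2 + (c + s) ^ 2 ≤
      10 * s ^ 2 + 18 * ((1 + Real.log (1 + (f - c) ^ 2 / s ^ 2)) * (f - c) ^ 2) := by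
  set g := f - c with hg
  set a := c + s with ha
  have ha0 : 0 < a := by positivity
  set h := Real.log (1 + g ^ 2 / s ^ 2) with hh
  have hq : 0 ≤ g ^ 2 / s ^ 2 := by positivity
  have hh0 : 0 ≤ h := Real.log_nonneg (by linarith)
  have hgh : 0 ≤ h * g ^ 2 := by positivity
  rcases le_or_gt f (2 * a) with h2 | h2
  · have key : f ^ 2 * Real.log (f ^ 2) - f ^ 2 * Real.log (a ^ 2) - f ^ 2 + a ^ 2 ≤
        5 * (f - a) ^ 2 := by
      rcases hf.eq_or_lt with h0 | h0
      · rw [← h0]; simp; nlinarith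
      · have hlog : Real.log (f ^ 2) - Real.log (a ^ 2) ≤ 2 * (f / a - 1) := by
          rw [Real.log_pow, Real.log_pow, ← mul_sub, ← Real.log_div h0.ne' ha0.ne']
          have := Real.log_le_sub_one_of_pos (div_pos h0 ha0)
          push_cast
          linarith
        calc f ^ 2 * Real.log (f ^ 2) - f ^ 2 * Real.log (a ^ 2) - f ^ 2 + a ^ 2
            = f ^ 2 * (Real.log (f ^ 2) - Real.log (a ^ 2)) - f ^ 2 + a ^ 2 := by ring
          _ ≤ f ^ 2 * (2 * (f / a - 1)) - f ^ 2 + a ^ 2 := by gcongr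
          _ = (f - a) ^ 2 * (2 * (f / a) + 1) := by field_simp; ring
          _ ≤ (f - a) ^ 2 * (2 * 2 + 1) := by
              gcongr
              rwa [div_le_iff₀ ha0]
          _ = _ := by ring
    have e : f - a = g - s := by rw [hg, ha]; ring
    rw [e] at key
    nlinarith [sq_nonneg (g + s)]
  · have hg2 : f ≤ 2 * g := by rw [hg]; linarith
    have hgs : s ≤ g := by rw [hg]; linarith
    have hg0 : 0 < g := by linarith
    have hf0 : 0 < f := by linarith
    have hlog : Real.log (f ^ 2) - Real.log (a ^ 2) ≤ 2 + h := by
      have h3 : Real.log (f ^ 2) ≤ Real.log (4 * g ^ 2) :=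
        Real.log_le_log (by positivity) (by nlinarith)
      have h4 : Real.log (s ^ 2) ≤ Real.log (a ^ 2) := Real.log_le_log (by positivity) (by gcongr; linarith)
      have h5 : Real.log (4 * g ^ 2) = Real.log 4 + Real.log (g ^ 2) :=
        Real.log_mul (by norm_num) (by positivity)
      have h6 : Real.log (g ^ 2) - Real.log (s ^ 2) ≤ h := by
        rw [← Real.log_div (by positivity) (by positivity)]
        exact Real.log_le_log (by positivity) (by linarith)
      have h7 : Real.log 4 ≤ 2 := by
        rw [show (4 : ℝ) = 2 ^ 2 by norm_num, Real.log_pow]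
        push_cast
        linarith [Real.log_two_lt_d9]
      linarith
    calc f ^ 2 * Real.log (f ^ 2) - f ^ 2 * Real.log (a ^ 2) - f ^ 2 + a ^ 2
        = f ^ 2 * (Real.log (f ^ 2) - Real.log (a ^ 2)) - (f ^ 2 - a ^ 2) := by ring
      _ ≤ f ^ 2 * (2 + h) - 0 := by
          gcongr
          nlinarith
      _ ≤ (2 * g) ^ 2 * (2 + h) - 0 := by gcongr
      _ ≤ _ := by nlinarith [sq_nonneg s, sq_nonneg g]

/-- With `M` the mean, the two sides differ by `M log (M/t) - M + t ≥ 0`, so any reference level `t`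
may replace the mean. -/
theorem chainEntropy_le_of_pos {r : ℕ} {γ ψ : ℕ → ℝ} (hγ : ∀ k ≤ r, 0 < γ k)
    (hsum : ∑ k ∈ range (r + 1), γ k = 1) (hψ : ∀ k ≤ r, 0 ≤ ψ k) {t : ℝ} (ht : 0 < t) :
    chainEntropy r γ ψ ≤
      ∑ k ∈ range (r + 1), γ k * (ψ k * Real.log (ψ k) - ψ k * Real.log t - ψ k + t) := by
  have hM : 0 ≤ chainMean r γ ψ := sum_nonneg fun k hk => by
    have hk' : k ≤ r := Nat.lt_succ_iff.1 (mem_range.1 hk)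
    exact mul_nonneg (hγ k hk').le (hψ k hk')
  have e : ∑ k ∈ range (r + 1), γ k * (ψ k * Real.log (ψ k) - ψ k * Real.log t - ψ k + t) =
      chainMean r γ (fun k => ψ k * Real.log (ψ k)) - chainMean r γ ψ * Real.log t -
        chainMean r γ ψ + t := by
    simp only [chainMean, mul_add, mul_sub, sum_add_distrib, sum_sub_distrib, ← mul_assoc,
      ← sum_mul, hsum, one_mul]
  rw [e, chainEntropy]
  set M := chainMean r γ ψ
  rcases hM.eq_or_lt with h0 | h0
  · rw [← h0]; simp; exact ht.le
  · have := Real.log_le_sub_one_of_pos (div_pos ht h0)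
    rw [Real.log_div ht.ne' h0.ne'] at this
    have h2 := mul_le_mul_of_nonneg_left this hM
    have h3 : M * (t / M - 1) = t - M := by field_simp
    rw [h3] at h2
    linarith

/-- Let `N` be the second moment of `√ψ - √ψ(m)`. If `N > 0`, the choice `h = log (1 + (√ψ -
√ψ(m))²/N)` gives `γ[e^h] = 2`, and the reference level is `(√ψ(m) + √N)²`. If `N = 0`, `ψ` is
constant. The constant is 10 + 18, as `N` is itself below the weighted sum. -/
theorem chainEntropy_le_weighted_variance {r : ℕ} {γ ψ : ℕ → ℝ} (hγ : ∀ k ≤ r, 0 < γ k)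
    (hsum : ∑ k ∈ range (r + 1), γ k = 1) (hψ : ∀ k ≤ r, 0 ≤ ψ k) {m : ℕ} (hm : m ≤ r) :
    ∃ h : ℕ → ℝ, (∀ i, 0 ≤ h i) ∧ ∑ k ∈ range (r + 1), γ k * Real.exp (h k) ≤ 2 ∧
      chainEntropy r γ ψ ≤
        28 * ∑ k ∈ range (r + 1), γ k * (1 + h k) * (√(ψ k) - √(ψ m)) ^ 2 := by
  set N := ∑ k ∈ range (r + 1), γ k * (√(ψ k) - √(ψ m)) ^ 2 with hN
  have hle : ∀ {k}, k ∈ range (r + 1) → k ≤ r := fun hk => Nat.lt_succ_iff.1 (mem_range.1 hk)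
  have hterm : ∀ k ∈ range (r + 1), 0 ≤ γ k * (√(ψ k) - √(ψ m)) ^ 2 := fun k hk => by
    have := hγ k (hle hk); positivity
  have hN0 : 0 ≤ N := sum_nonneg hterm
  rcases hN0.eq_or_lt with h0 | h0
  · refine ⟨fun _ => 0, fun _ => le_rfl, by simp [hsum], ?_⟩
    have hz := (sum_eq_zero_iff_of_nonneg hterm).1 h0.symm
    have hconst : ∀ k ∈ range (r + 1), ψ k = ψ m := by
      intro k hk
      have h1 := (mul_eq_zero.1 (hz k hk)).resolve_left (hγ k (hle hk)).ne'
      exact (Real.sqrt_inj (hψ k (hle hk)) (hψ m hm)).1 (sub_eq_zero.1 (pow_eq_zero_iff two_ne_zero |>.1 h1))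
    have e1 : chainMean r γ ψ = ψ m := by
      rw [chainMean, sum_congr rfl fun k hk => by rw [hconst k hk], ← sum_mul, hsum, one_mul]
    have e2 : chainMean r γ (fun k => ψ k * Real.log (ψ k)) = ψ m * Real.log (ψ m) := by
      rw [chainMean, sum_congr rfl fun k hk => by rw [hconst k hk], ← sum_mul, hsum, one_mul]
    rw [chainEntropy, e1, e2, sub_self]
    simp only [add_zero, mul_one]
    exact mul_nonneg (by norm_num) hN0
  · have hs : 0 < √N := Real.sqrt_pos.2 h0
    have hs2 : √N ^ 2 = N := Real.sq_sqrt hN0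
    set h : ℕ → ℝ := fun k => Real.log (1 + (√(ψ k) - √(ψ m)) ^ 2 / √N ^ 2) with hh
    have hh0 : ∀ k, 0 ≤ h k := fun k => Real.log_nonneg (by
      have : 0 ≤ (√(ψ k) - √(ψ m)) ^ 2 / √N ^ 2 := by positivity
      linarith)
    refine ⟨h, hh0, ?_, ?_⟩
    · have e : ∀ k, Real.exp (h k) = 1 + (√(ψ k) - √(ψ m)) ^ 2 / N := by
        intro k
        rw [hh]
        simp only
        rw [Real.exp_log (by positivity), hs2]
      simp only [e, mul_add, mul_one, sum_add_distrib, hsum, ← mul_div_assoc]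
      rw [← sum_div, ← hN, div_self h0.ne']
      norm_num
    · refine (chainEntropy_le_of_pos hγ hsum hψ (t := (√(ψ m) + √N) ^ 2) (by positivity)).trans ?_
      have hpt : ∀ k ∈ range (r + 1), γ k * (ψ k * Real.log (ψ k) -
          ψ k * Real.log ((√(ψ m) + √N) ^ 2) - ψ k + (√(ψ m) + √N) ^ 2) ≤
          γ k * (10 * N) + 18 * (γ k * (1 + h k) * (√(ψ k) - √(ψ m)) ^ 2) := by
        intro k hk
        have h1 := sq_mul_log_sq_le (Real.sqrt_nonneg (ψ k)) (Real.sqrt_nonneg (ψ m)) hs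
        rw [Real.sq_sqrt (hψ k (hle hk))] at h1
        refine (mul_le_mul_of_nonneg_left h1 (hγ k (hle hk)).le).trans_eq ?_
        rw [hs2, hh]
        simp only [hs2]
        ring
      refine (sum_le_sum hpt).trans ?_
      rw [sum_add_distrib, ← sum_mul, hsum, ← mul_sum]
      have : N ≤ ∑ k ∈ range (r + 1), γ k * (1 + h k) * (√(ψ k) - √(ψ m)) ^ 2 := by
        refine sum_le_sum fun k hk => ?_
        have h1 := hterm k hk
        have h2 := mul_nonneg (hh0 k) h1
        linarith
      linarith

/-! ### The two sides of the minimum put together. -/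

theorem sum_range_split_at {m q : ℕ} (F : ℕ → ℝ) :
    ∑ k ∈ range (m + q), F k =
      ∑ i ∈ range m, F (m - (i + 1)) + ∑ i ∈ range q, F (m + i) := by
  rw [sum_range_add, ← sum_range_reflect F]
  congr 1
  exact sum_congr rfl fun i _ => by rw [show m - 1 - i = m - (i + 1) by omega]

theorem sum_range_succ_split_at {m q : ℕ} (F : ℕ → ℝ) :
    ∑ k ∈ range (m + q + 1), F k =
      ∑ i ∈ range m, F (m - (i + 1)) + F m + ∑ i ∈ range q, F (m + (i + 1)) := by
  rw [add_assoc, sum_range_split_at, sum_range_succ']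
  simp only [add_zero]
  ring

/-- A logarithmic Sobolev inequality for chains on `{0, …, r}` whose stationary law is comparable
to a Boltzmann weight with energy of curvature at least `c / r`. -/
theorem chain_logSobolev {c A C₄ : ℝ} (hc : 0 < c) (hA : 1 ≤ A) (hC₄ : 0 ≤ C₄) :
    ∃ C : ℝ, 0 < C ∧ ∀ r : ℕ, 1 ≤ r → ∀ γ E : ℕ → ℝ,
      (∀ i ≤ r, A⁻¹ * Real.exp (-E i) ≤ γ i) → (∀ i ≤ r, γ i ≤ A * Real.exp (-E i)) →
      (∀ i, i + 2 ≤ r → c / r ≤ E (i + 2) - 2 * E (i + 1) + E i) →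
      ∑ k ∈ range (r + 1), γ k = 1 → (∀ i ≤ r, Real.exp (-(C₄ * r)) ≤ γ i) →
      ∀ ψ : ℕ → ℝ, (∀ k ≤ r, 0 ≤ ψ k) →
        chainEntropy r γ ψ ≤
          C * r * ∑ k ∈ range r, min (γ (k + 1)) (γ k) * (√(ψ (k + 1)) - √(ψ k)) ^ 2 := by
  have hA0 : 0 < A := by linarith
  have hlogA : 0 ≤ Real.log A := Real.log_nonneg hA
  set C₀ := Real.exp (c / 2) * (1 + 2 / c) with hC₀
  have hC₀pos : 0 < C₀ := by positivity
  -- The total mass 1 is at most `A e^{-E m}` times `2 C₀ √r`, one `C₀ √r` for each side of the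
  -- minimiser `m`.
  set c₃ := 1 / (2 * A * C₀) with hc₃def
  have hc₃ : 0 < c₃ := by positivity
  -- Oscillation of `E` above its minimum: `e^{-C₄ r} ≤ γ ≤ 1`, each bound being transferred to `E`
  -- at the cost of `log A`.
  set C₅ := C₄ + 2 * Real.log A with hC₅
  have hC₅0 : 0 ≤ C₅ := by positivity
  set B := 4 * ((A + 2) * A * (C₀ ^ 2 + 2 + 1 / c + C₅ + C₀ / c₃)) with hB
  have hB0 : 0 < B := by positivity
  refine ⟨28 * B, by positivity, ?_⟩
  intro r hr γ E hlow hupp hE hsum hmin ψ hψ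
  have hr1 : (1 : ℝ) ≤ r := by exact_mod_cast hr
  have hr0 : (0 : ℝ) < r := by linarith
  have hγ : ∀ i ≤ r, 0 < γ i := fun i hi => lt_of_lt_of_le (by positivity) (hlow i hi)
  have hγ1 : ∀ i ≤ r, γ i ≤ 1 := fun i hi => by
    rw [← hsum]
    exact single_le_sum (f := γ) (fun j hj => (hγ j (Nat.lt_succ_iff.1 (mem_range.1 hj))).le)
      (mem_range.2 (Nat.lt_succ_iff.2 hi))
  obtain ⟨m, hm, hmE⟩ := exists_min_image (range (r + 1)) E ⟨0, by simp⟩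
  have hmr : m ≤ r := Nat.lt_succ_iff.1 (mem_range.1 hm)
  have hmE' : ∀ j ≤ r, E m ≤ E j := fun j hj => hmE j (mem_range.2 (by omega))
  obtain ⟨q, rfl⟩ := Nat.exists_eq_add_of_le hmr
  obtain ⟨h, hh0, hhsum, hent⟩ := chainEntropy_le_weighted_variance hγ hsum hψ hmr
  -- the two reflected sequences
  have hER : ∀ i, i + 2 ≤ q → c / (m + q : ℕ) ≤
      E (m + (i + 2)) - 2 * E (m + (i + 1)) + E (m + i) := fun i hi => hE (m + i) (by omega)
  have hEL : ∀ i, i + 2 ≤ m → c / (m + q : ℕ) ≤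
      E (m - (i + 2)) - 2 * E (m - (i + 1)) + E (m - i) := by
    intro i hi
    have := hE (m - (i + 2)) (by omega)
    rw [show m - (i + 2) + 2 = m - i by omega, show m - (i + 2) + 1 = m - (i + 1) by omega] at this
    linarith
  have hR01 : 1 ≤ q → E (m + 0) ≤ E (m + 1) := fun hq => hmE' _ (by omega)
  have hL01 : 1 ≤ m → E (m - 0) ≤ E (m - 1) := fun hq => hmE' _ (by omega)
  have hsumR : ∑ i ∈ range (q + 1), Real.exp (-(E (m + i) - E m)) ≤ C₀ * √(m + q : ℕ) := by
    refine le_trans (sum_le_sum fun i hi => Real.exp_le_exp.2 (neg_le_neg ?_))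
      (sum_exp_neg_quadratic_le hc hr1 (q + 1))
    have hi' := mem_range.1 hi
    have h1 := energy_ge_slope (E := fun i => E (m + i)) hER (i := 0) i (by omega)
    simp only [zero_add, add_zero] at h1
    rcases Nat.eq_zero_or_pos i with h0 | h0
    · subst h0; simp
    · have h2 := mul_nonneg (show (0 : ℝ) ≤ i by positivity) (sub_nonneg.2 (hR01 (by omega)))
      simp only [add_zero] at h2
      linarith
  have hsumL : ∑ i ∈ range (m + 1), Real.exp (-(E (m - i) - E m)) ≤ C₀ * √(m + q : ℕ) := by
    refine le_trans (sum_le_sum fun i hi => Real.exp_le_exp.2 (neg_le_neg ?_))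
      (sum_exp_neg_quadratic_le hc hr1 (m + 1))
    have hi' := mem_range.1 hi
    have h1 := energy_ge_slope (E := fun i => E (m - i)) hEL (i := 0) i (by omega)
    simp only [zero_add, Nat.sub_zero] at h1
    rcases Nat.eq_zero_or_pos i with h0 | h0
    · subst h0; simp
    · have h2 := mul_nonneg (show (0 : ℝ) ≤ i by positivity) (sub_nonneg.2 (hL01 (by omega)))
      simp only [Nat.sub_zero] at h2
      linarith
  have hEm : c₃ ≤ √(m + q : ℕ) * Real.exp (-E m) := by
    have h1 : (1 : ℝ) ≤ A * Real.exp (-E m) * (2 * (C₀ * √(m + q : ℕ))) := by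
      calc (1 : ℝ) = ∑ k ∈ range (m + q + 1), γ k := hsum.symm
        _ ≤ ∑ k ∈ range (m + q + 1), A * Real.exp (-E m) * Real.exp (-(E k - E m)) := by
            refine sum_le_sum fun k hk => (hupp k (Nat.lt_succ_iff.1 (mem_range.1 hk))).trans_eq ?_
            rw [mul_assoc, ← Real.exp_add]; ring_nf
        _ = A * Real.exp (-E m) * ∑ k ∈ range (m + q + 1), Real.exp (-(E k - E m)) := by
            rw [mul_sum]
        _ ≤ _ := by
            gcongr
            rw [sum_range_succ_split_at]
            rw [sum_range_succ'] at hsumR hsumL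
            simp only [Nat.sub_zero, add_zero, sub_self, neg_zero, Real.exp_zero] at *
            linarith
    rw [hc₃def, div_le_iff₀ (by positivity)]
    linarith
  have hdiff : ∀ i ≤ m + q, E i - E m ≤ C₅ * (m + q : ℕ) := by
    intro i hi
    have h1 : -E i + Real.log A ≥ -(C₄ * (m + q : ℕ)) := by
      have := (hmin i hi).trans (hupp i hi)
      rw [← Real.exp_log hA0, ← Real.exp_add, Real.exp_le_exp] at this
      linarith
    have h2 : -E m - Real.log A ≤ 0 := by
      have := (hlow m hmr).trans (hγ1 m hmr)
      rw [← Real.exp_log hA0, ← Real.exp_neg, ← Real.exp_add,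
        Real.exp_le_one_iff] at this
      linarith
    have h3 : Real.log A ≤ Real.log A * (m + q : ℕ) := le_mul_of_one_le_right hlogA hr1
    rw [hC₅]
    nlinarith
  have hsumexp := hhsum
  rw [sum_range_succ_split_at] at hsumexp
  have hexpnn : ∀ i ≤ m + q, 0 ≤ γ i * Real.exp (h i) := fun i hi => by
    have := hγ i hi; positivity
  have hRight := one_sided_hardy (p := fun i => γ (m + i)) (h := fun i => h (m + i))
    (E := fun i => E (m + i)) hc hA hc₃ hr (R := q) (by omega)
    (fun i hi => hlow _ (by omega)) (fun i hi => hupp _ (by omega)) hER hR01 hEm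
    (fun i hi => hdiff _ (by omega)) (fun i => hh0 _)
    (by
      rw [sum_range_succ']
      have : 0 ≤ ∑ i ∈ range m, γ (m - (i + 1)) * Real.exp (h (m - (i + 1))) :=
        sum_nonneg fun i _ => hexpnn _ (by omega)
      simp only [add_zero]
      linarith) (fun i => √(ψ (m + i)))
  have hLeft := one_sided_hardy (p := fun i => γ (m - i)) (h := fun i => h (m - i))
    (E := fun i => E (m - i)) hc hA hc₃ hr (R := m) (by omega)
    (fun i hi => hlow _ (by omega)) (fun i hi => hupp _ (by omega)) hEL hL01 hEm
    (fun i hi => hdiff _ (by omega)) (fun i => hh0 _)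
    (by
      rw [sum_range_succ']
      have : 0 ≤ ∑ i ∈ range q, γ (m + (i + 1)) * Real.exp (h (m + (i + 1))) :=
        sum_nonneg fun i hi => hexpnn _ (by have := mem_range.1 hi; omega)
      simp only [Nat.sub_zero]
      linarith) (fun i => √(ψ (m - i)))
  refine hent.trans ?_
  rw [sum_range_succ_split_at, sum_range_split_at]
  simp only [add_zero, Nat.sub_zero, sub_self] at hRight hLeft ⊢
  have e1 : ∑ i ∈ range q, min (γ (m + i)) (γ (m + (i + 1))) *
      (√(ψ (m + (i + 1))) - √(ψ (m + i))) ^ 2 =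
      ∑ i ∈ range q, min (γ (m + i + 1)) (γ (m + i)) *
      (√(ψ (m + i + 1)) - √(ψ (m + i))) ^ 2 :=
    sum_congr rfl fun i _ => by rw [min_comm, add_assoc]
  have e2 : ∑ i ∈ range m, min (γ (m - i)) (γ (m - (i + 1))) *
      (√(ψ (m - (i + 1))) - √(ψ (m - i))) ^ 2 =
      ∑ i ∈ range m, min (γ (m - (i + 1) + 1)) (γ (m - (i + 1))) *
      (√(ψ (m - (i + 1) + 1)) - √(ψ (m - (i + 1)))) ^ 2 :=
    sum_congr rfl fun i hi => by
      have := mem_range.1 hi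
      rw [show m - (i + 1) + 1 = m - i by omega]
      ring
  rw [e1] at hRight
  rw [e2] at hLeft
  rw [hB]
  calc _ = 28 * (∑ i ∈ range m, γ (m - (i + 1)) * (1 + h (m - (i + 1))) *
        (√(ψ (m - (i + 1))) - √(ψ m)) ^ 2 + ∑ i ∈ range q, γ (m + (i + 1)) *
        (1 + h (m + (i + 1))) * (√(ψ (m + (i + 1))) - √(ψ m)) ^ 2) := by ring
    _ ≤ _ := (mul_le_mul_of_nonneg_left (add_le_add hLeft hRight) (by norm_num)).trans_eq (by ring)

/-! ## Moments of a single-site partition function -/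

/-- Rates `u` with `u 0 = 0` squeezed between two linear functions. -/
structure LinearRates (c₁ a₁ : ℝ) (u : ℕ → ℝ) : Prop where
  pos : 0 < c₁
  zero : u 0 = 0
  lower : ∀ k : ℕ, c₁ * k ≤ u k
  upper : ∀ k : ℕ, u k ≤ a₁ * k

/-- The unnormalised moments `∑ k^j e^{tk} / u(k)!`. -/
noncomputable def rateMoment (u : ℕ → ℝ) (j : ℕ) (t : ℝ) : ℝ :=
  ∑' k : ℕ, (k : ℝ) ^ j * (Real.exp t ^ k / rateFactorial u k)

theorem rateMoment_zero (u : ℕ → ℝ) (t : ℝ) :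
    rateMoment u 0 t = sitePartition u (Real.exp t) := by
  simp [rateMoment, sitePartition]

theorem rateFactorial_succ (u : ℕ → ℝ) (k : ℕ) :
    rateFactorial u (k + 1) = rateFactorial u k * u (k + 1) := prod_range_succ _ _

theorem rateFactorial_zero (u : ℕ → ℝ) : rateFactorial u 0 = 1 := prod_range_zero _

namespace LinearRates

variable {c₁ a₁ : ℝ} {u : ℕ → ℝ}

theorem succ_pos (hu : LinearRates c₁ a₁ u) (k : ℕ) : 0 < u (k + 1) :=
  lt_of_lt_of_le (mul_pos hu.pos (by positivity)) (hu.lower (k + 1))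

theorem fact_pos (hu : LinearRates c₁ a₁ u) (k : ℕ) : 0 < rateFactorial u k :=
  rateFactorial_pos hu.succ_pos k

theorem le_const (hu : LinearRates c₁ a₁ u) : c₁ ≤ a₁ := by
  have h1 := hu.lower 1
  have h2 := hu.upper 1
  simp only [Nat.cast_one, mul_one] at h1 h2
  linarith

theorem const_pos (hu : LinearRates c₁ a₁ u) : 0 < a₁ := hu.pos.trans_le hu.le_const

theorem nonneg (hu : LinearRates c₁ a₁ u) (k : ℕ) : 0 ≤ u k :=
  le_trans (mul_nonneg hu.pos.le (by positivity)) (hu.lower k)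

theorem pow_mul_factorial_le (hu : LinearRates c₁ a₁ u) (k : ℕ) :
    c₁ ^ k * k.factorial ≤ rateFactorial u k := by
  induction k with
  | zero => simp [rateFactorial_zero]
  | succ k ih =>
    rw [rateFactorial_succ, Nat.factorial_succ]
    have h := hu.lower (k + 1)
    have := hu.pos
    push_cast at h ⊢
    calc c₁ ^ (k + 1) * ((k + 1) * k.factorial) = (c₁ ^ k * k.factorial) * (c₁ * (k + 1)) := by ring
      _ ≤ _ := by gcongr; exact (hu.fact_pos k).le

theorem le_pow_mul_factorial (hu : LinearRates c₁ a₁ u) (k : ℕ) :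
    rateFactorial u k ≤ a₁ ^ k * k.factorial := by
  induction k with
  | zero => simp [rateFactorial_zero]
  | succ k ih =>
    rw [rateFactorial_succ, Nat.factorial_succ]
    have h := hu.upper (k + 1)
    have := hu.const_pos
    push_cast at h ⊢
    calc _ ≤ (a₁ ^ k * k.factorial) * (a₁ * (k + 1)) := by
          gcongr
          exact (hu.succ_pos k).le
      _ = _ := by ring

theorem summable_moment (hu : LinearRates c₁ a₁ u) (j : ℕ) {φ : ℝ} (hφ : 0 ≤ φ) :
    Summable fun k : ℕ => (k : ℝ) ^ j * (φ ^ k / rateFactorial u k) := by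
  refine Summable.of_nonneg_of_le (fun k => ?_) (fun k => ?_)
    ((Real.summable_pow_div_factorial (φ * Real.exp 1 / c₁)).mul_left (j.factorial : ℝ))
  · have := hu.fact_pos k; positivity
  · have h1 : (k : ℝ) ^ j ≤ j.factorial * Real.exp 1 ^ k := by
      have := Real.pow_div_factorial_le_exp (k : ℝ) k.cast_nonneg j
      rw [div_le_iff₀ (by positivity)] at this
      rw [← Real.exp_nat_mul, mul_one]
      linarith
    have h2 := hu.pow_mul_factorial_le k
    have hc := hu.pos
    calc (k : ℝ) ^ j * (φ ^ k / rateFactorial u k)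
        ≤ (j.factorial * Real.exp 1 ^ k) * (φ ^ k / (c₁ ^ k * k.factorial)) := by
          have := hu.fact_pos k
          gcongr
      _ = _ := by rw [div_pow, mul_pow]; field_simp

theorem summable_partition (hu : LinearRates c₁ a₁ u) {φ : ℝ} (hφ : 0 ≤ φ) :
    Summable fun k : ℕ => φ ^ k / rateFactorial u k := by
  simpa using hu.summable_moment 0 hφ

theorem partition_pos (hu : LinearRates c₁ a₁ u) {φ : ℝ} (hφ : 0 ≤ φ) :
    0 < sitePartition u φ := by
  refine (hu.summable_partition hφ).tsum_pos (fun k => ?_) 0 ?_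
  · have := hu.fact_pos k; positivity
  · simp [rateFactorial_zero]

theorem moment_zero_pos (hu : LinearRates c₁ a₁ u) (t : ℝ) : 0 < rateMoment u 0 t := by
  rw [rateMoment_zero]; exact hu.partition_pos (Real.exp_pos t).le

/-- Differentiation in the chemical potential multiplies the `k`-th term by `k`. On the half-line
below `t + 1` the differentiated series is dominated by its value at `t + 1`. -/
theorem hasDerivAt_moment (hu : LinearRates c₁ a₁ u) (j : ℕ) (t : ℝ) :
    HasDerivAt (rateMoment u j) (rateMoment u (j + 1) t) t := by
  have h := hasDerivAt_tsum_of_isPreconnected (𝕜 := ℝ)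
    (g := fun (k : ℕ) s => (k : ℝ) ^ j * (Real.exp s ^ k / rateFactorial u k))
    (g' := fun (k : ℕ) s => (k : ℝ) ^ (j + 1) * (Real.exp s ^ k / rateFactorial u k))
    (t := Set.Iio (t + 1)) (y₀ := t) (y := t)
    (hu.summable_moment (j + 1) (Real.exp_pos (t + 1)).le) isOpen_Iio isPreconnected_Iio
    (fun k y _ => ?_) (fun k y hy => ?_) (by simp) (hu.summable_moment j (Real.exp_pos t).le)
    (by simp)
  · exact h
  · have h1 : HasDerivAt (fun s : ℝ => Real.exp s ^ k) (k * Real.exp y ^ k) y := by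
      have := ((hasDerivAt_id y).const_mul (k : ℝ)).exp
      simp only [id, mul_one, Real.exp_nat_mul] at this
      simpa [mul_comm] using! this
    exact ((h1.div_const (rateFactorial u k)).const_mul ((k : ℝ) ^ j)).congr_deriv (by ring)
  · have := hu.fact_pos k
    have hy' : y ≤ t + 1 := le_of_lt hy
    rw [Real.norm_of_nonneg (by positivity)]
    gcongr

theorem hasSum_moment (hu : LinearRates c₁ a₁ u) (j : ℕ) (t : ℝ) :
    HasSum (fun k : ℕ => (k : ℝ) ^ j * (Real.exp t ^ k / rateFactorial u k))
      (rateMoment u j t) := (hu.summable_moment j (Real.exp_pos t).le).hasSum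

/-- Detailed balance: the rate cancels the last factor of `u(k)!`, which shifts the index by one,
and the term `k = 0` vanishes because `u 0 = 0`. -/
theorem hasSum_rate_mul (hu : LinearRates c₁ a₁ u) {φ : ℝ} {g : ℕ → ℝ} {S : ℝ}
    (h : HasSum (fun k => g (k + 1) * (φ ^ k / rateFactorial u k)) S) :
    HasSum (fun k => u k * g k * (φ ^ k / rateFactorial u k)) (φ * S) := by
  rw [← hasSum_nat_add_iff' 1]
  simp only [range_one, sum_singleton, hu.zero, zero_mul, sub_zero]
  refine (h.mul_left φ).congr_fun ?_
  intro k
  rw [rateFactorial_succ, pow_succ]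
  have := (hu.fact_pos k).ne'
  have := (hu.succ_pos k).ne'
  field_simp

theorem hasSum_rate (hu : LinearRates c₁ a₁ u) (t : ℝ) :
    HasSum (fun k => u k * (Real.exp t ^ k / rateFactorial u k))
      (Real.exp t * rateMoment u 0 t) := by
  have := hu.hasSum_rate_mul (g := fun _ => 1) (φ := Real.exp t) (S := rateMoment u 0 t)
    (by simpa using hu.hasSum_moment 0 t)
  simpa using this

theorem hasSum_rate_mul_id (hu : LinearRates c₁ a₁ u) (t : ℝ) :
    HasSum (fun k : ℕ => u k * k * (Real.exp t ^ k / rateFactorial u k))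
      (Real.exp t * (rateMoment u 1 t + rateMoment u 0 t)) := by
  refine hu.hasSum_rate_mul (g := fun k => (k : ℝ)) ?_
  refine ((hu.hasSum_moment 1 t).add (hu.hasSum_moment 0 t)).congr_fun ?_
  intro k
  push_cast
  ring

theorem moment_one_lower (hu : LinearRates c₁ a₁ u) (t : ℝ) :
    Real.exp t * rateMoment u 0 t ≤ a₁ * rateMoment u 1 t := by
  refine hasSum_le (fun k => ?_) (hu.hasSum_rate t) ((hu.hasSum_moment 1 t).mul_left a₁)
  have h1 := hu.fact_pos k
  have h2 := hu.upper k
  rw [pow_one, ← mul_assoc]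
  gcongr

theorem moment_one_upper (hu : LinearRates c₁ a₁ u) (t : ℝ) :
    c₁ * rateMoment u 1 t ≤ Real.exp t * rateMoment u 0 t := by
  refine hasSum_le (fun k => ?_) ((hu.hasSum_moment 1 t).mul_left c₁) (hu.hasSum_rate t)
  have h1 := hu.fact_pos k
  have h2 := hu.lower k
  rw [pow_one, ← mul_assoc]
  gcongr

/-- The derivative of the logarithmic partition function is the density. -/
theorem hasDerivAt_logPartition (hu : LinearRates c₁ a₁ u) (t : ℝ) :
    HasDerivAt (fun t => Real.log (sitePartition u (Real.exp t)))
      (rateMoment u 1 t / rateMoment u 0 t) t := by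
  have := (hu.hasDerivAt_moment 0 t).log (hu.moment_zero_pos t).ne'
  simpa only [rateMoment_zero] using! this

theorem hasDerivAt_density (hu : LinearRates c₁ a₁ u) (t : ℝ) :
    HasDerivAt (fun t => rateMoment u 1 t / rateMoment u 0 t)
      (rateMoment u 2 t / rateMoment u 0 t - (rateMoment u 1 t / rateMoment u 0 t) ^ 2) t := by
  have h0 := (hu.moment_zero_pos t).ne'
  refine ((hu.hasDerivAt_moment 1 t).div (hu.hasDerivAt_moment 0 t) h0).congr_deriv ?_
  field_simp

/-- The mean rate equals the fugacity and `u k ≤ a₁ k`, so the density is at least `e^t / a₁`. -/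
theorem monotone_logPartition_sub (hu : LinearRates c₁ a₁ u) :
    Monotone fun t => Real.log (sitePartition u (Real.exp t)) - Real.exp t / a₁ := by
  have hd : ∀ t, HasDerivAt (fun t => Real.log (sitePartition u (Real.exp t)) - Real.exp t / a₁)
      (rateMoment u 1 t / rateMoment u 0 t - Real.exp t / a₁) t := fun t =>
    (hu.hasDerivAt_logPartition t).sub ((Real.hasDerivAt_exp t).div_const a₁)
  refine monotone_of_deriv_nonneg (fun t => (hd t).differentiableAt) fun t => ?_
  rw [(hd t).deriv, sub_nonneg, div_le_div_iff₀ hu.const_pos (hu.moment_zero_pos t)]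
  linarith [hu.moment_one_lower t]

theorem monotone_sub_logPartition (hu : LinearRates c₁ a₁ u) :
    Monotone fun t => Real.exp t / c₁ - Real.log (sitePartition u (Real.exp t)) := by
  have hd : ∀ t, HasDerivAt (fun t => Real.exp t / c₁ - Real.log (sitePartition u (Real.exp t)))
      (Real.exp t / c₁ - rateMoment u 1 t / rateMoment u 0 t) t := fun t =>
    ((Real.hasDerivAt_exp t).div_const c₁).sub (hu.hasDerivAt_logPartition t)
  refine monotone_of_deriv_nonneg (fun t => (hd t).differentiableAt) fun t => ?_
  rw [(hd t).deriv, sub_nonneg, div_le_div_iff₀ (hu.moment_zero_pos t) hu.pos]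
  linarith [hu.moment_one_upper t]

/-- For rates that increase quasi-linearly, the variance of the site measure is at most a multiple
of the fugacity. -/
theorem variance_le (hu : LinearRates c₁ a₁ u) {a b : ℝ} (ha : 0 < a) (hb : 0 ≤ b)
    (hM : ∀ k l : ℕ, a * ((k : ℝ) - l) ^ 2 - b * (k + l) ≤ ((k : ℝ) - l) * (u k - u l)) (t : ℝ) :
    rateMoment u 2 t / rateMoment u 0 t - (rateMoment u 1 t / rateMoment u 0 t) ^ 2 ≤
      (2 + 2 * b / c₁) / a * Real.exp t := by
  set ρ := rateMoment u 1 t / rateMoment u 0 t with hρ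
  have hM0 := hu.moment_zero_pos t
  have hc := hu.pos
  have hρ0 : 0 ≤ ρ := div_nonneg (tsum_nonneg fun k => by
    have := hu.fact_pos k; positivity) hM0.le
  have hρle : ρ ≤ Real.exp t / c₁ := by
    rw [hρ, div_le_div_iff₀ hM0 hc]; linarith [hu.moment_one_upper t]
  -- Weak monotonicity is averaged over `k` against this fixed integer: the mean of `(k - l)(u k - u
  -- l)` is `φ (ρ - l + 1) - u(l)(ρ - l)`, at most `2φ`.
  set l := ⌊ρ⌋₊
  have hl1 : (l : ℝ) ≤ ρ := Nat.floor_le hρ0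
  have hl2 : ρ < l + 1 := Nat.lt_floor_add_one ρ
  have h1 := hu.hasSum_moment 1 t
  have h0 := hu.hasSum_moment 0 t
  have hL := (((hu.hasSum_moment 2 t).sub (h1.mul_left (2 * (l : ℝ)))).add
    (h0.mul_left ((l : ℝ) ^ 2))).mul_left a |>.sub ((h1.add (h0.mul_left (l : ℝ))).mul_left b)
  have hR := ((hu.hasSum_rate_mul_id t).sub ((hu.hasSum_rate t).mul_left (l : ℝ))).sub
    ((h1.sub (h0.mul_left (l : ℝ))).mul_left (u l))
  have key := hasSum_le (fun k => ?_) hL hR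
  · have e1 : rateMoment u 1 t = ρ * rateMoment u 0 t := by rw [hρ]; field_simp
    set V := rateMoment u 2 t / rateMoment u 0 t with hV
    have e2 : rateMoment u 2 t = V * rateMoment u 0 t := by rw [hV]; field_simp
    rw [e1, e2] at key
    have key2 : (a * (V - 2 * l * ρ + l ^ 2) - b * (ρ + l)) * rateMoment u 0 t ≤
        (Real.exp t * (ρ + 1) - l * Real.exp t - u l * (ρ - l)) * rateMoment u 0 t := by
      linarith
    have key3 := le_of_mul_le_mul_right key2 hM0
    have hul := mul_nonneg (hu.nonneg l) (sub_nonneg.2 hl1)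
    have h4 : Real.exp t * (ρ - l) ≤ Real.exp t * 1 := by
      gcongr; linarith
    have h5 : a * (V - ρ ^ 2) ≤ a * (V - 2 * l * ρ + l ^ 2) := by
      gcongr; nlinarith [sq_nonneg (ρ - l)]
    have h6 : b * (ρ + l) ≤ b * (2 * (Real.exp t / c₁)) := by gcongr; linarith
    rw [div_mul_eq_mul_div, le_div_iff₀ ha]
    have h7 : b * (2 * (Real.exp t / c₁)) = 2 * b / c₁ * Real.exp t := by ring
    linarith
  · have hk := hu.fact_pos k
    have h := mul_le_mul_of_nonneg_right (hM k l)
      (show 0 ≤ Real.exp t ^ k / rateFactorial u k by positivity)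
    simp only [pow_one, pow_zero, one_mul]
    linarith

/-- The second derivative of the log partition function is the site variance, which `variance_le`
controls. -/
theorem convexOn_sub_logPartition (hu : LinearRates c₁ a₁ u) {a b : ℝ} (ha : 0 < a) (hb : 0 ≤ b)
    (hM : ∀ k l : ℕ, a * ((k : ℝ) - l) ^ 2 - b * (k + l) ≤ ((k : ℝ) - l) * (u k - u l)) :
    ConvexOn ℝ Set.univ fun t => (2 + 2 * b / c₁) / a * Real.exp t -
      Real.log (sitePartition u (Real.exp t)) := by
  have hd : ∀ t, HasDerivAt (fun t => (2 + 2 * b / c₁) / a * Real.exp t -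
      Real.log (sitePartition u (Real.exp t)))
      ((2 + 2 * b / c₁) / a * Real.exp t - rateMoment u 1 t / rateMoment u 0 t) t := fun t =>
    ((Real.hasDerivAt_exp t).const_mul _).sub (hu.hasDerivAt_logPartition t)
  have hd2 : ∀ t, HasDerivAt (fun t => (2 + 2 * b / c₁) / a * Real.exp t -
      rateMoment u 1 t / rateMoment u 0 t) _ t := fun t =>
    ((Real.hasDerivAt_exp t).const_mul _).sub (hu.hasDerivAt_density t)
  refine convexOn_of_hasDerivWithinAt2_nonneg convex_univ
    (fun t _ => (hd t).continuousAt.continuousWithinAt) (fun t _ => (hd t).hasDerivWithinAt)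
    (fun t _ => (hd2 t).hasDerivWithinAt) fun t _ => ?_
  exact sub_nonneg.2 (hu.variance_le ha hb hM t)

end LinearRates

/-- Lipschitz growth and weak monotonicity give quasi-linear growth in both variables. -/
theorem quasiLinear_of_weakMonotone {u : ℕ → ℝ} {a₁ a₂ : ℝ} {k₀ : ℕ} (hk₀ : 0 < k₀)
    (ha₂ : 0 < a₂) (hL : ∀ k, |u (k + 1) - u k| ≤ a₁) (hM : ∀ k, a₂ ≤ u (k + k₀) - u k) (k l : ℕ) :
    a₂ / k₀ * ((k : ℝ) - l) ^ 2 - (a₂ + k₀ * a₁) * (k + l) ≤ ((k : ℝ) - l) * (u k - u l) := by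
  have ha₁ : 0 ≤ a₁ := (abs_nonneg _).trans (hL 0)
  have hk : (0 : ℝ) < k₀ := by exact_mod_cast hk₀
  have hmul : ∀ (q l : ℕ), q * a₂ ≤ u (l + k₀ * q) - u l := by
    intro q l
    induction q with
    | zero => simp
    | succ q ih =>
      have := hM (l + k₀ * q)
      rw [show l + k₀ * (q + 1) = l + k₀ * q + k₀ by ring]
      push_cast
      linarith
  have hlip : ∀ (s l : ℕ), -(s * a₁) ≤ u (l + s) - u l := by
    intro s l
    induction s with
    | zero => simp
    | succ s ih =>
      have := (abs_le.1 (hL (l + s))).1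
      rw [← add_assoc]
      push_cast
      linarith
  -- Euclidean division of `n` by `k₀`: each full block gains `a₂` by (M), and each of the fewer
  -- than `k₀` leftover steps loses at most `a₁` by (LG).
  have hone : ∀ (n l : ℕ), a₂ / k₀ * n - (a₂ + k₀ * a₁) ≤ u (l + n) - u l := by
    intro n l
    have h1 := hmul (n / k₀) l
    have h2 := hlip (n % k₀) (l + k₀ * (n / k₀))
    have h3 : (n : ℝ) = k₀ * ((n / k₀ : ℕ) : ℝ) + ((n % k₀ : ℕ) : ℝ) := by
      exact_mod_cast (Nat.div_add_mod n k₀).symm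
    rw [show l + k₀ * (n / k₀) + n % k₀ = l + n by rw [add_assoc, Nat.div_add_mod]] at h2
    have h4 : ((n % k₀ : ℕ) : ℝ) ≤ k₀ := by exact_mod_cast (Nat.mod_lt n hk₀).le
    have h5 : a₂ / k₀ * n = a₂ * ((n / k₀ : ℕ) : ℝ) + a₂ / k₀ * ((n % k₀ : ℕ) : ℝ) := by
      rw [h3]; field_simp
    have h6 : a₂ / k₀ * ((n % k₀ : ℕ) : ℝ) ≤ a₂ := by
      calc _ ≤ a₂ / k₀ * k₀ := by gcongr
        _ = a₂ := by field_simp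
    have h7 : ((n % k₀ : ℕ) : ℝ) * a₁ ≤ k₀ * a₁ := by gcongr
    linarith
  have hb : 0 ≤ a₂ + k₀ * a₁ := by positivity
  rcases le_total l k with h | h
  · obtain ⟨n, rfl⟩ := Nat.exists_eq_add_of_le h
    have h1 := mul_le_mul_of_nonneg_left (hone n l) (show (0 : ℝ) ≤ n by positivity)
    have h2 := mul_nonneg hb (show (0 : ℝ) ≤ l by positivity)
    push_cast
    rw [add_sub_cancel_left]
    nlinarith
  · obtain ⟨n, rfl⟩ := Nat.exists_eq_add_of_le h
    have h1 := mul_le_mul_of_nonneg_left (hone n k) (show (0 : ℝ) ≤ n by positivity)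
    have h2 := mul_nonneg hb (show (0 : ℝ) ≤ k by positivity)
    push_cast
    rw [show (k : ℝ) - (k + n) = -n by ring]
    nlinarith

/-! ## Local estimates for one rate function -/

/-- The logarithm of the partition function, as a function of the chemical potential. -/
noncomputable def logPartition (u : ℕ → ℝ) (t : ℝ) : ℝ := Real.log (sitePartition u (Real.exp t))

/-- Linear rates whose upward increments are bounded by `a₁` and whose logarithmic partition
function has second derivative at most `K e^t`. -/
structure TameRates (c₁ a₁ K : ℝ) (u : ℕ → ℝ) : Prop extends LinearRates c₁ a₁ u where
  step : ∀ k, u (k + 1) ≤ u k + a₁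
  convex : ConvexOn ℝ Set.univ fun t => K * Real.exp t - logPartition u t

/-- The concave conjugate of the logarithmic partition function at half-integers. -/
noncomputable def legendre (u : ℕ → ℝ) (k : ℕ) : ℝ :=
  ⨅ t : ℝ, (logPartition u t - ((k : ℝ) + 1 / 2) * t)

theorem exp_add_exp_neg_le {h : ℝ} (hh : |h| ≤ 1) :
    Real.exp h + Real.exp (-h) - 2 ≤ 2 * h ^ 2 := by
  have h1 := (abs_le.1 (Real.abs_exp_sub_one_sub_id_le hh)).2
  have h2 := (abs_le.1 (Real.abs_exp_sub_one_sub_id_le (x := -h) (by rwa [abs_neg]))).2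
  nlinarith

namespace LinearRates

variable {c₁ a₁ : ℝ} {u : ℕ → ℝ}

theorem exp_logPartition (hu : LinearRates c₁ a₁ u) (t : ℝ) :
    Real.exp (logPartition u t) = sitePartition u (Real.exp t) :=
  Real.exp_log (hu.partition_pos (Real.exp_pos t).le)

theorem sum_le_partition (hu : LinearRates c₁ a₁ u) (S : Finset ℕ) {φ : ℝ} (hφ : 0 ≤ φ) :
    ∑ k ∈ S, φ ^ k / rateFactorial u k ≤ sitePartition u φ :=
  (hu.summable_partition hφ).sum_le_tsum S fun k _ => by have := hu.fact_pos k; positivity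

theorem le_logPartition (hu : LinearRates c₁ a₁ u) (k : ℕ) (t : ℝ) :
    k * t - Real.log (rateFactorial u k) ≤ logPartition u t := by
  have h := hu.sum_le_partition {k} (Real.exp_pos t).le
  rw [sum_singleton, ← hu.exp_logPartition, ← Real.exp_nat_mul] at h
  have h2 := Real.log_le_log (div_pos (Real.exp_pos _) (hu.fact_pos k)) h
  rwa [Real.log_div (Real.exp_pos _).ne' (hu.fact_pos k).ne', Real.log_exp, Real.log_exp] at h2

theorem continuous_logPartition (hu : LinearRates c₁ a₁ u) : Continuous (logPartition u) :=
  continuous_iff_continuousAt.2 fun t => (hu.hasDerivAt_logPartition t).continuousAt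

theorem exists_legendre (hu : LinearRates c₁ a₁ u) (k : ℕ) :
    ∃ τ : ℝ, legendre u k = logPartition u τ - ((k : ℝ) + 1 / 2) * τ ∧
      ∀ t, legendre u k ≤ logPartition u t - ((k : ℝ) + 1 / 2) * t := by
  have hcont : Continuous fun t => logPartition u t - ((k : ℝ) + 1 / 2) * t :=
    hu.continuous_logPartition.sub (continuous_const.mul continuous_id)
  have htend : Filter.Tendsto (fun t => logPartition u t - ((k : ℝ) + 1 / 2) * t)
      (Filter.cocompact ℝ) Filter.atTop := by
    rw [cocompact_eq_atBot_atTop]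
    -- The shift by `1/2` makes the function coercive at both ends, also for `k = 0`: the term of
    -- index 0 gives `log Z ≥ 0`, and the term of index `k + 1` beats the slope `k + 1/2`.
    refine Filter.Tendsto.sup ?_ ?_
    · refine Filter.tendsto_atTop_mono (fun t => ?_)
        (Filter.Tendsto.const_mul_atBot_of_neg (r := -((k : ℝ) + 1 / 2))
          (neg_neg_of_pos (by positivity)) Filter.tendsto_id)
      have := hu.le_logPartition 0 t
      simp only [Nat.cast_zero, zero_mul, rateFactorial_zero, Real.log_one, sub_zero, id] at this ⊢
      linarith
    · refine Filter.tendsto_atTop_mono (fun t => ?_)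
        (Filter.tendsto_atTop_add_const_right _ (-Real.log (rateFactorial u (k + 1)))
          (Filter.Tendsto.const_mul_atTop (r := (1 : ℝ) / 2) (by norm_num) Filter.tendsto_id))
      have := hu.le_logPartition (k + 1) t
      push_cast at this
      simp only [id]
      linarith
  obtain ⟨τ, hτ⟩ := hcont.exists_forall_le htend
  have hle : ∀ t, legendre u k ≤ logPartition u t - ((k : ℝ) + 1 / 2) * t := fun t =>
    ciInf_le ⟨_, by rintro y ⟨s, rfl⟩; exact hτ s⟩ t
  exact ⟨τ, le_antisymm (hle τ) (le_ciInf hτ), hle⟩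

/-- Bounds on the fugacity at the minimiser. -/
theorem fugacity_bounds (hu : LinearRates c₁ a₁ u) {m τ : ℝ}
    (hτ : ∀ t, logPartition u τ - m * τ ≤ logPartition u t - m * t) :
    c₁ * m ≤ 2 * Real.exp τ ∧ Real.exp τ ≤ 2 * (a₁ * m) := by
  have he := Real.exp_pos τ
  have e1 := Real.exp_one_lt_d9
  have e2 := Real.exp_one_gt_d9
  -- Minimality is tested at `τ + 1` and at `τ - 1`; the factors 2 come from `e - 1 ≤ 2` and `1/e ≤
  -- 1/2`.
  constructor
  · have h1 := hu.monotone_sub_logPartition (show τ ≤ τ + 1 by linarith)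
    have h2 := hτ (τ + 1)
    simp only [logPartition] at h2
    simp only [Real.exp_add] at h1 h2
    have h3 : m ≤ (Real.exp τ * Real.exp 1 - Real.exp τ) / c₁ := by
      rw [sub_div]; linarith
    rw [le_div_iff₀ hu.pos] at h3
    nlinarith
  · have h1 := hu.monotone_logPartition_sub (show τ - 1 ≤ τ by linarith)
    have h2 := hτ (τ - 1)
    simp only [logPartition] at h2
    simp only [Real.exp_sub] at h1 h2
    have h3 : (Real.exp τ - Real.exp τ / Real.exp 1) / a₁ ≤ m := by
      rw [sub_div]; linarith
    rw [div_le_iff₀ hu.const_pos] at h3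
    have h4 : Real.exp τ / Real.exp 1 ≤ Real.exp τ / 2 := by gcongr; linarith
    linarith

end LinearRates

namespace TameRates

variable {c₁ a₁ K : ℝ} {u : ℕ → ℝ}

theorem symm_diff_le (hu : TameRates c₁ a₁ K u) (hK : 0 ≤ K) (τ : ℝ) {h : ℝ} (hh : |h| ≤ 1) :
    logPartition u (τ + h) + logPartition u (τ - h) - 2 * logPartition u τ ≤
      2 * K * Real.exp τ * h ^ 2 := by
  have h1 := hu.convex.2 (Set.mem_univ (τ + h)) (Set.mem_univ (τ - h))
    (show (0 : ℝ) ≤ 1 / 2 by norm_num) (show (0 : ℝ) ≤ 1 / 2 by norm_num) (by norm_num)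
  simp only [smul_eq_mul] at h1
  rw [show 1 / 2 * (τ + h) + 1 / 2 * (τ - h) = τ by ring, Real.exp_add, sub_eq_add_neg τ h,
    Real.exp_add] at h1
  have h2 := mul_le_mul_of_nonneg_left (exp_add_exp_neg_le hh)
    (mul_nonneg hK (Real.exp_pos τ).le)
  rw [← sub_eq_add_neg] at h1
  linarith

/-- Minimality tested at `τ - h` turns the symmetric second difference into a one-sided bound,
namely a sub-Gaussian estimate of the log moment generating function centred at `m`. -/
theorem logPartition_add_le (hu : TameRates c₁ a₁ K u) (hK : 0 ≤ K) {m τ : ℝ}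
    (hτ : ∀ t, logPartition u τ - m * τ ≤ logPartition u t - m * t) {h : ℝ} (hh : |h| ≤ 1) :
    logPartition u (τ + h) - logPartition u τ - h * m ≤ 2 * K * Real.exp τ * h ^ 2 := by
  have h1 := hu.symm_diff_le hK τ hh
  have h2 := hτ (τ - h)
  linarith

/-- Duality of curvatures. The minimiser `τ` for `k + 1` is tested as `τ + h` for `k + 2` and `τ -
h` for `k`, with `h = η/r`: the linear terms give `-2h`, and the second difference of `log Z` is at
most `h` because `e^τ ≤ 2 a₁ r`. -/
theorem legendre_second_diff (hu : TameRates c₁ a₁ K u) (hK : 0 ≤ K) {k : ℕ} {r η : ℝ}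
    (hkr : (k : ℝ) + 2 ≤ r) (hη : 0 ≤ η) (hη1 : η ≤ 1) (hηK : 4 * K * a₁ * η ≤ 1) :
    legendre u (k + 2) - 2 * legendre u (k + 1) + legendre u k ≤ -(η / r) := by
  obtain ⟨τ, hτ, hmin⟩ := hu.exists_legendre (k + 1)
  obtain ⟨_, -, h2⟩ := hu.exists_legendre (k + 2)
  obtain ⟨_, -, h0⟩ := hu.exists_legendre k
  have hk0 : (0 : ℝ) ≤ k := k.cast_nonneg
  have hr : 0 < r := by linarith
  have hr1 : 1 ≤ r := by linarith
  set h := η / r with hh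
  have hh0 : 0 ≤ h := by positivity
  have hh1 : |h| ≤ 1 := by
    rw [abs_of_nonneg hh0, hh, div_le_one hr]; linarith
  have hsym := hu.symm_diff_le hK τ hh1
  have hlam : Real.exp τ ≤ 2 * (a₁ * r) := by
    have := (hu.fugacity_bounds (m := ((k + 1 : ℕ) : ℝ) + 1 / 2) (τ := τ)
      (fun t => hτ ▸ hmin t)).2
    refine this.trans ?_
    have := hu.const_pos
    push_cast
    gcongr
    linarith
  have hq : 2 * K * Real.exp τ * h ^ 2 ≤ h := by
    calc 2 * K * Real.exp τ * h ^ 2 ≤ 2 * K * (2 * (a₁ * r)) * h ^ 2 := by gcongr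
      _ = (4 * K * a₁ * η) * h := by rw [hh]; field_simp; ring
      _ ≤ 1 * h := by gcongr
      _ = h := one_mul h
  have h2' := h2 (τ + h)
  have h0' := h0 (τ - h)
  push_cast at h2' h0' hτ
  linarith

/-! ### The site measure near its mode -/

theorem _root_.LinearRates.siteMass_pos (hu : LinearRates c₁ a₁ u) {φ : ℝ} (hφ : 0 < φ) (k : ℕ) :
    0 < siteMass u φ k :=
  div_pos (pow_pos hφ k) (mul_pos (hu.fact_pos k) (hu.partition_pos hφ.le))

theorem _root_.LinearRates.hasSum_siteMass (hu : LinearRates c₁ a₁ u) {φ : ℝ} (hφ : 0 < φ) :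
    HasSum (siteMass u φ) 1 := by
  have h := (hu.summable_partition hφ.le).hasSum.div_const (sitePartition u φ)
  have e : (∑' k : ℕ, φ ^ k / rateFactorial u k) = sitePartition u φ := rfl
  rw [e, div_self (hu.partition_pos hφ.le).ne'] at h
  simpa only [siteMass, div_div] using! h

theorem _root_.LinearRates.siteMass_succ_mul (hu : LinearRates c₁ a₁ u) {φ : ℝ} (hφ : 0 < φ)
    (k : ℕ) : siteMass u φ (k + 1) * u (k + 1) = φ * siteMass u φ k := by
  have h1 := (hu.fact_pos k).ne'
  have h2 := (hu.partition_pos hφ.le).ne'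
  have h3 := (hu.succ_pos k).ne'
  rw [siteMass, siteMass, rateFactorial_succ, pow_succ]
  field_simp

theorem _root_.LinearRates.sum_siteMass_le (hu : LinearRates c₁ a₁ u) {φ : ℝ} (hφ : 0 < φ)
    (S : Finset ℕ) : ∑ k ∈ S, siteMass u φ k ≤ 1 := by
  have h := hu.hasSum_siteMass hφ
  rw [← h.tsum_eq]
  exact h.summable.sum_le_tsum S fun k _ => (hu.siteMass_pos hφ k).le

theorem le_add_mul (hu : TameRates c₁ a₁ K u) (j i : ℕ) : u (j + i) ≤ u j + a₁ * i := by
  induction i with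
  | zero => simp
  | succ i ih =>
    have := hu.step (j + i)
    rw [← add_assoc]
    push_cast
    linarith

/-- The rate starts at most at `φ` and rises by at most `a₁` per step, so the `i`-th mass ratio is
at least `e^{-a₁ i/φ}`; the exponents add up to at most `a₁ i²/φ`. -/
theorem siteMass_add_ge (hu : TameRates c₁ a₁ K u) {φ : ℝ} (hφ : 0 < φ) {j : ℕ} (hj : u j ≤ φ)
    (i : ℕ) :
    siteMass u φ j * Real.exp (-(a₁ * i ^ 2 / φ)) ≤ siteMass u φ (j + i) := by
  have ha := hu.const_pos
  induction i with
  | zero => simp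
  | succ i ih =>
    have h1 := hu.siteMass_succ_mul hφ (j + i)
    have hpos := hu.siteMass_pos hφ (j + i + 1)
    have hle : u (j + i + 1) ≤ φ * Real.exp (a₁ * (i + 1) / φ) := by
      have h2 := hu.le_add_mul j (i + 1)
      have h3 := Real.add_one_le_exp (a₁ * (i + 1) / φ)
      have h4 : φ * (a₁ * (i + 1) / φ + 1) = φ + a₁ * (i + 1) := by field_simp; ring
      rw [← add_assoc] at h2
      push_cast at h2
      nlinarith [mul_le_mul_of_nonneg_left h3 hφ.le]
    have h5 : siteMass u φ (j + i) ≤ siteMass u φ (j + i + 1) * Real.exp (a₁ * (i + 1) / φ) := by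
      have : φ * siteMass u φ (j + i) ≤
          φ * (siteMass u φ (j + i + 1) * Real.exp (a₁ * (i + 1) / φ)) := by
        rw [← h1]
        nlinarith [mul_le_mul_of_nonneg_left hle hpos.le]
      exact le_of_mul_le_mul_left this hφ
    have hj0 := hu.siteMass_pos hφ j
    calc siteMass u φ j * Real.exp (-(a₁ * ((i + 1 : ℕ) : ℝ) ^ 2 / φ))
        ≤ siteMass u φ j * Real.exp (-(a₁ * i ^ 2 / φ) - a₁ * (i + 1) / φ) := by
          gcongr
          rw [show -(a₁ * (i : ℝ) ^ 2 / φ) - a₁ * (i + 1) / φ = -(a₁ * (i ^ 2 + i + 1) / φ) by ring]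
          gcongr
          push_cast
          nlinarith [(i.cast_nonneg : (0 : ℝ) ≤ i)]
      _ = siteMass u φ j * Real.exp (-(a₁ * i ^ 2 / φ)) * Real.exp (-(a₁ * (i + 1) / φ)) := by
          rw [mul_assoc, ← Real.exp_add, sub_eq_add_neg]
      _ ≤ siteMass u φ (j + i + 1) * Real.exp (a₁ * (i + 1) / φ) *
            Real.exp (-(a₁ * (i + 1) / φ)) := by
          exact mul_le_mul_of_nonneg_right (ih.trans h5) (Real.exp_pos _).le
      _ = siteMass u φ (j + (i + 1)) := by
          rw [mul_assoc, ← Real.exp_add, add_neg_cancel, Real.exp_zero, mul_one, add_assoc]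

theorem exp_neg_two_mul_le {x : ℝ} (hx0 : 0 ≤ x) (hx : x ≤ 1 / 2) :
    Real.exp (-(2 * x)) ≤ 1 - x := by
  have h := Real.add_one_le_exp (2 * x)
  rw [Real.exp_neg, inv_le_comm₀ (Real.exp_pos _) (by linarith)]
  refine le_trans ?_ h
  rw [inv_le_iff_one_le_mul₀ (by linarith)]
  nlinarith

/-- Mirror image of `siteMass_add_ge`, with the same step bound read downwards. The restriction on
`i` keeps the rates above `φ/2` and the walk above 0. -/
theorem siteMass_sub_ge (hu : TameRates c₁ a₁ K u) {φ : ℝ} (hφ : 0 < φ) {j : ℕ}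
    (hj : φ ≤ u j + a₁) (i : ℕ) (hi : 2 * (a₁ * i) ≤ φ) :
    i ≤ j ∧ siteMass u φ j * Real.exp (-(2 * a₁ * i ^ 2 / φ)) ≤ siteMass u φ (j - i) := by
  have ha := hu.const_pos
  have hij : ∀ i : ℕ, 2 * (a₁ * i) ≤ φ → i ≤ j := by
    intro i hi
    by_contra hlt
    have h1 := hu.upper j
    have h2 : (j : ℝ) + 1 ≤ i := by exact_mod_cast not_le.1 hlt
    have h3 : (1 : ℝ) ≤ i := by linarith [(j.cast_nonneg : (0 : ℝ) ≤ j)]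
    have h4 : a₁ * (j + 1) ≤ a₁ * i := by gcongr
    have h5 : a₁ * 1 ≤ a₁ * i := by gcongr
    linarith
  refine ⟨hij i hi, ?_⟩
  induction i with
  | zero => simp
  | succ i ih =>
    push_cast at hi
    have hi' := ih (by linarith)
    have hlt := hij (i + 1) (by push_cast; exact hi)
    obtain ⟨l, rfl⟩ := Nat.exists_eq_add_of_le hlt
    have h1 := hu.siteMass_succ_mul hφ l
    rw [show i + 1 + l - i = l + 1 by omega] at hi'
    rw [show i + 1 + l - (i + 1) = l by omega]
    have hge : φ * Real.exp (-(2 * (a₁ * (i + 1) / φ))) ≤ u (l + 1) := by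
      have h2 := hu.le_add_mul (l + 1) i
      rw [show l + 1 + i = i + 1 + l by ring] at h2
      have h3 : a₁ * (i + 1) / φ ≤ 1 / 2 := by
        rw [div_le_iff₀ hφ]; linarith
      have h4 := exp_neg_two_mul_le (by positivity) h3
      have h5 : φ * (1 - a₁ * (i + 1) / φ) = φ - a₁ * (i + 1) := by field_simp
      nlinarith [mul_le_mul_of_nonneg_left h4 hφ.le]
    have hpos := hu.siteMass_pos hφ (l + 1)
    have h5 : siteMass u φ (l + 1) * Real.exp (-(2 * (a₁ * (i + 1) / φ))) ≤ siteMass u φ l := by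
      have : φ * (siteMass u φ (l + 1) * Real.exp (-(2 * (a₁ * (i + 1) / φ)))) ≤
          φ * siteMass u φ l := by
        rw [← h1]
        nlinarith [mul_le_mul_of_nonneg_left hge hpos.le]
      exact le_of_mul_le_mul_left this hφ
    have hj0 := hu.siteMass_pos hφ (i + 1 + l)
    calc siteMass u φ (i + 1 + l) * Real.exp (-(2 * a₁ * ((i + 1 : ℕ) : ℝ) ^ 2 / φ))
        ≤ siteMass u φ (i + 1 + l) *
            Real.exp (-(2 * a₁ * i ^ 2 / φ) - 2 * (a₁ * (i + 1) / φ)) := by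
          gcongr
          rw [show -(2 * a₁ * (i : ℝ) ^ 2 / φ) - 2 * (a₁ * (i + 1) / φ) =
            -(2 * a₁ * (i ^ 2 + i + 1) / φ) by ring]
          gcongr
          push_cast
          nlinarith [(i.cast_nonneg : (0 : ℝ) ≤ i)]
      _ = siteMass u φ (i + 1 + l) * Real.exp (-(2 * a₁ * i ^ 2 / φ)) *
            Real.exp (-(2 * (a₁ * (i + 1) / φ))) := by
          rw [mul_assoc (siteMass u φ _), ← Real.exp_add, sub_eq_add_neg]
      _ ≤ siteMass u φ (l + 1) * Real.exp (-(2 * (a₁ * (i + 1) / φ))) := by gcongr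
      _ ≤ _ := h5

end TameRates

/-! ### Concentration and anticoncentration of the site measure. -/

namespace TameRates

variable {c₁ a₁ K : ℝ} {u : ℕ → ℝ}

/-- The length of the window on which the site measure is comparable to its value at an end. -/
theorem exists_window {φ : ℝ} (hφ : 0 < φ) (ha : 0 < a₁) :
    ∃ N : ℕ, √φ / √(2 * a₁) ≤ N + 1 ∧ (N : ℝ) ≤ √φ / √(2 * a₁) ∧
      ∀ i ≤ N, a₁ * (i : ℝ) ^ 2 / φ ≤ 1 / 2 ∧ 2 * (a₁ * i) ≤ φ := by
  have hs : 0 ≤ √φ / √(2 * a₁) := by positivity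
  refine ⟨⌊√φ / √(2 * a₁)⌋₊, (Nat.lt_floor_add_one _).le, Nat.floor_le hs, fun i hi => ?_⟩
  have h1 : (i : ℝ) ≤ √φ / √(2 * a₁) := le_trans (by exact_mod_cast hi) (Nat.floor_le hs)
  have h2 : (i : ℝ) ^ 2 ≤ φ / (2 * a₁) := by
    calc (i : ℝ) ^ 2 ≤ (√φ / √(2 * a₁)) ^ 2 := by gcongr
      _ = φ / (2 * a₁) := by rw [div_pow, Real.sq_sqrt hφ.le, Real.sq_sqrt (by positivity)]
  rw [le_div_iff₀ (by positivity)] at h2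
  constructor
  · rw [div_le_iff₀ hφ]; linarith
  · rcases Nat.eq_zero_or_pos i with h | h
    · subst h; simp; exact hφ.le
    · have : (1 : ℝ) ≤ i := by exact_mod_cast h
      nlinarith

/-- Upper bound on the atoms of the site measure. -/
theorem siteMass_mul_sqrt_le (hu : TameRates c₁ a₁ K u) {φ : ℝ} (hφ : 0 < φ) (j : ℕ) :
    siteMass u φ j * √φ ≤ Real.exp 1 * √(2 * a₁) := by
  have ha := hu.const_pos
  obtain ⟨N, hN, -, hw⟩ := exists_window hφ ha
  have hj0 := hu.siteMass_pos hφ j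
  have key : (N + 1 : ℝ) * (siteMass u φ j * Real.exp (-1)) ≤ 1 := by
    -- The window is laid on the side of `j` where the mass cannot drop fast: upwards if the rate is
    -- below the fugacity, downwards otherwise.
    rcases le_total (u j) φ with h | h
    · calc (N + 1 : ℝ) * (siteMass u φ j * Real.exp (-1))
          = ∑ i ∈ range (N + 1), siteMass u φ j * Real.exp (-1) := by simp
        _ ≤ ∑ i ∈ range (N + 1), siteMass u φ (j + i) := by
            refine sum_le_sum fun i hi => le_trans ?_ (hu.siteMass_add_ge hφ h i)
            have := (hw i (Nat.lt_succ_iff.1 (mem_range.1 hi))).1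
            gcongr
            linarith
        _ = ∑ k ∈ (range (N + 1)).image (fun i => j + i), siteMass u φ k :=
            (sum_image (by intro a _ b _ h; simpa using h)).symm
        _ ≤ 1 := hu.sum_siteMass_le hφ _
    · have hd := fun i (hi : i ≤ N) =>
        hu.siteMass_sub_ge hφ (show φ ≤ u j + a₁ by linarith) i (hw i hi).2
      calc (N + 1 : ℝ) * (siteMass u φ j * Real.exp (-1))
          = ∑ i ∈ range (N + 1), siteMass u φ j * Real.exp (-1) := by simp
        _ ≤ ∑ i ∈ range (N + 1), siteMass u φ (j - i) := by
            refine sum_le_sum fun i hi => ?_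
            have hi' := Nat.lt_succ_iff.1 (mem_range.1 hi)
            refine le_trans ?_ (hd i hi').2
            have := (hw i hi').1
            gcongr
            rw [mul_assoc, mul_div_assoc]
            linarith
        _ = ∑ k ∈ (range (N + 1)).image (fun i => j - i), siteMass u φ k := by
            refine (sum_image ?_).symm
            intro a ha b hb h
            have h1 := (hd a (Nat.lt_succ_iff.1 (by simpa using ha))).1
            have h2 := (hd b (Nat.lt_succ_iff.1 (by simpa using hb))).1
            omega
        _ ≤ 1 := hu.sum_siteMass_le hφ _
  have hpos : 0 < √(2 * a₁) := by positivity
  have h1 : √φ / √(2 * a₁) * (siteMass u φ j * Real.exp (-1)) ≤ 1 := by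
    refine le_trans ?_ key
    gcongr
  rw [Real.exp_neg] at h1
  have h2 : √φ / √(2 * a₁) * (siteMass u φ j * (Real.exp 1)⁻¹) =
      siteMass u φ j * √φ / (Real.exp 1 * √(2 * a₁)) := by field_simp
  rwa [h2, div_le_one (by positivity)] at h1

/-- Exponential concentration of the site measure around the tilted mean. -/
theorem sum_siteMass_far_le (hu : TameRates c₁ a₁ K u) (hK : 0 ≤ K) {m τ : ℝ}
    (hτ : ∀ t, logPartition u τ - m * τ ≤ logPartition u t - m * t) {h s : ℝ} (hh0 : 0 ≤ h)
    (hh1 : h ≤ 1) (S : Finset ℕ) (hS : ∀ j ∈ S, s ≤ |(j : ℝ) - m|) :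
    ∑ j ∈ S, siteMass u (Real.exp τ) j ≤ 2 * Real.exp (2 * K * Real.exp τ * h ^ 2 - h * s) := by
  have hZ := hu.partition_pos (Real.exp_pos τ).le
  -- Chernoff bound for `g = ±h`: tilting the site measure by `e^{gj}` replaces `τ` by `τ + g`.
  have hexp : ∀ g : ℝ, |g| ≤ 1 → g ^ 2 = h ^ 2 →
      ∑ j ∈ S, siteMass u (Real.exp τ) j * Real.exp (g * (j - m)) ≤
        Real.exp (2 * K * Real.exp τ * h ^ 2) := by
    intro g hg hgh
    have e : ∀ j : ℕ, siteMass u (Real.exp τ) j * Real.exp (g * (j - m)) =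
        Real.exp (τ + g) ^ j / rateFactorial u j *
          (Real.exp (-(logPartition u τ)) * Real.exp (-(g * m))) := by
      intro j
      rw [siteMass, ← hu.exp_logPartition, ← Real.exp_nat_mul, ← Real.exp_nat_mul]
      have h1 : Real.exp (g * (j - m)) = Real.exp (j * g) * Real.exp (-(g * m)) := by
        rw [← Real.exp_add]; ring_nf
      have h2 : Real.exp (j * (τ + g)) = Real.exp (j * τ) * Real.exp (j * g) := by
        rw [← Real.exp_add]; ring_nf
      rw [h1, h2, Real.exp_neg (logPartition u τ)]
      have := (hu.fact_pos j).ne'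
      have := (Real.exp_pos (logPartition u τ)).ne'
      field_simp
    simp only [e]
    rw [← sum_mul]
    calc _ ≤ sitePartition u (Real.exp (τ + g)) *
          (Real.exp (-(logPartition u τ)) * Real.exp (-(g * m))) := by
          gcongr
          exact hu.sum_le_partition S (Real.exp_pos _).le
      _ = Real.exp (logPartition u (τ + g) - logPartition u τ - g * m) := by
          rw [← hu.exp_logPartition, ← Real.exp_add, ← Real.exp_add]; ring_nf
      _ ≤ _ := by
          rw [← hgh]
          exact Real.exp_le_exp.2 (hu.logPartition_add_le hK hτ hg)
  have h1 := hexp h (by rwa [abs_of_nonneg hh0]) rfl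
  have h2 := hexp (-h) (by rwa [abs_neg, abs_of_nonneg hh0]) (neg_sq h)
  calc ∑ j ∈ S, siteMass u (Real.exp τ) j
      ≤ ∑ j ∈ S, (siteMass u (Real.exp τ) j * Real.exp (h * (j - m)) +
          siteMass u (Real.exp τ) j * Real.exp (-h * (j - m))) * Real.exp (-(h * s)) := by
        refine sum_le_sum fun j hj => ?_
        have hp := hu.siteMass_pos (Real.exp_pos τ) j
        have h3 : 1 ≤ (Real.exp (h * (j - m)) + Real.exp (-h * (j - m))) * Real.exp (-(h * s)) := by
          have h4 : Real.exp (h * s) ≤ Real.exp (h * (j - m)) + Real.exp (-h * (j - m)) := by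
            have h5 := mul_le_mul_of_nonneg_left (hS j hj) hh0
            rcases abs_cases ((j : ℝ) - m) with ⟨h6, -⟩ | ⟨h6, -⟩
            · rw [h6] at h5
              linarith [Real.exp_le_exp.2 h5, Real.exp_pos (-h * (j - m))]
            · rw [h6, mul_neg, ← neg_mul] at h5
              linarith [Real.exp_le_exp.2 h5, Real.exp_pos (h * (j - m))]
          calc (1 : ℝ) = Real.exp (h * s) * Real.exp (-(h * s)) := by
                rw [← Real.exp_add, add_neg_cancel, Real.exp_zero]
            _ ≤ _ := by gcongr
        nlinarith
    _ = (∑ j ∈ S, siteMass u (Real.exp τ) j * Real.exp (h * (j - m)) +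
          ∑ j ∈ S, siteMass u (Real.exp τ) j * Real.exp (-h * (j - m))) * Real.exp (-(h * s)) := by
        rw [← sum_mul, sum_add_distrib]
    _ ≤ (Real.exp (2 * K * Real.exp τ * h ^ 2) + Real.exp (2 * K * Real.exp τ * h ^ 2)) *
          Real.exp (-(h * s)) := by gcongr
    _ = _ := by rw [← two_mul, mul_assoc, ← Real.exp_add, sub_eq_add_neg]

/-- The site measure has a mode, which sits where the rates cross the fugacity. -/
theorem exists_mode (hu : TameRates c₁ a₁ K u) {φ : ℝ} (hφ : 0 < φ) :
    ∃ J : ℕ, (∀ j, siteMass u φ j ≤ siteMass u φ J) ∧ u J ≤ φ ∧ φ ≤ u (J + 1) := by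
  have hp0 := hu.siteMass_pos hφ
  obtain ⟨J, hJ⟩ : ∃ J : ℕ, ∀ j, siteMass u φ j ≤ siteMass u φ J := by
    have ht := (hu.hasSum_siteMass hφ).summable.tendsto_atTop_zero
    obtain ⟨N, hN⟩ := Filter.eventually_atTop.1 (ht.eventually (gt_mem_nhds (hp0 0)))
    obtain ⟨J, -, hJ⟩ := exists_max_image (range (N + 1)) (siteMass u φ) ⟨0, by simp⟩
    refine ⟨J, fun j => ?_⟩
    rcases Nat.lt_or_ge j (N + 1) with h | h
    · exact hJ j (mem_range.2 h)
    · exact (hN j (by omega)).le.trans (hJ 0 (by simp))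
  refine ⟨J, hJ, ?_, ?_⟩
  · rcases J with _ | J
    · rw [hu.zero]; exact hφ.le
    · have h1 := hu.siteMass_succ_mul hφ J
      have h2 := mul_le_mul_of_nonneg_left (hJ J) hφ.le
      rw [← h1, mul_comm] at h2
      exact le_of_mul_le_mul_right h2 (hp0 _)
  · have h1 := hu.siteMass_succ_mul hφ J
    have h2 := mul_le_mul_of_nonneg_left (hJ (J + 1)) hφ.le
    rw [← h1, mul_comm (siteMass u φ (J + 1))] at h2
    exact le_of_mul_le_mul_right h2 (hp0 _)

/-- Going down from the mode to a point at distance at most `D √φ`. -/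
theorem siteMass_below_mode_ge (hu : TameRates c₁ a₁ K u) {φ D : ℝ} (hφ : 0 < φ) (hD : 0 ≤ D)
    {J i : ℕ} (hJ : φ ≤ u (J + 1)) (hiJ : i ≤ J) (hi : (i : ℝ) ≤ D * √φ) :
    siteMass u φ J * (Real.exp (-(2 * a₁ * D ^ 2)) *
      min 1 (c₁ / (2 * a₁ * D) ^ 2) ^ ⌈2 * a₁ * D ^ 2⌉₊) ≤ siteMass u φ (J - i) := by
  have ha := hu.const_pos
  have hc := hu.pos
  have hp := hu.siteMass_pos hφ
  set q := min 1 (c₁ / (2 * a₁ * D) ^ 2) with hq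
  have hq0 : 0 ≤ q := le_min zero_le_one (by positivity)
  have hq1 : q ≤ 1 := min_le_left _ _
  have hsq : √φ ^ 2 = φ := Real.sq_sqrt hφ.le
  -- In the second case `φ < 2 a₁ D √φ` bounds the fugacity, so each downward ratio is at least `q`
  -- and there are at most `2 a₁ D²` steps.
  rcases le_or_gt (2 * (a₁ * i)) φ with h | h
  · refine le_trans ?_ (hu.siteMass_sub_ge hφ (hJ.trans (hu.step J)) i h).2
    refine mul_le_mul_of_nonneg_left ?_ (hp J).le
    refine (mul_le_of_le_one_right (Real.exp_pos _).le (pow_le_one₀ hq0 hq1)).trans ?_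
    refine Real.exp_le_exp.2 (neg_le_neg ?_)
    rw [div_le_iff₀ hφ]
    calc 2 * a₁ * (i : ℝ) ^ 2 ≤ 2 * a₁ * (D * √φ) ^ 2 := by gcongr
      _ = 2 * a₁ * D ^ 2 * φ := by rw [mul_pow, hsq]; ring
  · have hs : √φ < 2 * a₁ * D := by
      have h1 : √φ * √φ < 2 * a₁ * D * √φ := by
        rw [← sq, hsq]
        calc φ < 2 * (a₁ * i) := h
          _ ≤ 2 * (a₁ * (D * √φ)) := by gcongr
          _ = _ := by ring
      exact lt_of_mul_lt_mul_right h1 (Real.sqrt_nonneg φ)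
    have hφ' : φ ≤ (2 * a₁ * D) ^ 2 := by rw [← hsq]; gcongr
    have hqφ : φ * q ≤ c₁ := by
      have hpos : 0 < (2 * a₁ * D) ^ 2 := hφ.trans_le hφ'
      calc φ * q ≤ (2 * a₁ * D) ^ 2 * (c₁ / (2 * a₁ * D) ^ 2) := by
            gcongr; exact min_le_right _ _
        _ = c₁ := by rw [mul_div_assoc', mul_div_cancel_left₀ _ hpos.ne']
    have hstep : ∀ l, siteMass u φ (l + 1) * q ≤ siteMass u φ l := by
      intro l
      have h1 := hu.siteMass_succ_mul hφ l
      have h2 := hu.lower (l + 1)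
      have h3 : c₁ ≤ c₁ * ((l + 1 : ℕ) : ℝ) := le_mul_of_one_le_right hc.le (by push_cast; linarith [(l.cast_nonneg : (0:ℝ) ≤ l)])
      have : φ * (siteMass u φ (l + 1) * q) ≤ φ * siteMass u φ l := by
        rw [← h1]
        nlinarith [mul_le_mul_of_nonneg_left (hqφ.trans (h3.trans h2)) (hp (l + 1)).le]
      exact le_of_mul_le_mul_left this hφ
    have hpow : ∀ i ≤ J, siteMass u φ J * q ^ i ≤ siteMass u φ (J - i) := by
      intro i hi
      induction i with
      | zero => simp
      | succ i ih =>
        have h1 := hstep (J - (i + 1))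
        rw [show J - (i + 1) + 1 = J - i by omega] at h1
        rw [pow_succ, ← mul_assoc]
        exact (mul_le_mul_of_nonneg_right (ih (by omega)) hq0).trans h1
    refine le_trans (mul_le_mul_of_nonneg_left ?_ (hp J).le) (hpow i hiJ)
    refine (mul_le_of_le_one_left (pow_nonneg hq0 _) (Real.exp_le_one_iff.2 ?_)).trans ?_
    · rw [neg_nonpos]; positivity
    · refine pow_le_pow_of_le_one hq0 hq1 ?_
      have : (i : ℝ) ≤ 2 * a₁ * D ^ 2 := by
        calc (i : ℝ) ≤ D * √φ := hi
          _ ≤ D * (2 * a₁ * D) := by gcongr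
          _ = _ := by ring
      exact_mod_cast this.trans (Nat.le_ceil _)

end TameRates

/-! ### Mass of the site measure near the tilted mean. -/

namespace TameRates

theorem card_near_le (m s : ℝ) (hs : 0 ≤ s) (S : Finset ℕ) (hS : ∀ j ∈ S, |(j : ℝ) - m| < s) :
    (#S : ℝ) ≤ 2 * s + 1 := by
  have hsub : S ⊆ Ico ⌈m - s⌉₊ (⌊m + s⌋₊ + 1) := by
    intro j hj
    have h := abs_lt.1 (hS j hj)
    refine mem_Ico.2 ⟨Nat.ceil_le.2 (by linarith), Nat.lt_succ_iff.2 (Nat.le_floor (by linarith))⟩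
  have h1 : (#S : ℝ) ≤ ((⌊m + s⌋₊ + 1 - ⌈m - s⌉₊ : ℕ) : ℝ) := by
    rw [← Nat.card_Ico]; exact_mod_cast card_le_card hsub
  refine h1.trans ?_
  rcases le_total (⌊m + s⌋₊ + 1) ⌈m - s⌉₊ with h | h
  · rw [Nat.sub_eq_zero_of_le h]; simp; linarith
  · rw [Nat.cast_sub h]
    have h2 := Nat.le_ceil (m - s)
    rcases le_total 0 (m + s) with h3 | h3
    · have := Nat.floor_le h3
      push_cast
      linarith
    · rw [Nat.floor_of_nonpos h3]
      have : (0 : ℝ) ≤ (⌈m - s⌉₊ : ℝ) := by positivity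
      push_cast
      linarith

variable {c₁ a₁ K : ℝ} {u : ℕ → ℝ}

/-- Concentration at the scale of the square root of the fugacity. -/
theorem sum_siteMass_far_le_of_scale (hu : TameRates c₁ a₁ K u) (hK : 0 ≤ K) {m τ b : ℝ}
    (hτ : ∀ t, logPartition u τ - m * τ ≤ logPartition u t - m * t) (hb0 : 0 ≤ b) (hb1 : b ≤ 1)
    (hbτ : b ≤ √(Real.exp τ)) (T : ℝ) (S : Finset ℕ)
    (hS : ∀ j ∈ S, T * √(Real.exp τ) ≤ |(j : ℝ) - m|) :
    ∑ j ∈ S, siteMass u (Real.exp τ) j ≤ 2 * Real.exp (2 * K - b * T) := by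
  have hsφ : 0 < √(Real.exp τ) := Real.sqrt_pos.2 (Real.exp_pos τ)
  have hsq : √(Real.exp τ) ^ 2 = Real.exp τ := Real.sq_sqrt (Real.exp_pos τ).le
  have hbφ : b / √(Real.exp τ) ≤ 1 := (div_le_one hsφ).2 hbτ
  refine (hu.sum_siteMass_far_le hK hτ (h := b / √(Real.exp τ)) (by positivity) hbφ S hS).trans ?_
  have e1 : 2 * K * Real.exp τ * (b / √(Real.exp τ)) ^ 2 = 2 * K * b ^ 2 := by
    rw [div_pow, hsq]
    have := (Real.exp_pos τ).ne'
    field_simp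
  have e2 : b / √(Real.exp τ) * (T * √(Real.exp τ)) = b * T := by field_simp
  rw [e1, e2]
  have h2 : K * b ^ 2 ≤ K * 1 := mul_le_mul_of_nonneg_left (pow_le_one₀ hb0 hb1) hK
  refine mul_le_mul_of_nonneg_left (Real.exp_le_exp.2 ?_) zero_le_two
  linarith

/-- A law with exponential concentration has an atom of the natural order of magnitude. -/
theorem mode_mass_ge (hu : TameRates c₁ a₁ K u) {m φ b s : ℝ} (hK : 0 ≤ K) (hφ : 0 < φ)
    (hb0 : 0 < b) (hs : 0 < s) (hsφ : s ≤ 2 * √φ)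
    (hfar : ∀ (T : ℝ) (S : Finset ℕ), (∀ j ∈ S, T * √φ ≤ |(j : ℝ) - m|) →
      ∑ j ∈ S, siteMass u φ j ≤ 2 * Real.exp (2 * K - b * T))
    {J : ℕ} (hJ : ∀ j, siteMass u φ j ≤ siteMass u φ J) :
    1 / (4 * ((2 * K + 3) / b) + 4 / s) ≤ siteMass u φ J * √φ := by
  -- With this `T₁` the mass beyond `T₁ √φ` is at most `2 e^{-3} ≤ 1/4`, so at least half of the
  -- mass sits on about `2 T₁ √φ + 1` integers.
  set T₁ := (2 * K + 3) / b with hT₁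
  have hT₁0 : 0 < T₁ := by positivity
  have hp := hu.siteMass_pos hφ J
  obtain ⟨S, hS⟩ : ∃ S : Finset ℕ, 3 / 4 < ∑ j ∈ S, siteMass u φ j :=
    ((hu.hasSum_siteMass hφ).eventually (lt_mem_nhds (by norm_num))).exists
  have hsplit := sum_filter_add_sum_filter_not S (fun j : ℕ => |(j : ℝ) - m| < T₁ * √φ)
    (siteMass u φ)
  have h1 := hfar T₁ (S.filter fun j : ℕ => ¬|(j : ℝ) - m| < T₁ * √φ)
    fun j hj => not_lt.1 (mem_filter.1 hj).2
  have h2 : 2 * Real.exp (2 * K - b * T₁) ≤ 1 / 4 := by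
    have e : 2 * K - b * T₁ = -3 := by rw [hT₁]; field_simp; ring
    rw [e, Real.exp_neg]
    have h3 : (8 : ℝ) ≤ Real.exp 3 := by
      have := Real.exp_one_gt_d9
      calc (8 : ℝ) = 2 ^ 3 := by norm_num
        _ ≤ Real.exp 1 ^ 3 := by gcongr; linarith
        _ = Real.exp 3 := by rw [← Real.exp_nat_mul]; norm_num
    have h4 : (Real.exp 3)⁻¹ ≤ 8⁻¹ := inv_anti₀ (by norm_num) h3
    linarith
  have h3 := card_near_le m (T₁ * √φ) (by positivity)
    (S.filter fun j : ℕ => |(j : ℝ) - m| < T₁ * √φ) fun j hj => (mem_filter.1 hj).2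
  have h4 : ∑ j ∈ S.filter (fun j : ℕ => |(j : ℝ) - m| < T₁ * √φ), siteMass u φ j ≤
      (2 * (T₁ * √φ) + 1) * siteMass u φ J := by
    refine (sum_le_card_nsmul _ _ _ fun j _ => hJ j).trans ?_
    rw [nsmul_eq_mul]
    gcongr
  -- The lower bound on `√φ` absorbs the `+ 1` of the integer count.
  have h5 : 1 ≤ 2 / s * √φ := by
    rw [div_mul_eq_mul_div, le_div_iff₀ hs]; linarith
  have h6 : 1 / 2 ≤ (2 * T₁ + 2 / s) * (siteMass u φ J * √φ) := by
    have h7 := mul_le_mul_of_nonneg_right h5 hp.le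
    have e : (2 * T₁ + 2 / s) * (siteMass u φ J * √φ) =
      2 * (T₁ * √φ) * siteMass u φ J + 2 / s * √φ * siteMass u φ J := by ring
    rw [e]
    linarith
  rw [div_le_iff₀ (by positivity)]
  have e : siteMass u φ J * √φ * (4 * T₁ + 4 / s) =
      2 * ((2 * T₁ + 2 / s) * (siteMass u φ J * √φ)) := by ring
  linarith

/-- The mode lies within the natural scale of the centre of concentration. -/
theorem mode_close (hu : TameRates c₁ a₁ K u) {m φ b c₂ : ℝ} (hφ : 0 < φ) (hb0 : 0 < b)
    (hc₂ : 0 < c₂)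
    (hfar : ∀ (T : ℝ) (S : Finset ℕ), (∀ j ∈ S, T * √φ ≤ |(j : ℝ) - m|) →
      ∑ j ∈ S, siteMass u φ j ≤ 2 * Real.exp (2 * K - b * T))
    {J : ℕ} (hJ : u J ≤ φ) (hmass : c₂ ≤ siteMass u φ J * √φ) :
    |m - J| ≤ (max ((2 * K + 1 - Real.log (c₂ * Real.exp (-1) / √(2 * a₁) / 2)) / b) 0 +
      1 / √(2 * a₁)) * √φ := by
  have ha := hu.const_pos
  have hp := hu.siteMass_pos hφ J
  set c₄ := c₂ * Real.exp (-1) / √(2 * a₁) with hc₄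
  have hc₄0 : 0 < c₄ := by positivity
  -- The mass beyond `T₂ √φ` is then at most `c₄ / e`, less than the mass `c₄` found on the window
  -- above the mode. Hence the window meets the central region.
  set T₂ := (2 * K + 1 - Real.log (c₄ / 2)) / b with hT₂
  obtain ⟨N, hN1, hN2, hw⟩ := exists_window hφ ha
  have hwin : c₄ ≤ ∑ j ∈ (range (N + 1)).image (fun i => J + i), siteMass u φ j := by
    rw [sum_image (by intro a _ b _ h; simpa using h)]
    calc c₄ ≤ (siteMass u φ J * √φ) * Real.exp (-1) / √(2 * a₁) := by rw [hc₄]; gcongr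
      _ = (√φ / √(2 * a₁)) * (siteMass u φ J * Real.exp (-1)) := by ring
      _ ≤ (N + 1) * (siteMass u φ J * Real.exp (-1)) := by gcongr
      _ = ∑ i ∈ range (N + 1), siteMass u φ J * Real.exp (-1) := by simp
      _ ≤ _ := by
          refine sum_le_sum fun i hi => le_trans ?_ (hu.siteMass_add_ge hφ hJ i)
          have := (hw i (Nat.lt_succ_iff.1 (mem_range.1 hi))).1
          gcongr
          linarith
  have hex : ∃ i ≤ N, |((J + i : ℕ) : ℝ) - m| < T₂ * √φ := by
    by_contra! hcon
    have h1 := hfar T₂ ((range (N + 1)).image (fun i => J + i)) (by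
      intro j hj
      obtain ⟨i, hi, rfl⟩ := mem_image.1 hj
      exact hcon i (Nat.lt_succ_iff.1 (mem_range.1 hi)))
    have e : 2 * K - b * T₂ = Real.log (c₄ / 2) + -1 := by rw [hT₂]; field_simp; ring
    rw [e, Real.exp_add, Real.exp_log (by positivity)] at h1
    have h2 : Real.exp (-1) < 1 := Real.exp_zero ▸ Real.exp_lt_exp.2 (by norm_num)
    have h3 := mul_lt_mul_of_pos_left h2 hc₄0
    linarith
  obtain ⟨i, hi, hi2⟩ := hex
  have hiN : (i : ℝ) ≤ √φ / √(2 * a₁) := le_trans (by exact_mod_cast hi) hN2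
  have h4 : T₂ * √φ ≤ max T₂ 0 * √φ := by gcongr; exact le_max_left _ _
  have h5 : (max T₂ 0 + 1 / √(2 * a₁)) * √φ = max T₂ 0 * √φ + √φ / √(2 * a₁) := by ring
  have hi0 : (0 : ℝ) ≤ i := i.cast_nonneg
  have h6 := abs_lt.1 hi2
  push_cast at h6
  rw [h5, abs_le]
  constructor <;> linarith

/-- Comparison of a point at distance `D √φ` with the mode. -/
theorem siteMass_near_mode_ge (hu : TameRates c₁ a₁ K u) {φ D : ℝ} (hφ : 0 < φ) (hD : 0 < D)
    {J k : ℕ} (hJ1 : u J ≤ φ) (hJ2 : φ ≤ u (J + 1)) (hclose : |(k : ℝ) - J| ≤ D * √φ) :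
    siteMass u φ J * (Real.exp (-(2 * a₁ * D ^ 2)) *
      min 1 (c₁ / (2 * a₁ * D) ^ 2) ^ ⌈2 * a₁ * D ^ 2⌉₊) ≤ siteMass u φ k := by
  have ha := hu.const_pos
  have hc := hu.pos
  have hsq : √φ ^ 2 = φ := Real.sq_sqrt hφ.le
  rcases le_total J k with h | h
  · obtain ⟨i, rfl⟩ := Nat.exists_eq_add_of_le h
    refine le_trans ?_ (hu.siteMass_add_ge hφ hJ1 i)
    refine mul_le_mul_of_nonneg_left ?_ (hu.siteMass_pos hφ J).le
    refine (mul_le_of_le_one_right (Real.exp_pos _).le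
      (pow_le_one₀ (le_min zero_le_one (by positivity)) (min_le_left _ _))).trans ?_
    refine Real.exp_le_exp.2 (neg_le_neg ?_)
    have hi : (i : ℝ) ≤ D * √φ := by
      have := (abs_le.1 hclose).2
      push_cast at this
      linarith
    rw [div_le_iff₀ hφ]
    calc a₁ * (i : ℝ) ^ 2 ≤ a₁ * (D * √φ) ^ 2 := by gcongr
      _ = a₁ * D ^ 2 * φ := by rw [mul_pow, hsq]; ring
      _ ≤ 2 * a₁ * D ^ 2 * φ := by
          have : 0 ≤ a₁ * D ^ 2 * φ := by positivity
          linarith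
  · have hi : ((J - k : ℕ) : ℝ) ≤ D * √φ := by
      have := (abs_le.1 hclose).1
      rw [Nat.cast_sub h]
      linarith
    have := hu.siteMass_below_mode_ge hφ hD.le hJ2 (Nat.sub_le J k) hi
    rwa [Nat.sub_sub_self h] at this

/-- A uniform lower bound on the mass of the integer below the tilted mean. -/
theorem exists_siteMass_ge (hc : 0 < c₁) (ha : 0 < a₁) (hK : 0 ≤ K) :
    ∃ δ : ℝ, 0 < δ ∧ ∀ u : ℕ → ℝ, TameRates c₁ a₁ K u → ∀ (k : ℕ) (τ : ℝ),
      (∀ t, logPartition u τ - ((k : ℝ) + 1 / 2) * τ ≤ logPartition u t - ((k : ℝ) + 1 / 2) * t) →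
        δ ≤ siteMass u (Real.exp τ) k * √(Real.exp τ) := by
  -- At the minimiser the fugacity is at least `c₁/4`, so `b ≤ √φ` and the tilt `b/√φ` is
  -- admissible.
  obtain ⟨b, hb0, hb1, hbc⟩ : ∃ b : ℝ, 0 < b ∧ b ≤ 1 ∧ b ≤ √c₁ / 2 :=
    ⟨min 1 (√c₁ / 2), lt_min one_pos (by positivity), min_le_left _ _, min_le_right _ _⟩
  obtain ⟨c₂, hc₂, hc₂0⟩ : ∃ c₂, c₂ = 1 / (4 * ((2 * K + 3) / b) + 4 / √c₁) ∧ 0 < c₂ :=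
    ⟨_, rfl, by positivity⟩
  obtain ⟨D', hD', hD'0⟩ : ∃ D', D' = max ((2 * K + 1 -
      Real.log (c₂ * Real.exp (-1) / √(2 * a₁) / 2)) / b) 0 + 1 / √(2 * a₁) ∧ 0 < D' :=
    ⟨_, rfl, by positivity⟩
  -- The extra `1/√c₁` covers the half unit between `k` and the centre `k + 1/2`.
  obtain ⟨D, hD, hD0⟩ : ∃ D, D = D' + 1 / √c₁ ∧ 0 < D := ⟨_, rfl, by positivity⟩
  obtain ⟨δ₁, hδ₁, hδ₁0⟩ : ∃ δ₁, δ₁ = Real.exp (-(2 * a₁ * D ^ 2)) *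
      min 1 (c₁ / (2 * a₁ * D) ^ 2) ^ ⌈2 * a₁ * D ^ 2⌉₊ ∧ 0 < δ₁ := by
    refine ⟨_, rfl, mul_pos (Real.exp_pos _) (pow_pos (lt_min one_pos (by positivity)) _)⟩
  refine ⟨δ₁ * c₂, by positivity, fun u hu k τ hτ => ?_⟩
  have hφ : 0 < Real.exp τ := Real.exp_pos τ
  have hsc : 0 < √c₁ := Real.sqrt_pos.2 hc
  have hlow : √c₁ ≤ 2 * √(Real.exp τ) := by
    have h1 := (hu.fugacity_bounds hτ).1
    have h2 : (1 : ℝ) / 2 ≤ (k : ℝ) + 1 / 2 := by linarith [(k.cast_nonneg : (0 : ℝ) ≤ k)]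
    rw [Real.sqrt_le_left (by positivity), mul_pow, Real.sq_sqrt hφ.le]
    have h3 := mul_le_mul_of_nonneg_left h2 hc.le
    linarith
  have hfar := hu.sum_siteMass_far_le_of_scale hK hτ hb0.le hb1 (by linarith)
  obtain ⟨J, hJmax, hJ1, hJ2⟩ := hu.exists_mode hφ
  have hmass := hu.mode_mass_ge hK hφ hb0 hsc hlow hfar hJmax
  rw [← hc₂] at hmass
  have hclose := hu.mode_close hφ hb0 hc₂0 hfar hJ1 hmass
  rw [← hD'] at hclose
  have hclose' : |(k : ℝ) - J| ≤ D * √(Real.exp τ) := by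
    have h3 : 1 / 2 ≤ 1 / √c₁ * √(Real.exp τ) := by
      rw [div_mul_eq_mul_div, one_mul, le_div_iff₀ hsc]; linarith
    rw [hD, add_mul]
    have h4 := abs_le.1 hclose
    rw [abs_le]
    constructor <;> linarith
  have hcomp := hu.siteMass_near_mode_ge hφ hD0 hJ1 hJ2 hclose'
  rw [← hδ₁] at hcomp
  calc δ₁ * c₂ ≤ δ₁ * (siteMass u (Real.exp τ) J * √(Real.exp τ)) := by gcongr
    _ = siteMass u (Real.exp τ) J * δ₁ * √(Real.exp τ) := by ring
    _ ≤ _ := by gcongr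

/-- The weights `1 / u(k)!` are comparable to the exponential of the concave conjugate of the
logarithmic partition function. -/
theorem exists_inv_rateFactorial_bounds (hc : 0 < c₁) (ha : 0 < a₁) (hK : 0 ≤ K) :
    ∃ A : ℝ, 1 ≤ A ∧ ∀ u : ℕ → ℝ, TameRates c₁ a₁ K u → ∀ k : ℕ,
      A⁻¹ * Real.exp (legendre u k) ≤ (rateFactorial u k)⁻¹ ∧
        (rateFactorial u k)⁻¹ ≤ A * Real.exp (legendre u k) := by
  obtain ⟨δ, hδ, hlow⟩ := exists_siteMass_ge hc ha hK
  refine ⟨max 1 (max δ⁻¹ (Real.exp 1 * √(2 * a₁))), le_max_left _ _, fun u hu k => ?_⟩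
  obtain ⟨τ, hτ, hmin⟩ := hu.exists_legendre k
  have h1 := hlow u hu k τ fun t => hτ ▸ hmin t
  have h2 := hu.siteMass_mul_sqrt_le (Real.exp_pos τ) k
  -- The factor `√φ = e^{τ/2}` turns `kτ` into `(k + 1/2) τ`, which is why the conjugate is taken at
  -- half-integers.
  have e : (rateFactorial u k)⁻¹ =
      siteMass u (Real.exp τ) k * √(Real.exp τ) * Real.exp (legendre u k) := by
    rw [hτ, siteMass, ← hu.exp_logPartition, ← Real.exp_nat_mul, ← Real.exp_half]
    have e1 : Real.exp (logPartition u τ - ((k : ℝ) + 1 / 2) * τ) =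
        Real.exp (logPartition u τ) * (Real.exp (k * τ))⁻¹ * (Real.exp (τ / 2))⁻¹ := by
      rw [← Real.exp_neg, ← Real.exp_neg, ← Real.exp_add, ← Real.exp_add]; ring_nf
    rw [e1]
    have := (hu.fact_pos k).ne'
    have := (Real.exp_pos (logPartition u τ)).ne'
    have := (Real.exp_pos (k * τ)).ne'
    have := (Real.exp_pos (τ / 2)).ne'
    field_simp
  rw [e]
  constructor
  · gcongr
    refine le_trans ?_ h1
    rw [inv_le_comm₀ (by positivity) hδ]
    exact (le_max_left _ _).trans (le_max_right _ _)
  · gcongr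
    exact h2.trans ((le_max_right _ _).trans (le_max_right _ _))

end TameRates

/-! ## The rate function of a volume -/

section Volume

variable {V : Type*}

theorem configWeight_congr (c : V → ℕ → ℝ) {Λ : Finset V} {η ξ : V → ℕ}
    (h : ∀ x ∈ Λ, η x = ξ x) : configWeight c Λ η = configWeight c Λ ξ :=
  prod_congr rfl fun x hx => by rw [h x hx]

variable [DecidableEq V]

/-- The canonical partition function of a volume with `k` particles. -/
noncomputable def volumeWeight (c : V → ℕ → ℝ) (Λ : Finset V) (k : ℕ) : ℝ :=
  ∑ η ∈ piAntidiag Λ k, configWeight c Λ η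

/-- The effective rate of a volume: `|Λ|` times the canonical mean of one of its rates. -/
noncomputable def volumeRate (c : V → ℕ → ℝ) (Λ : Finset V) : ℕ → ℝ
  | 0 => 0
  | k + 1 => #Λ * volumeWeight c Λ k / volumeWeight c Λ (k + 1)

/-- Restriction to `A` and to `B`, extended by zero, is a bijection onto pairs of configurations,
and the weight factorises. -/
theorem sum_fiber_configWeight (c : V → ℕ → ℝ) {A B : Finset V} (hd : Disjoint A B) (k l : ℕ) :
    ∑ η ∈ (piAntidiag (A ∪ B) (k + l)).filter (fun η => ∑ x ∈ A, η x = k),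
      configWeight c (A ∪ B) η = volumeWeight c A k * volumeWeight c B l := by
  have hAB : ∀ x ∈ A, x ∉ B := fun x hx => disjoint_left.1 hd hx
  have hBA : ∀ x ∈ B, x ∉ A := fun x hx => disjoint_right.1 hd hx
  rw [volumeWeight, volumeWeight, sum_mul_sum, ← sum_product']
  refine sum_nbij' (fun η => (fun x => if x ∈ A then η x else 0, fun x => if x ∈ B then η x else 0))
    (fun p => p.1 + p.2) ?_ ?_ ?_ ?_ ?_
  · intro η hη
    rw [mem_filter, mem_piAntidiag, sum_union hd] at hη
    obtain ⟨⟨h1, h2⟩, h3⟩ := hη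
    rw [mem_product, mem_piAntidiag, mem_piAntidiag]
    refine ⟨⟨?_, fun x hx => ?_⟩, ⟨?_, fun x hx => ?_⟩⟩
    · rw [← h3]; exact sum_congr rfl fun x hx => if_pos hx
    · by_contra h; simp [h] at hx
    · rw [show l = ∑ x ∈ B, η x by omega]; exact sum_congr rfl fun x hx => if_pos hx
    · by_contra h; simp [h] at hx
  · rintro ⟨f, g⟩ hp
    rw [mem_product, mem_piAntidiag, mem_piAntidiag] at hp
    obtain ⟨⟨h1, h2⟩, h3, h4⟩ := hp
    simp only at h1 h2 h3 h4
    have hg : ∀ x ∈ A, g x = 0 := fun x hx => by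
      by_contra h; exact hAB x hx (h4 x h)
    have hf : ∀ x ∈ B, f x = 0 := fun x hx => by
      by_contra h; exact hBA x hx (h2 x h)
    have e1 : ∑ x ∈ A, (f + g) x = k := by
      rw [← h1]; exact sum_congr rfl fun x hx => by simp [hg x hx]
    have e2 : ∑ x ∈ B, (f + g) x = l := by
      rw [← h3]; exact sum_congr rfl fun x hx => by simp [hf x hx]
    rw [mem_filter, mem_piAntidiag, sum_union hd, e1, e2]
    refine ⟨⟨rfl, fun x hx => ?_⟩, rfl⟩
    rw [mem_union]
    by_contra h
    rw [not_or] at h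
    have h5 : f x = 0 := by by_contra h6; exact h.1 (h2 x h6)
    have h7 : g x = 0 := by by_contra h6; exact h.2 (h4 x h6)
    simp [h5, h7] at hx
  · intro η hη
    rw [mem_filter, mem_piAntidiag] at hη
    funext x
    simp only [Pi.add_apply]
    by_cases hA : x ∈ A
    · simp [hA, hAB x hA]
    · by_cases hB : x ∈ B
      · simp [hA, hB]
      · have : η x = 0 := by
          by_contra h
          rcases mem_union.1 (hη.1.2 x h) with h | h
          · exact hA h
          · exact hB h
        simp [hA, hB, this]
  · rintro ⟨f, g⟩ hp
    rw [mem_product, mem_piAntidiag, mem_piAntidiag] at hp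
    obtain ⟨⟨h1, h2⟩, h3, h4⟩ := hp
    simp only at h1 h2 h3 h4
    refine Prod.ext (funext fun x => ?_) (funext fun x => ?_)
    · by_cases hx : x ∈ A
      · have : g x = 0 := by by_contra h; exact hAB x hx (h4 x h)
        simp [hx, this]
      · have : f x = 0 := by by_contra h; exact hx (h2 x h)
        simp [hx, this]
    · by_cases hx : x ∈ B
      · have : f x = 0 := by by_contra h; exact hBA x hx (h2 x h)
        simp [hx, this]
      · have : g x = 0 := by by_contra h; exact hx (h4 x h)
        simp [hx, this]
  · intro η _
    rw [configWeight, prod_union hd]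
    congr 1
    · exact configWeight_congr c fun x hx => by simp [hx]
    · exact configWeight_congr c fun x hx => by simp [hx]

theorem volumeWeight_union (c : V → ℕ → ℝ) {A B : Finset V} (hd : Disjoint A B) (r : ℕ) :
    volumeWeight c (A ∪ B) r =
      ∑ k ∈ range (r + 1), volumeWeight c A k * volumeWeight c B (r - k) := by
  rw [volumeWeight, ← sum_fiberwise_of_maps_to (s := piAntidiag (A ∪ B) r) (t := range (r + 1))
    (g := fun η => ∑ x ∈ A, η x)]
  · refine sum_congr rfl fun k hk => ?_
    have hk' := mem_range.1 hk
    rw [← sum_fiber_configWeight c hd, show k + (r - k) = r by omega]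
  · intro η hη
    rw [mem_piAntidiag, sum_union hd] at hη
    exact mem_range.2 (by omega)

theorem volumeWeight_singleton (c : V → ℕ → ℝ) (x : V) (k : ℕ) :
    volumeWeight c {x} k = (rateFactorial (c x) k)⁻¹ := by
  have : piAntidiag {x} k = {(Pi.single x k : V → ℕ)} := by
    ext η
    rw [mem_piAntidiag, sum_singleton, mem_singleton]
    constructor
    · rintro ⟨h1, h2⟩
      funext y
      by_cases hy : y = x
      · subst hy; simp [h1]
      · have : η y = 0 := by by_contra h; exact hy (mem_singleton.1 (h2 y h))
        simp [hy, this]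
    · rintro rfl
      refine ⟨by simp, fun y hy => ?_⟩
      by_contra h
      rw [mem_singleton] at h
      simp [h] at hy
  rw [volumeWeight, this, sum_singleton, configWeight, prod_singleton, Pi.single_eq_same]

theorem volumeWeight_zero (c : V → ℕ → ℝ) (Λ : Finset V) : volumeWeight c Λ 0 = 1 := by
  simp [volumeWeight, configWeight, rateFactorial_zero]

theorem volumeWeight_empty (c : V → ℕ → ℝ) (k : ℕ) :
    volumeWeight c ∅ k = if k = 0 then 1 else 0 := by
  rw [volumeWeight, piAntidiag_empty]
  split_ifs <;> simp [configWeight]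

variable {c : V → ℕ → ℝ} {c₁ a₁ : ℝ}

theorem volumeWeight_pos (hc : ∀ x, LinearRates c₁ a₁ (c x)) {Λ : Finset V} (hΛ : Λ.Nonempty)
    (k : ℕ) : 0 < volumeWeight c Λ k := by
  obtain ⟨a, ha⟩ := hΛ
  refine sum_pos (fun η _ => configWeight_pos (fun x k => (hc x).succ_pos k) Λ η)
    ⟨Pi.single a k, mem_piAntidiag.2 ⟨by simp [Pi.single_apply, ha], fun i hi => ?_⟩⟩
  have : i = a := by
    by_contra h
    simp [h] at hi
  rwa [this]

/-- Induction on the sites: adding a site convolves the weights, so the generating functions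
multiply by the Cauchy product. -/
theorem hasSum_volumeWeight (hc : ∀ x, LinearRates c₁ a₁ (c x)) (Λ : Finset V) {φ : ℝ}
    (hφ : 0 ≤ φ) :
    HasSum (fun k => φ ^ k * volumeWeight c Λ k) (∏ x ∈ Λ, sitePartition (c x) φ) := by
  have hnn : ∀ (Λ : Finset V) k, 0 ≤ volumeWeight c Λ k := fun Λ k =>
    sum_nonneg fun η _ => (configWeight_pos (fun x k => (hc x).succ_pos k) Λ η).le
  induction Λ using Finset.induction_on with
  | empty =>
    rw [prod_empty]
    convert hasSum_ite_eq (0 : ℕ) (1 : ℝ) using 2 with k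
    rw [volumeWeight_empty]
    split_ifs with h <;> simp [h]
  | insert x Λ hx ih =>
    rw [prod_insert hx]
    have hs := (hc x).summable_partition hφ
    have hns : Summable fun k => ‖φ ^ k / rateFactorial (c x) k‖ := hs.norm
    have hnW : Summable fun k => ‖φ ^ k * volumeWeight c Λ k‖ := ih.summable.norm
    have h1 := tsum_mul_tsum_eq_tsum_sum_antidiagonal_of_summable_norm hns hnW
    have h2 := (summable_norm_sum_mul_antidiagonal_of_summable_norm hns hnW).of_norm.hasSum
    rw [← h1, ih.tsum_eq] at h2
    refine h2.congr_fun fun k => ?_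
    rw [insert_eq, volumeWeight_union c (disjoint_singleton_left.2 hx),
      Nat.sum_antidiagonal_eq_sum_range_succ (fun i j => φ ^ i / rateFactorial (c x) i *
        (φ ^ j * volumeWeight c Λ j)), mul_sum]
    refine sum_congr rfl fun i hi => ?_
    have hi' : i ≤ k := Nat.lt_succ_iff.1 (mem_range.1 hi)
    rw [volumeWeight_singleton]
    conv_lhs => rw [← Nat.add_sub_of_le hi', pow_add]
    rw [Nat.add_sub_cancel_left]
    ring

/-- Removing a particle at `x` trades the rate at `x` for a shift of the configuration. -/
theorem sum_rate_mul_configWeight (hc : ∀ x, LinearRates c₁ a₁ (c x)) {Λ : Finset V} {x : V}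
    (hx : x ∈ Λ) (k : ℕ) (g : (V → ℕ) → ℝ) :
    ∑ η ∈ piAntidiag Λ (k + 1), c x (η x) * g η * configWeight c Λ η =
      ∑ ξ ∈ piAntidiag Λ k, g (ξ + Pi.single x 1) * configWeight c Λ ξ := by
  have hz : ∀ η ∈ piAntidiag Λ (k + 1), c x (η x) * g η * configWeight c Λ η ≠ 0 → η x ≠ 0 := by
    intro η _ h h0
    rw [h0, (hc x).zero] at h
    simp at h
  rw [← sum_filter_of_ne hz]
  refine sum_nbij' (fun η => η - Pi.single x 1) (fun ξ => ξ + Pi.single x 1) ?_ ?_ ?_ ?_ ?_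
  · intro η hη
    rw [mem_filter, mem_piAntidiag] at hη
    obtain ⟨⟨h1, h2⟩, h3⟩ := hη
    rw [mem_piAntidiag]
    constructor
    · have e : ∑ y ∈ Λ, η y = ∑ y ∈ Λ, ((η - Pi.single x 1 : V → ℕ) y + (Pi.single x 1 : V → ℕ) y) := by
        refine sum_congr rfl fun y _ => ?_
        by_cases hy : y = x
        · subst hy; simp; omega
        · simp [hy]
      rw [h1, sum_add_distrib] at e
      have : ∑ y ∈ Λ, (Pi.single x 1 : V → ℕ) y = 1 := by simp [Pi.single_apply, hx]
      rw [this] at e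
      exact (Nat.succ.inj e).symm
    · intro y hy
      refine h2 y fun h0 => hy ?_
      simp [h0]
  · intro ξ hξ
    rw [mem_piAntidiag] at hξ
    rw [mem_filter, mem_piAntidiag]
    refine ⟨⟨?_, fun y hy => ?_⟩, by simp⟩
    · simp [sum_add_distrib, hξ.1, Pi.single_apply, hx]
    · by_cases h : y = x
      · rwa [h]
      · refine hξ.2 y ?_
        simpa [h] using hy
  · intro η hη
    rw [mem_filter] at hη
    funext y
    by_cases hy : y = x
    · subst hy
      have := hη.2
      simp
      omega
    · simp [hy]
  · intro ξ _
    funext y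
    simp
  · intro η hη
    rw [mem_filter] at hη
    obtain ⟨m, hm⟩ := Nat.exists_eq_succ_of_ne_zero hη.2
    have e : η - Pi.single x 1 + Pi.single x 1 = η := by
      funext y
      by_cases hy : y = x
      · subst hy; simp; omega
      · simp [hy]
    rw [e]
    have hw : c x (η x) * configWeight c Λ η = configWeight c Λ (η - Pi.single x 1) := by
      rw [configWeight, configWeight, ← mul_prod_erase _ _ hx, ← mul_prod_erase _ _ hx, ← mul_assoc]
      congr 1
      · have e2 : (η - Pi.single x 1 : V → ℕ) x = m := by simp [hm]
        rw [e2, hm, Nat.succ_eq_add_one, rateFactorial_succ]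
        have := ((hc x).fact_pos m).ne'
        have := ((hc x).succ_pos m).ne'
        field_simp
      · refine prod_congr rfl fun y hy => ?_
        simp [(mem_erase.1 hy).1]
    rw [← hw]
    ring

theorem sum_totalRate_mul (hc : ∀ x, LinearRates c₁ a₁ (c x)) (Λ : Finset V) (k : ℕ)
    (g : (V → ℕ) → ℝ) :
    ∑ η ∈ piAntidiag Λ (k + 1), (∑ x ∈ Λ, c x (η x)) * g η * configWeight c Λ η =
      ∑ x ∈ Λ, ∑ ξ ∈ piAntidiag Λ k, g (ξ + Pi.single x 1) * configWeight c Λ ξ := by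
  rw [sum_congr rfl fun x hx => (sum_rate_mul_configWeight hc hx k g).symm, sum_comm]
  refine sum_congr rfl fun η _ => ?_
  rw [sum_mul, sum_mul]

/-- Identifies the effective rate with the canonical mean of the total rate, so that bounds on
configurations pass to it. -/
theorem sum_totalRate (hc : ∀ x, LinearRates c₁ a₁ (c x)) (Λ : Finset V) (k : ℕ) :
    ∑ η ∈ piAntidiag Λ (k + 1), (∑ x ∈ Λ, c x (η x)) * configWeight c Λ η =
      #Λ * volumeWeight c Λ k := by
  have := sum_totalRate_mul hc Λ k fun _ => 1
  simpa [volumeWeight] using this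

theorem volumeRate_linear (hc : ∀ x, LinearRates c₁ a₁ (c x)) {Λ : Finset V} (hΛ : Λ.Nonempty) :
    LinearRates c₁ a₁ (volumeRate c Λ) := by
  have hw := fun η => (configWeight_pos (fun x k => (hc x).succ_pos k) Λ η).le
  obtain ⟨x₀, hx₀⟩ := id hΛ
  refine ⟨(hc x₀).pos, rfl, fun k => ?_, fun k => ?_⟩
  · rcases k with _ | k
    · simp [volumeRate]
    · rw [volumeRate, le_div_iff₀ (volumeWeight_pos hc hΛ _), ← sum_totalRate hc, volumeWeight,
        mul_sum]
      refine sum_le_sum fun η hη => mul_le_mul_of_nonneg_right ?_ (hw η)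
      rw [← (mem_piAntidiag.1 hη).1]
      push_cast
      rw [mul_sum]
      exact sum_le_sum fun x _ => (hc x).lower _
  · rcases k with _ | k
    · simp [volumeRate]
    · rw [volumeRate, div_le_iff₀ (volumeWeight_pos hc hΛ _), ← sum_totalRate hc, volumeWeight,
        mul_sum]
      refine sum_le_sum fun η hη => mul_le_mul_of_nonneg_right ?_ (hw η)
      rw [← (mem_piAntidiag.1 hη).1]
      push_cast
      rw [mul_sum]
      exact sum_le_sum fun x _ => (hc x).upper _

/-- The effective rate inherits the upper Lipschitz bound, because the canonical variance of the
total rate is nonnegative. -/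
theorem volumeRate_step (hc : ∀ x, LinearRates c₁ a₁ (c x))
    (hL : ∀ x k, c x (k + 1) ≤ c x k + a₁) {Λ : Finset V} (hΛ : Λ.Nonempty) (k : ℕ) :
    volumeRate c Λ (k + 1) ≤ volumeRate c Λ k + a₁ := by
  have hlin := volumeRate_linear hc hΛ
  rcases k with _ | k
  · have := hlin.upper 1
    rw [hlin.zero]
    simpa using this
  have hw := fun η => (configWeight_pos (fun x k => (hc x).succ_pos k) Λ η).le
  have hW := volumeWeight_pos hc hΛ
  have hn : (0 : ℝ) < #Λ := by exact_mod_cast hΛ.card_pos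
  set G : (V → ℕ) → ℝ := fun η => ∑ x ∈ Λ, c x (η x) with hG
  -- One factor `G` is traded for an added particle, which raises the other by at most `a₁`.
  -- Cauchy–Schwarz then compares this second moment with the square of the mean.
  have hsq : ∑ η ∈ piAntidiag Λ (k + 2), G η * G η * configWeight c Λ η ≤
      #Λ * (#Λ * volumeWeight c Λ k + a₁ * volumeWeight c Λ (k + 1)) := by
    rw [sum_totalRate_mul hc Λ (k + 1) G, ← nsmul_eq_mul]
    refine sum_le_card_nsmul _ _ _ fun x hx => ?_
    rw [← sum_totalRate hc, volumeWeight, mul_sum, ← sum_add_distrib]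
    refine sum_le_sum fun ξ _ => ?_
    rw [← add_mul]
    refine mul_le_mul_of_nonneg_right ?_ (hw ξ)
    rw [hG]
    simp only
    rw [← add_sum_erase _ _ hx, ← add_sum_erase _ _ hx]
    have e : ∑ y ∈ Λ.erase x, c y ((ξ + Pi.single x 1 : V → ℕ) y) = ∑ y ∈ Λ.erase x, c y (ξ y) :=
      sum_congr rfl fun y hy => by simp [(mem_erase.1 hy).1]
    have h1 := hL x (ξ x)
    rw [e]
    simp only [Pi.add_apply, Pi.single_eq_same]
    linarith
  have hcs : (∑ η ∈ piAntidiag Λ (k + 2), G η * configWeight c Λ η) ^ 2 ≤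
      (∑ η ∈ piAntidiag Λ (k + 2), G η * G η * configWeight c Λ η) *
        ∑ η ∈ piAntidiag Λ (k + 2), configWeight c Λ η :=
    sum_sq_le_sum_mul_sum_of_sq_le_mul _
      (fun η _ => mul_nonneg (mul_self_nonneg _) (hw η)) (fun η _ => hw η)
      fun η _ => le_of_eq (by ring)
  rw [sum_totalRate hc Λ (k + 1)] at hcs
  have hcs2 := hcs.trans (mul_le_mul_of_nonneg_right hsq (hW (k + 2)).le)
  rw [volumeRate, volumeRate, div_le_iff₀ (hW _)]
  have hW1 := hW (k + 1)
  have h3 : (#Λ : ℝ) * volumeWeight c Λ (k + 1) * (#Λ * volumeWeight c Λ (k + 1)) ≤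
      (#Λ * volumeWeight c Λ k / volumeWeight c Λ (k + 1) + a₁) * volumeWeight c Λ (k + 1 + 1) *
        (#Λ * volumeWeight c Λ (k + 1)) := by
    have e : (#Λ * volumeWeight c Λ k / volumeWeight c Λ (k + 1) + a₁) *
        volumeWeight c Λ (k + 1 + 1) * (#Λ * volumeWeight c Λ (k + 1)) =
        #Λ * (#Λ * volumeWeight c Λ k + a₁ * volumeWeight c Λ (k + 1)) *
          volumeWeight c Λ (k + 2) := by
      field_simp
    rw [e, ← sq]
    exact hcs2
  exact le_of_mul_le_mul_right h3 (by positivity)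

/-- The product telescopes, so a volume enters the canonical law as a single site would. -/
theorem rateFactorial_volumeRate (hc : ∀ x, LinearRates c₁ a₁ (c x)) {Λ : Finset V}
    (hΛ : Λ.Nonempty) (k : ℕ) :
    rateFactorial (volumeRate c Λ) k = (#Λ : ℝ) ^ k / volumeWeight c Λ k := by
  induction k with
  | zero => simp [rateFactorial_zero, volumeWeight_zero]
  | succ k ih =>
    have h1 := (volumeWeight_pos hc hΛ k).ne'
    have h2 := (volumeWeight_pos hc hΛ (k + 1)).ne'
    rw [rateFactorial_succ, ih, volumeRate]
    field_simp
    ring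

theorem sitePartition_volumeRate (hc : ∀ x, LinearRates c₁ a₁ (c x)) {Λ : Finset V}
    (hΛ : Λ.Nonempty) {φ : ℝ} (hφ : 0 ≤ φ) :
    sitePartition (volumeRate c Λ) φ = ∏ x ∈ Λ, sitePartition (c x) (φ / #Λ) := by
  rw [← (hasSum_volumeWeight hc Λ (φ := φ / #Λ) (by positivity)).tsum_eq, sitePartition]
  refine tsum_congr fun k => ?_
  have h1 := (volumeWeight_pos hc hΛ k).ne'
  have hn : (#Λ : ℝ) ≠ 0 := by exact_mod_cast hΛ.card_pos.ne'
  rw [rateFactorial_volumeRate hc hΛ, div_pow]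
  field_simp

theorem logPartition_volumeRate (hc : ∀ x, LinearRates c₁ a₁ (c x)) {Λ : Finset V}
    (hΛ : Λ.Nonempty) (t : ℝ) :
    logPartition (volumeRate c Λ) t = ∑ x ∈ Λ, logPartition (c x) (t - Real.log #Λ) := by
  have hn : (0 : ℝ) < #Λ := by exact_mod_cast hΛ.card_pos
  rw [logPartition, sitePartition_volumeRate hc hΛ (Real.exp_pos t).le, Real.log_prod]
  · simp only [logPartition, Real.exp_sub, Real.exp_log hn]
  · intro x _
    exact ((hc x).partition_pos (by positivity)).ne'

/-- The constant `K` is preserved: there are `|Λ|` sites, each at chemical potential `t - log |Λ|`,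
and each contributes `K e^t / |Λ|`. -/
theorem volumeRate_tame (hc : ∀ x, LinearRates c₁ a₁ (c x))
    (hL : ∀ x k, c x (k + 1) ≤ c x k + a₁) {K : ℝ}
    (hK : ∀ x, ConvexOn ℝ Set.univ fun t => K * Real.exp t - logPartition (c x) t)
    {Λ : Finset V} (hΛ : Λ.Nonempty) : TameRates c₁ a₁ K (volumeRate c Λ) := by
  refine { toLinearRates := volumeRate_linear hc hΛ, step := volumeRate_step hc hL hΛ, convex := ?_ }
  have hn : (0 : ℝ) < #Λ := by exact_mod_cast hΛ.card_pos
  have e : (fun t => K * Real.exp t - logPartition (volumeRate c Λ) t) = fun t =>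
      ∑ x ∈ Λ, (K * Real.exp (t - Real.log #Λ) - logPartition (c x) (t - Real.log #Λ)) := by
    funext t
    rw [logPartition_volumeRate hc hΛ, sum_sub_distrib, sum_const, nsmul_eq_mul, Real.exp_sub,
      Real.exp_log hn]
    field_simp
  rw [e]
  refine ⟨convex_univ, fun s _ t _ a b ha hb hab => ?_⟩
  simp only [smul_eq_mul]
  rw [mul_sum, mul_sum, ← sum_add_distrib]
  refine sum_le_sum fun x _ => ?_
  have h := (hK x).2 (Set.mem_univ (s - Real.log #Λ)) (Set.mem_univ (t - Real.log #Λ)) ha hb hab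
  simp only [smul_eq_mul] at h
  rwa [show a * (s - Real.log #Λ) + b * (t - Real.log #Λ) = a * s + b * t - Real.log #Λ by
    have : b = 1 - a := by linarith
    rw [this]; ring] at h

theorem halfLaw_eq (c : V → ℕ → ℝ) {A B : Finset V} (hd : Disjoint A B) {r k : ℕ} (hk : k ≤ r) :
    halfLaw c A B r k =
      volumeWeight c A k * volumeWeight c B (r - k) / volumeWeight c (A ∪ B) r := by
  have h := sum_fiber_configWeight c hd k (r - k)
  rw [Nat.add_sub_of_le hk] at h
  rw [← h, sum_div]
  rfl

end Volume

/-! ## Logarithmic Sobolev inequality for the splitting law -/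

theorem LinearRates.of_lipschitz {c₁ a₁ : ℝ} {u : ℕ → ℝ} (hc : 0 < c₁) (h0 : u 0 = 0)
    (hl : ∀ k : ℕ, c₁ * k ≤ u k) (hL : ∀ k, |u (k + 1) - u k| ≤ a₁) : LinearRates c₁ a₁ u := by
  refine ⟨hc, h0, hl, fun k => ?_⟩
  induction k with
  | zero => simp [h0]
  | succ k ih =>
    have := (abs_le.1 (hL k)).2
    push_cast
    linarith

/-- The law of the first of two particle numbers with sum `r` and effective rates `u` and `v`. -/
noncomputable def splitLaw (u v : ℕ → ℝ) (r k : ℕ) : ℝ :=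
  (rateFactorial u k)⁻¹ * (rateFactorial v (r - k))⁻¹ /
    ∑ j ∈ range (r + 1), (rateFactorial u j)⁻¹ * (rateFactorial v (r - j))⁻¹

section SplitLaw

variable {c₁ a₁ : ℝ} {u v : ℕ → ℝ}

theorem sum_inv_rateFactorial_pos (hu : LinearRates c₁ a₁ u) (hv : LinearRates c₁ a₁ v) (r : ℕ) :
    0 < ∑ j ∈ range (r + 1), (rateFactorial u j)⁻¹ * (rateFactorial v (r - j))⁻¹ :=
  sum_pos (fun j _ => mul_pos (inv_pos.2 (hu.fact_pos j)) (inv_pos.2 (hv.fact_pos _)))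
    ⟨0, by simp⟩

theorem sum_splitLaw (hu : LinearRates c₁ a₁ u) (hv : LinearRates c₁ a₁ v) (r : ℕ) :
    ∑ k ∈ range (r + 1), splitLaw u v r k = 1 := by
  simp only [splitLaw]
  rw [← sum_div, div_self (sum_inv_rateFactorial_pos hu hv r).ne']

/-- Comparison with factorials: the numerator is at least `1/(a₁^r r!)`, and the binomial theorem
bounds the normalisation by `2^r/(c₁^r r!)`. -/
theorem pow_le_splitLaw (hu : LinearRates c₁ a₁ u) (hv : LinearRates c₁ a₁ v) (ha : 0 < a₁)
    {r k : ℕ} (hk : k ≤ r) : (c₁ / (2 * a₁)) ^ r ≤ splitLaw u v r k := by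
  have hc := hu.pos
  have hr : (0 : ℝ) < r.factorial := by exact_mod_cast r.factorial_pos
  have hS : ∑ j ∈ range (r + 1), (rateFactorial u j)⁻¹ * (rateFactorial v (r - j))⁻¹ ≤
      2 ^ r / (c₁ ^ r * r.factorial) := by
    have h2 : (2 : ℝ) ^ r = ∑ j ∈ range (r + 1), (r.choose j : ℝ) := by
      exact_mod_cast (Nat.sum_range_choose r).symm
    rw [h2, sum_div]
    refine sum_le_sum fun j hj => ?_
    have hj' : j ≤ r := Nat.lt_succ_iff.1 (mem_range.1 hj)
    have h3 := hu.pow_mul_factorial_le j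
    have h4 := hv.pow_mul_factorial_le (r - j)
    have hjp : (0 : ℝ) < j.factorial := by exact_mod_cast j.factorial_pos
    have hrp : (0 : ℝ) < (r - j).factorial := by exact_mod_cast (r - j).factorial_pos
    rw [Nat.cast_choose ℝ hj']
    calc (rateFactorial u j)⁻¹ * (rateFactorial v (r - j))⁻¹
        ≤ (c₁ ^ j * j.factorial)⁻¹ * (c₁ ^ (r - j) * (r - j).factorial)⁻¹ := by
          have := hv.fact_pos (r - j)
          gcongr
      _ = _ := by
          conv_rhs => rw [← Nat.add_sub_of_le hj', pow_add, Nat.add_sub_cancel_left]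
          field_simp
  have hw : (a₁ ^ r * r.factorial)⁻¹ ≤ (rateFactorial u k)⁻¹ * (rateFactorial v (r - k))⁻¹ := by
    rw [← mul_inv]
    have h3 := hu.le_pow_mul_factorial k
    have h4 := hv.le_pow_mul_factorial (r - k)
    have h5 := hu.fact_pos k
    have h6 := hv.fact_pos (r - k)
    have h7 : (k.factorial * (r - k).factorial : ℝ) ≤ r.factorial := by
      exact_mod_cast Nat.le_of_dvd r.factorial_pos (Nat.factorial_mul_factorial_dvd_factorial hk)
    refine inv_anti₀ (mul_pos h5 h6) ?_
    calc rateFactorial u k * rateFactorial v (r - k)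
        ≤ (a₁ ^ k * k.factorial) * (a₁ ^ (r - k) * (r - k).factorial) := by gcongr
      _ = a₁ ^ (k + (r - k)) * (k.factorial * (r - k).factorial) := by rw [pow_add]; ring
      _ ≤ a₁ ^ r * r.factorial := by rw [Nat.add_sub_of_le hk]; gcongr
  rw [splitLaw, le_div_iff₀ (sum_inv_rateFactorial_pos hu hv r)]
  calc _ ≤ (c₁ / (2 * a₁)) ^ r * (2 ^ r / (c₁ ^ r * r.factorial)) := by gcongr
    _ = (a₁ ^ r * r.factorial)⁻¹ := by rw [div_pow, mul_pow]; field_simp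
    _ ≤ _ := hw

theorem exists_splitLaw_logSobolev {K : ℝ} (hc : 0 < c₁) (hca : c₁ ≤ a₁) (hK : 0 < K) :
    ∃ C : ℝ, 0 < C ∧ ∀ u v : ℕ → ℝ, TameRates c₁ a₁ K u → TameRates c₁ a₁ K v →
      ∀ r : ℕ, 1 ≤ r → ∀ ψ : ℕ → ℝ, (∀ k ≤ r, 0 ≤ ψ k) →
        chainEntropy r (splitLaw u v r) ψ ≤ C * r * ∑ k ∈ range r,
          min (splitLaw u v r (k + 1)) (splitLaw u v r k) * (√(ψ (k + 1)) - √(ψ k)) ^ 2 := by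
  have ha : 0 < a₁ := hc.trans_le hca
  obtain ⟨A, hA, hbound⟩ := TameRates.exists_inv_rateFactorial_bounds hc ha hK.le
  have hA0 : 0 < A := by linarith
  set η := min 1 (1 / (4 * K * a₁)) with hη
  have hη0 : 0 < η := by positivity
  have hηK : 4 * K * a₁ * η ≤ 1 := by
    have h := min_le_right 1 (1 / (4 * K * a₁))
    rw [← hη, le_div_iff₀ (by positivity)] at h
    linarith
  have hD : 0 ≤ Real.log (2 * a₁ / c₁) := by
    refine Real.log_nonneg ?_
    rw [le_div_iff₀ hc]
    linarith
  -- Each of the two factors costs `A`, and `log (2 a₁/c₁)` is the exponential rate in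
  -- `pow_le_splitLaw`. The two conjugates together have curvature `2η/r`, of which `η/r` is enough.
  obtain ⟨C, hC, hLS⟩ := chain_logSobolev hη0 (one_le_mul_of_one_le_of_one_le hA hA) hD
  refine ⟨C, hC, fun u v hu hv r hr ψ hψ => ?_⟩
  set S := ∑ j ∈ range (r + 1), (rateFactorial u j)⁻¹ * (rateFactorial v (r - j))⁻¹ with hSdef
  have hS : 0 < S := sum_inv_rateFactorial_pos hu.toLinearRates hv.toLinearRates r
  have hexp : ∀ i, Real.exp (-(-legendre u i - legendre v (r - i) + Real.log S)) =
      Real.exp (legendre u i) * Real.exp (legendre v (r - i)) / S := fun i => by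
    rw [show -(-legendre u i - legendre v (r - i) + Real.log S) =
      legendre u i + legendre v (r - i) - Real.log S by ring, Real.exp_sub, Real.exp_add,
      Real.exp_log hS]
  refine hLS r hr (splitLaw u v r) (fun i => -legendre u i - legendre v (r - i) + Real.log S)
    (fun i _ => ?_) (fun i _ => ?_) (fun i hi => ?_)
    (sum_splitLaw hu.toLinearRates hv.toLinearRates r) (fun i hi => ?_) ψ hψ
  · rw [hexp, splitLaw, ← mul_div_assoc, mul_inv]
    refine div_le_div_of_nonneg_right ?_ hS.le
    calc _ = (A⁻¹ * Real.exp (legendre u i)) * (A⁻¹ * Real.exp (legendre v (r - i))) := by ring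
      _ ≤ _ := mul_le_mul (hbound u hu i).1 (hbound v hv (r - i)).1 (by positivity)
          (inv_pos.2 (hu.fact_pos i)).le
  · rw [hexp, splitLaw, ← mul_div_assoc]
    refine div_le_div_of_nonneg_right ?_ hS.le
    calc _ ≤ (A * Real.exp (legendre u i)) * (A * Real.exp (legendre v (r - i))) :=
          mul_le_mul (hbound u hu i).2 (hbound v hv (r - i)).2 (inv_pos.2 (hv.fact_pos _)).le
            (by positivity)
      _ = _ := by ring
  · obtain ⟨m, rfl⟩ := Nat.exists_eq_add_of_le hi
    have h1 := hu.legendre_second_diff hK.le (k := i) (r := ((i + 2 + m : ℕ) : ℝ))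
      (by push_cast; linarith [m.cast_nonneg (α := ℝ)]) hη0.le (min_le_left _ _) hηK
    have h2 := hv.legendre_second_diff hK.le (k := m) (r := ((i + 2 + m : ℕ) : ℝ))
      (by push_cast; linarith [i.cast_nonneg (α := ℝ)]) hη0.le (min_le_left _ _) hηK
    have h3 : 0 ≤ η / ((i + 2 + m : ℕ) : ℝ) := by positivity
    rw [show i + 2 + m - (i + 2) = m by omega, show i + 2 + m - (i + 1) = m + 1 by omega,
      show i + 2 + m - i = m + 2 by omega]
    linarith
  · refine le_of_eq_of_le ?_ (pow_le_splitLaw hu.toLinearRates hv.toLinearRates ha hi)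
    rw [← neg_mul, ← Real.log_inv, inv_div, mul_comm, Real.exp_nat_mul,
      Real.exp_log (by positivity)]

end SplitLaw

/-- Equal cardinalities make `|A|^k |B|^{r-k}` independent of `k`, so it cancels against the
normalisation. -/
theorem halfLaw_eq_splitLaw {V : Type*} [DecidableEq V] {c : V → ℕ → ℝ} {c₁ a₁ : ℝ}
    (hc : ∀ x, LinearRates c₁ a₁ (c x)) {A B : Finset V} (hd : Disjoint A B) (hAB : #A = #B)
    (hA : A.Nonempty) {r k : ℕ} (hk : k ≤ r) :
    halfLaw c A B r k = splitLaw (volumeRate c A) (volumeRate c B) r k := by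
  have hn : (0 : ℝ) < #A := by exact_mod_cast hA.card_pos
  have hB : B.Nonempty := card_pos.1 (hAB ▸ hA.card_pos)
  have h : ∀ j ≤ r, (rateFactorial (volumeRate c A) j)⁻¹ *
      (rateFactorial (volumeRate c B) (r - j))⁻¹ =
        volumeWeight c A j * volumeWeight c B (r - j) / (#A : ℝ) ^ r := by
    intro j hj
    rw [rateFactorial_volumeRate hc hA, rateFactorial_volumeRate hc hB, ← hAB, inv_div, inv_div,
      div_mul_div_comm, ← pow_add, Nat.add_sub_of_le hj]
  rw [halfLaw_eq c hd hk, splitLaw, h k hk,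
    sum_congr rfl fun j hj => h j (Nat.lt_succ_iff.1 (mem_range.1 hj)), ← sum_div,
    ← volumeWeight_union c hd, div_div_div_cancel_right₀ (by positivity)]

theorem mainTheorem4 (a₁ a₂ c₁ : ℝ) (k₀ : ℕ) (e₁ e₂ : ℕ → ℝ) :
    ∃ C : ℝ, 0 < C ∧
      ∀ (d : ℕ) (c : (Fin d → ℤ) → ℕ → ℝ),
        AdmissibleRates c₁ c → LipschitzGrowth a₁ c → WeakMonotone a₂ k₀ c →
        ∀ Λ₁ Λ₂ : Finset (Fin d → ℤ),
          Disjoint Λ₁ Λ₂ → Λ₁.card = Λ₂.card → Λ₁.Nonempty →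
          ConditionE e₁ e₂ c Λ₁ → ConditionE e₁ e₂ c Λ₂ → ConditionE e₁ e₂ c (Λ₁ ∪ Λ₂) →
          ∀ (r : ℕ) (ψ : ℕ → ℝ), (∀ k ≤ r, 0 ≤ ψ k) →
            chainEntropy r (halfLaw c Λ₁ Λ₂ r) ψ ≤
              C * (r : ℝ) * bdDirichlet r (halfLaw c Λ₁ Λ₂ r) (fun k => √(ψ k)) := by
  -- `C` is chosen before the rates. If the constants violate these relations, no rates satisfy the
  -- hypotheses at a site of `Λ₁`, and any `C` will do.
  by_cases hpar : 0 < c₁ ∧ c₁ ≤ a₁ ∧ 0 < a₂ ∧ 0 < k₀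
  swap
  · refine ⟨1, one_pos, fun d c hadm hLG hM Λ₁ Λ₂ _ _ hne _ _ _ _ _ _ => absurd ?_ hpar⟩
    obtain ⟨x, -⟩ := hne
    refine ⟨hadm.1, ?_, hM.1, Nat.pos_of_ne_zero fun h => ?_⟩
    · have h1 := (abs_le.1 (hLG x 0)).2
      have h2 := hadm.2.2 x 1
      rw [zero_add, hadm.2.1 x] at h1
      push_cast at h2
      linarith
    · have h1 := hM.2 x 0
      rw [h, add_zero, sub_self] at h1
      exact h1.not_gt hM.1
  obtain ⟨hc₁, hca, ha₂, hk₀⟩ := hpar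
  have ha₁ : 0 < a₁ := hc₁.trans_le hca
  have hk : (0 : ℝ) < k₀ := by exact_mod_cast hk₀
  have ha : 0 < a₂ / k₀ := by positivity
  have hb : 0 ≤ a₂ + k₀ * a₁ := by positivity
  -- `K` is the variance constant of `variance_le` for the slope `a₂/k₀` and defect `a₂ + k₀ a₁`
  -- supplied by `quasiLinear_of_weakMonotone`.
  obtain ⟨C, hC, hLS⟩ := exists_splitLaw_logSobolev
    (K := (2 + 2 * (a₂ + k₀ * a₁) / c₁) / (a₂ / k₀)) hc₁ hca (by positivity)
  refine ⟨C, hC, fun d c hadm hLG hM Λ₁ Λ₂ hd hcard hne _ _ _ r ψ hψ => ?_⟩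
  have hlin : ∀ x, LinearRates c₁ a₁ (c x) := fun x =>
    .of_lipschitz hc₁ (hadm.2.1 x) (hadm.2.2 x) (hLG x)
  have hne₂ : Λ₂.Nonempty := card_pos.1 (hcard ▸ hne.card_pos)
  have hpos : ∀ x k, 0 < c x (k + 1) := fun x k => (hlin x).succ_pos k
  have hstep : ∀ x k, c x (k + 1) ≤ c x k + a₁ := fun x k => by
    linarith [(abs_le.1 (hLG x k)).2]
  have hconv := fun x => (hlin x).convexOn_sub_logPartition ha hb
    (quasiLinear_of_weakMonotone hk₀ ha₂ (hLG x) (hM.2 x))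
  have htame : ∀ {Λ : Finset (Fin d → ℤ)}, Λ.Nonempty → TameRates c₁ a₁ _ (volumeRate c Λ) :=
    fun hΛ => volumeRate_tame hlin hstep hconv hΛ
  have heq : ∀ k ≤ r, halfLaw c Λ₁ Λ₂ r k = splitLaw (volumeRate c Λ₁) (volumeRate c Λ₂) r k :=
    fun k hk => halfLaw_eq_splitLaw hlin hd hcard hne hk
  rw [bdDirichlet_eq r _ _ (fun k hk => halfLaw_pos hpos hd hne hne₂ hk)
    (halfLaw_eq_zero c hd r.lt_succ_self)]
  -- For `r = 0` the law is a point mass and both sides vanish.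
  rcases Nat.eq_zero_or_pos r with rfl | hr
  · have h1 := sum_halfLaw hpos hd hne 0
    rw [zero_add, sum_range_one] at h1
    simp [chainEntropy, chainMean, h1]
  · have hmean : ∀ f : ℕ → ℝ, chainMean r (halfLaw c Λ₁ Λ₂ r) f =
        chainMean r (splitLaw (volumeRate c Λ₁) (volumeRate c Λ₂) r) f := fun f =>
      sum_congr rfl fun k hk => by rw [heq k (Nat.lt_succ_iff.1 (mem_range.1 hk))]
    rw [chainEntropy, hmean, hmean]
    refine (hLS _ _ (htame hne) (htame hne₂) r hr ψ hψ).trans_eq ?_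
    congr 1
    refine sum_congr rfl fun k hk => ?_
    have hk' := mem_range.1 hk
    rw [heq k hk'.le, heq (k + 1) hk']
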